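/- Let $k$ be a field, $B$ a finite-dimensional Hopf algebra over $k$ whose antipode satisfies $S_B=S_B^{-1}$, and let ${}^B_B\mathcal{YD}$ be the category of left-left Yetter–Drinfeld modules over $B$, with braiding $C_{V,W}(v\otimes w)=v_{(-1)}\cdot w\otimes v_{(0)}$. For $V\in{}^B_B\mathcal{YD}$ equip $V^*=\operatorname{Hom}_k(V,k)$ with $(b\cdot f)(v)=f(S_B(b)\cdot v)$ and $f_{(-1)}\langle f_{(0)},v\rangle=S_B^{-1}(v_{(-1)})\langle f,v_{(0)}\rangle$, and let $\langle\,,\rangle:V^*\otimes V\to k$ be the evaluation. Let $H$ be a braided Hopf algebra in ${}^B_B\mathcal{YD}$, of arbitrary dimension, with multiplication $m$, comultiplication $\Delta$, counit $\epsilon$ and antipode $S$. Define * a product $m_{H^*}$ on $H^*$ by $\langle\,,\rangle(m_{H^*}\otimes H)=(\langle\,,\rangle\otimes\langle\,,\rangle)(H^*\otimes C_{H^*,H}\otimes H)(H^*\otimes H^*\otimes\Delta)$; * $\rightharpoonup\colon H\otimes H^*\to H^*$ by $\langle\,,\rangle(\rightharpoonup\otimes H)=\langle\,,\rangle(H^*\otimes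 m)(H^*\otimes C_{H,H})(C_{H,H^*}\otimes H)$; * $\leftharpoondown\colon H^*\otimes H\to H^*$ by $\langle f\leftharpoondown h,x\rangle=\langle f,\,m\,C_{H,H}(S(h)\otimes x)\rangle$; * $\int^l_{H^*}=\{f\in H^*\mid gf=g(1)f\ \text{for all } g\in H^*\}$. An $H^*$-module $(M,\alpha)$ with $M\in{}^B_B\mathcal{YD}$ is called rational if there is a morphism $\rho:M\to M\otimes H$ in ${}^B_B\mathcal{YD}$ with $(M\otimes\langle\,,\rangle)(C_{H^*,M}\otimes H)(H^*\otimes\rho)=\alpha$. Let $H^{*rat}$ be the sum of all rational $H^*$-submodules in ${}^B_B\mathcal{YD}$ of the regular module $H^*$. Then: 1. $H^*$, with product $m_{H^*}$ and unit $\epsilon$, is an algebra in ${}^B_B\mathcal{YD}$, and $\langle\,,\rangle:H^*\otimes H\to k$ is a morphism in ${}^B_B\mathcal{YD}$. 2. $\rightharpoonup$ is a morphism in ${}^B_B\mathcal{YD}$, and so is $H\otimes H^*\to H^*$, $h\otimes f\mapsto(x\mapsto f(xh))$. 3. $H^{*rat}$ is itself rational, hence it is the maximal rational $H^*$-submodule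 of $H^*$ in ${}^B_B\mathcal{YD}$. 4. If $C_{H,H}=C_{H,H}^{-1}$, then $\leftharpoondown\;=\;\rightharpoonup(S\otimes H^*)\,C_{H^*,H}$. 5. $H^{*rat}$ and $\int^l_{H^*}$ are Yetter–Drinfeld submodules of $H^*$. The map $\leftharpoondown$ restricts to $H^{*rat}\otimes H\to H^{*rat}$, and with this action and a coaction $\rho$ as in the definition of rationality $H^{*rat}$ is a right $H$-Hopf module in ${}^B_B\mathcal{YD}$, that is, in addition $\rho\leftharpoondown\;=(\leftharpoondown\otimes m)(H^{*rat}\otimes C_{H,H}\otimes H)(\rho\otimes\Delta)$. Also $\int^l_{H^*}\otimes H$ is a right $H$-Hopf module in ${}^B_B\mathcal{YD}$ with action $\int^l_{H^*}\otimes m$ and coaction $\int^l_{H^*}\otimes\Delta$, and $$H^{*rat}\;\cong\;\int^l_{H^*}\otimes H\qquad\text{as right } H\text{-Hopf modules in } {}^B_B\mathcal{YD}.$$ -/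

import Mathlib

open scoped TensorProduct

noncomputable section

/-- A `k`-linear "action" `B ⊗ V → V` together with a "coaction" `V → B ⊗ V`, written
`b ⊗ v ↦ b · v` and `v ↦ v₍₋₁₎ ⊗ v₍₀₎`.  The laws are in `YDData.IsYD`. -/
structure YDData (k B V : Type*) [Field k] [Ring B] [HopfAlgebra k B]
    [AddCommMonoid V] [Module k V] where
  act : B ⊗[k] V →ₗ[k] V
  coact : V →ₗ[k] B ⊗[k] V

namespace YDData

section General

variable {k B U V W : Type*} [Field k] [Ring B] [HopfAlgebra k B]
  [AddCommMonoid U] [Module k U] [AddCommMonoid V] [Module k V] [AddCommMonoid W] [Module k W]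

/-- Left-left Yetter–Drinfeld modules over `B`: left modules and left comodules such that
`b₁ v₍₋₁₎ ⊗ b₂ · v₍₀₎ = (b₁ · v)₍₋₁₎ b₂ ⊗ (b₁ · v)₍₀₎`. -/
structure IsYD (X : YDData k B V) : Prop where
  one_act : ∀ v : V, X.act (1 ⊗ₜ v) = v
  mul_act : ∀ (a b : B) (v : V), X.act ((a * b) ⊗ₜ v) = X.act (a ⊗ₜ X.act (b ⊗ₜ v))
  coassoc : (TensorProduct.assoc k B B V).toLinearMap ∘ₗ
      (Coalgebra.comul (R := k) (A := B)).rTensor V ∘ₗ X.coact = X.coact.lTensor B ∘ₗ X.coact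
  counit_coact : (TensorProduct.lid k V).toLinearMap ∘ₗ
      (Coalgebra.counit (R := k) (A := B)).rTensor V ∘ₗ X.coact = LinearMap.id
  compat :
    TensorProduct.map (LinearMap.mul' k B) X.act ∘ₗ
        (TensorProduct.tensorTensorTensorComm k B B B V).toLinearMap ∘ₗ
        TensorProduct.map Coalgebra.comul X.coact =
      (LinearMap.mul' k B).rTensor V ∘ₗ
        (TensorProduct.rightComm k B V B).toLinearMap ∘ₗ
        (X.coact ∘ₗ X.act).rTensor B ∘ₗ
        (TensorProduct.rightComm k B B V).toLinearMap ∘ₗ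
        (Coalgebra.comul (R := k) (A := B)).rTensor V

/-- Morphisms of Yetter–Drinfeld modules: `B`-linear and `B`-colinear maps. -/
structure IsHom (X : YDData k B V) (Y : YDData k B W) (f : V →ₗ[k] W) : Prop where
  linear : f ∘ₗ X.act = Y.act ∘ₗ f.lTensor B
  colinear : Y.coact ∘ₗ f = f.lTensor B ∘ₗ X.coact

variable (k B) in
/-- The unit object `k`, with `b · c = ε(b) c` and `c ↦ 1 ⊗ c`. -/
def unit : YDData k B k where
  act := (TensorProduct.lid k k).toLinearMap ∘ₗ
    (Coalgebra.counit (R := k) (A := B)).rTensor k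
  coact := TensorProduct.mk k B k 1

/-- `b · (v ⊗ w) = b₁ · v ⊗ b₂ · w` and `v ⊗ w ↦ v₍₋₁₎ w₍₋₁₎ ⊗ (v₍₀₎ ⊗ w₍₀₎)`. -/
def tensor (X : YDData k B V) (Y : YDData k B W) : YDData k B (V ⊗[k] W) where
  act := TensorProduct.map X.act Y.act ∘ₗ
    (TensorProduct.tensorTensorTensorComm k B B V W).toLinearMap ∘ₗ
    (Coalgebra.comul (R := k) (A := B)).rTensor (V ⊗[k] W)
  coact := (LinearMap.mul' k B).rTensor (V ⊗[k] W) ∘ₗ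
    (TensorProduct.tensorTensorTensorComm k B V B W).toLinearMap ∘ₗ
    TensorProduct.map X.coact Y.coact

/-- The braiding `C_{V,W} : v ⊗ w ↦ v₍₋₁₎ · w ⊗ v₍₀₎`. -/
def braid (X : YDData k B V) (Y : YDData k B W) : V ⊗[k] W →ₗ[k] W ⊗[k] V :=
  Y.act.rTensor V ∘ₗ (TensorProduct.rightComm k B V W).toLinearMap ∘ₗ X.coact.rTensor W

/-- `U ⊗ C_{V,W} ⊗ Z`, from `(U ⊗ V) ⊗ (W ⊗ Z)` to `(U ⊗ W) ⊗ (V ⊗ Z)`. -/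
def midBraid (X : YDData k B V) (Y : YDData k B W) (U Z : Type*) [AddCommMonoid U] [Module k U]
    [AddCommMonoid Z] [Module k Z] :
    (U ⊗[k] V) ⊗[k] (W ⊗[k] Z) →ₗ[k] (U ⊗[k] W) ⊗[k] (V ⊗[k] Z) :=
  (TensorProduct.assoc k U W (V ⊗[k] Z)).symm.toLinearMap ∘ₗ
    ((TensorProduct.assoc k W V Z).toLinearMap ∘ₗ (X.braid Y).rTensor Z ∘ₗ
      (TensorProduct.assoc k V W Z).symm.toLinearMap).lTensor U ∘ₗ
    (TensorProduct.assoc k U V (W ⊗[k] Z)).toLinearMap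

variable (k B) in
/-- The inverse `S⁻¹` of the antipode of `B` (zero if the antipode is not invertible). -/
def antipodeInv : B →ₗ[k] B :=
  Ring.inverse (M₀ := Module.End k B) (HopfAlgebra.antipode k (A := B))

/-- The dual `V^*`: `(b · f)(v) = f(S(b) · v)`, and `f ↦ ∑ᵢ S⁻¹(bᵢ) ⊗ (v ↦ bᵢ^*(v₍₋₁₎) f(v₍₀₎))`
for a basis `bᵢ` of `B` with dual basis `bᵢ^*`; see `dual_coact_eval`. -/
def dual [FiniteDimensional k B] (X : YDData k B V) : YDData k B (Module.Dual k V) where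
  act := TensorProduct.lift
    (Module.Dual.transpose (R := k) ∘ₗ TensorProduct.curry X.act ∘ₗ
      HopfAlgebra.antipode k (A := B))
  coact := ∑ i, TensorProduct.mk k B (Module.Dual k V)
      (antipodeInv k B (Module.finBasis k B i)) ∘ₗ
    Module.Dual.transpose (R := k) ((TensorProduct.lid k V).toLinearMap ∘ₗ
      ((Module.finBasis k B).coord i).rTensor V ∘ₗ X.coact)

/-- The evaluation `V^* ⊗ V → k`. -/
abbrev ev (k V : Type*) [Field k] [AddCommMonoid V] [Module k V] :
    Module.Dual k V ⊗[k] V →ₗ[k] k := contractLeft k V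

theorem dual_act_apply [FiniteDimensional k B] (X : YDData k B V) (b : B)
    (f : Module.Dual k V) (v : V) :
    X.dual.act (b ⊗ₜ f) v = f (X.act (HopfAlgebra.antipode k b ⊗ₜ v)) := rfl

/-- The coaction of the dual is the one determined by
`f₍₋₁₎ ⟨f₍₀₎, v⟩ = S⁻¹(v₍₋₁₎) ⟨f, v₍₀₎⟩`. -/
theorem dual_coact_eval [FiniteDimensional k B] (X : YDData k B V)
    (f : Module.Dual k V) (v : V) :
    TensorProduct.rid k B ((ev k V).lTensor B
        (TensorProduct.assoc k B (Module.Dual k V) V (X.dual.coact f ⊗ₜ v))) =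
      TensorProduct.rid k B (TensorProduct.map (antipodeInv k B) f (X.coact v)) := by
  have key : ∀ t : B ⊗[k] V,
      ∑ i, f (TensorProduct.lid k V (((Module.finBasis k B).coord i).rTensor V t)) •
        antipodeInv k B (Module.finBasis k B i) =
      TensorProduct.rid k B (TensorProduct.map (antipodeInv k B) f t) := by
    intro t
    induction t using TensorProduct.induction_on with
    | zero => simp
    | add x y hx hy => simp only [map_add, add_smul, Finset.sum_add_distrib, hx, hy]
    | tmul b w =>
      simp only [LinearMap.rTensor_tmul, TensorProduct.lid_tmul, map_smul, smul_eq_mul,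
        TensorProduct.map_tmul, TensorProduct.rid_tmul, Module.Basis.coord_apply]
      conv_rhs => rw [← (Module.finBasis k B).sum_repr b]
      simp only [map_sum, map_smul, Finset.smul_sum, smul_smul, mul_comm]
  rw [← key]
  simp [dual, TensorProduct.sum_tmul, contractLeft_apply, Module.Dual.transpose_apply]

end General

section BraidedHopf

variable {k B H : Type*} [Field k] [Ring B] [HopfAlgebra k B] [Ring H] [Algebra k H]

/-- `m : V ⊗ V → V` and `e : V` make `V` an algebra in the category of Yetter–Drinfeld modules. -/
structure IsYDAlgebra {V : Type*} [AddCommMonoid V] [Module k V] (X : YDData k B V)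
    (m : V ⊗[k] V →ₗ[k] V) (e : V) : Prop where
  isYD : X.IsYD
  mul_hom : (X.tensor X).IsHom X m
  one_hom : (unit k B).IsHom X (LinearMap.toSpanSingleton k V e)
  one_mul : ∀ v, m (e ⊗ₜ v) = v
  mul_one : ∀ v, m (v ⊗ₜ e) = v
  mul_assoc : ∀ u v w, m (m (u ⊗ₜ v) ⊗ₜ w) = m (u ⊗ₜ m (v ⊗ₜ w))

variable [Coalgebra k H]

/-- `H` is a braided Hopf algebra, with antipode `S`, in the category of left-left
Yetter–Drinfeld modules over `B`.  The (co)associativity and (co)unit laws of the underlying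
algebra and coalgebra are those of the instances `Algebra k H` and `Coalgebra k H`. -/
structure IsBraidedHopfAlgebra (X : YDData k B H) (S : H →ₗ[k] H) : Prop where
  isYD : X.IsYD
  mul_hom : (X.tensor X).IsHom X (LinearMap.mul' k H)
  one_hom : (unit k B).IsHom X (Algebra.linearMap k H)
  comul_hom : X.IsHom (X.tensor X) Coalgebra.comul
  counit_hom : X.IsHom (unit k B) Coalgebra.counit
  antipode_hom : X.IsHom X S
  comul_one : Coalgebra.comul (R := k) (1 : H) = 1 ⊗ₜ 1
  comul_mul : (Coalgebra.comul (R := k) (A := H)) ∘ₗ LinearMap.mul' k H =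
    TensorProduct.map (LinearMap.mul' k H) (LinearMap.mul' k H) ∘ₗ X.midBraid X H H ∘ₗ
      TensorProduct.map Coalgebra.comul Coalgebra.comul
  counit_one : Coalgebra.counit (R := k) (1 : H) = 1
  counit_mul : ∀ x y : H,
    Coalgebra.counit (R := k) (x * y) = Coalgebra.counit (R := k) x * Coalgebra.counit (R := k) y
  mul_antipode_rTensor_comul : LinearMap.mul' k H ∘ₗ S.rTensor H ∘ₗ Coalgebra.comul =
    Algebra.linearMap k H ∘ₗ Coalgebra.counit
  mul_antipode_lTensor_comul : LinearMap.mul' k H ∘ₗ S.lTensor H ∘ₗ Coalgebra.comul =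
    Algebra.linearMap k H ∘ₗ Coalgebra.counit

/-- Right `H`-Hopf modules in the category of Yetter–Drinfeld modules: `a : M ⊗ H → M` is an
action, `ρ : M → M ⊗ H` a coaction, both are morphisms, and
`ρ a = (a ⊗ m)(M ⊗ C_{H,H} ⊗ H)(ρ ⊗ Δ)`. -/
structure IsHopfModule {M : Type*} [AddCommMonoid M] [Module k M] (X : YDData k B H)
    (Y : YDData k B M) (a : M ⊗[k] H →ₗ[k] M) (ρ : M →ₗ[k] M ⊗[k] H) : Prop where
  isYD : Y.IsYD
  act_hom : (Y.tensor X).IsHom Y a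
  coact_hom : Y.IsHom (Y.tensor X) ρ
  act_one : ∀ x : M, a (x ⊗ₜ 1) = x
  act_mul : ∀ (x : M) (g h : H), a (x ⊗ₜ (g * h)) = a (a (x ⊗ₜ g) ⊗ₜ h)
  coassoc : (TensorProduct.assoc k M H H).toLinearMap ∘ₗ ρ.rTensor H ∘ₗ ρ =
    (Coalgebra.comul (R := k) (A := H)).lTensor M ∘ₗ ρ
  counit_coact : (TensorProduct.rid k M).toLinearMap ∘ₗ
    (Coalgebra.counit (R := k) (A := H)).lTensor M ∘ₗ ρ = LinearMap.id
  compat : ρ ∘ₗ a = TensorProduct.map a (LinearMap.mul' k H) ∘ₗ X.midBraid X M H ∘ₗ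
    TensorProduct.map ρ Coalgebra.comul

variable [FiniteDimensional k B]

/-- The product of `H^*`, determined by
`⟨,⟩(m ⊗ H) = (⟨,⟩ ⊗ ⟨,⟩)(H^* ⊗ C_{H^*,H} ⊗ H)(H^* ⊗ H^* ⊗ Δ)`. -/
def dualMul (X : YDData k B H) :
    Module.Dual k H ⊗[k] Module.Dual k H →ₗ[k] Module.Dual k H :=
  TensorProduct.curry
    (LinearMap.mul' k k ∘ₗ TensorProduct.map (ev k H) (ev k H) ∘ₗ
      X.dual.midBraid X (Module.Dual k H) H ∘ₗ
      (Coalgebra.comul (R := k) (A := H)).lTensor (Module.Dual k H ⊗[k] Module.Dual k H))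

/-- `⇀ : H ⊗ H^* → H^*`, determined by
`⟨,⟩(⇀ ⊗ H) = ⟨,⟩(H^* ⊗ m)(H^* ⊗ C_{H,H})(C_{H,H^*} ⊗ H)`. -/
def harpoon (X : YDData k B H) : H ⊗[k] Module.Dual k H →ₗ[k] Module.Dual k H :=
  TensorProduct.curry
    (ev k H ∘ₗ (LinearMap.mul' k H ∘ₗ X.braid X).lTensor (Module.Dual k H) ∘ₗ
      (TensorProduct.assoc k (Module.Dual k H) H H).toLinearMap ∘ₗ
      (X.braid X.dual).rTensor H)

variable (k H) in
/-- `h ⊗ f ↦ (x ↦ f(x h))`. -/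
def translate : H ⊗[k] Module.Dual k H →ₗ[k] Module.Dual k H :=
  TensorProduct.lift (Module.Dual.transpose (R := k) ∘ₗ (LinearMap.mul k H).flip)

/-- `↼ = ⇀ (S ⊗ H^*) C_{H^*,H} : H^* ⊗ H → H^*`. -/
def rightHarpoon (X : YDData k B H) (S : H →ₗ[k] H) :
    Module.Dual k H ⊗[k] H →ₗ[k] Module.Dual k H :=
  X.harpoon ∘ₗ S.rTensor (Module.Dual k H) ∘ₗ X.dual.braid X

/-- The map `H^* ⊗ H → H^*` which sends `f ⊗ h` to `x ↦ ⟨f, m C_{H,H}(S(h) ⊗ x)⟩`. -/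
def dualAct (X : YDData k B H) (S : H →ₗ[k] H) :
    Module.Dual k H ⊗[k] H →ₗ[k] Module.Dual k H :=
  TensorProduct.curry
    (ev k H ∘ₗ (LinearMap.mul' k H ∘ₗ X.braid X ∘ₗ S.rTensor H).lTensor (Module.Dual k H) ∘ₗ
      (TensorProduct.assoc k (Module.Dual k H) H H).toLinearMap)

/-- The left integrals `∫^l_{H^*} = {f ∈ H^* | g f = g(1) f for all g ∈ H^*}`. -/
def integrals (X : YDData k B H) : Submodule k (Module.Dual k H) where
  carrier := {f | ∀ g : Module.Dual k H, X.dualMul (g ⊗ₜ f) = g 1 • f}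
  add_mem' := fun ha hb g => by rw [TensorProduct.tmul_add, map_add, ha g, hb g, smul_add]
  zero_mem' := fun g => by simp
  smul_mem' := fun c f hf g => by
    rw [TensorProduct.tmul_smul, map_smul, hf g, smul_comm]

/-- The map `(M ⊗ ⟨,⟩)(C_{H^*,M} ⊗ H)(H^* ⊗ ρ) : H^* ⊗ M → M`. -/
def inducedAct {M : Type*} [AddCommMonoid M] [Module k M] (X : YDData k B H)
    (Y : YDData k B M) (ρ : M →ₗ[k] M ⊗[k] H) : Module.Dual k H ⊗[k] M →ₗ[k] M :=
  (TensorProduct.rid k M).toLinearMap ∘ₗ (ev k H).lTensor M ∘ₗ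
    (TensorProduct.assoc k M (Module.Dual k H) H).toLinearMap ∘ₗ
    (X.dual.braid Y).rTensor H ∘ₗ
    (TensorProduct.assoc k (Module.Dual k H) M H).symm.toLinearMap ∘ₗ
    ρ.lTensor (Module.Dual k H)

/-- The `H^*`-module `(M, α)` is rational: there is a morphism `ρ : M → M ⊗ H` of
Yetter–Drinfeld modules with `(M ⊗ ⟨,⟩)(C_{H^*,M} ⊗ H)(H^* ⊗ ρ) = α`. -/
def IsRational {M : Type*} [AddCommMonoid M] [Module k M] (X : YDData k B H)
    (Y : YDData k B M) (α : Module.Dual k H ⊗[k] M →ₗ[k] M) : Prop :=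
  ∃ ρ : M →ₗ[k] M ⊗[k] H, Y.IsHom (Y.tensor X) ρ ∧ X.inducedAct Y ρ = α

/-- `N` is a rational `H^*`-submodule, in the category of Yetter–Drinfeld modules, of the regular
module `H^*`: with structures for which the inclusion is `B`-linear, `B`-colinear and `H^*`-linear
(these are unique, since the inclusion is injective), `N` is a rational `H^*`-module. -/
def IsRationalSubmodule (X : YDData k B H) (N : Submodule k (Module.Dual k H)) : Prop :=
  ∃ (Y : YDData k B N) (α : Module.Dual k H ⊗[k] N →ₗ[k] N),
    Y.IsHom X.dual N.subtype ∧
    N.subtype ∘ₗ α = X.dualMul ∘ₗ N.subtype.lTensor (Module.Dual k H) ∧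
    X.IsRational Y α

/-- `H^{*rat}`, the sum of all rational `H^*`-submodules of `H^*`. -/
def rat (X : YDData k B H) : Submodule k (Module.Dual k H) :=
  sSup {N | X.IsRationalSubmodule N}

end BraidedHopf

end YDData

end

/-! Call `f` in H^* finite if left multiplication g ↦ g f comes from a tensor t = t₁ ⊗ t₂ in H ⊗
H^*, that is g f = ⟨g, t₁⟩ t₂ for all g. As for ordinary Hopf algebras, the finite functionals form
the rational part, they are a right Hopf module, and the fundamental theorem of Hopf modules splits
such a module as (coinvariants) ⊗ H. Here the coinvariants are the left integrals. The work lies in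
carrying this through the braiding.

The hypothesis S_B² = 1 makes the braiding C invertible by an explicit formula, and makes the
evaluation a morphism in both orders, V^* ⊗ V → k and V ⊗ V^* → k. A strand can therefore be pulled
across an evaluation. This turns the braidings in the definitions into inverse braidings on H:
writing C⁻¹Δ(x) = x' ⊗ x'', one gets ⟨f g, x⟩ = g(x') f(x'') (`onFst_dualMul`), and a coaction ρ
induces the action g · m = (g ⊗ M)(C⁻¹ρ(m)) (`inducedAct_tmul`). So H^* is the opposite convolution
algebra of the coalgebra (H, C⁻¹Δ), and a rational module is a left comodule l = C⁻¹ρ over that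
coalgebra. Hence H^{*rat} is the space `finSub` of finite functionals (`isGreatest_finSub`). It is a
Yetter–Drinfeld submodule because both sides of g f = (g ⊗ id)(t) are morphisms (`IsHom.act_congr`,
`IsHom.coact_congr`).

The heart is `dualMul_dualAct`. Without the braiding it reads g(f ↼ h) = ((h₂ ⇀ g) f) ↼ h₁ with h₂ ⇀
g = g(· h₂). It shows that f ↼ h is again finite and is also the Hopf module compatibility. It
dualises `comulInvF_mulF_adF`, the braided form of (xS(h₁))₂ ⊗ (xS(h₁))₁h₂ = x₂S(h) ⊗ x₁, which
rests on the antipode being braided anti-comultiplicative (`comulF_antipode`). Braided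
antimultiplicativity (`antipode_mulF`) makes ↼ an action. Finally `exists_equiv_of_coinv` is the
fundamental theorem, and ρ(f) = f ⊗ 1 says exactly g f = g(1) f.

Identities between braided composites are stated for maps acting on the leading factors of a
right-nested tensor product with an arbitrary tail `T`. A string diagram then becomes a word of
maps, rewritten by sliding and by commuting maps on disjoint factors; `T = k` returns the plain
statement. -/

open scoped TensorProduct

noncomputable section

namespace YDData

/-! ### Yetter–Drinfeld modules, their morphisms, and the braiding as a morphism. -/

section Generic

variable {k B U V W V' W' : Type*} [Field k] [Ring B] [HopfAlgebra k B]
  [AddCommMonoid U] [Module k U] [AddCommMonoid V] [Module k V] [AddCommMonoid W] [Module k W]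
  [AddCommMonoid V'] [Module k V'] [AddCommMonoid W'] [Module k W']

open Coalgebra (comul counit)

/-- The map `b ↦ b · v`. -/
def orbit (X : YDData k B V) (v : V) : B →ₗ[k] V := (TensorProduct.curry X.act).flip v

@[simp] theorem orbit_apply (X : YDData k B V) (v : V) (b : B) :
    X.orbit v b = X.act (b ⊗ₜ v) := rfl

theorem tensor_act_tmul (X : YDData k B V) (Y : YDData k B W) (b : B) (v : V) (w : W) :
    (X.tensor Y).act (b ⊗ₜ (v ⊗ₜ w)) =
      TensorProduct.map (X.orbit v) (Y.orbit w) (comul (R := k) b) := by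
  simp only [tensor, LinearMap.comp_apply, LinearMap.rTensor_tmul]
  induction comul (R := k) b using TensorProduct.induction_on with
  | zero => simp
  | add x y hx hy => simp only [TensorProduct.add_tmul, map_add, hx, hy]
  | tmul x y => simp

/-- `(b ⊗ v) ⊗ (c ⊗ w) ↦ b c ⊗ (v ⊗ w)`. -/
def coactMul (k B V W : Type*) [Field k] [Ring B] [HopfAlgebra k B] [AddCommMonoid V] [Module k V]
    [AddCommMonoid W] [Module k W] : (B ⊗[k] V) ⊗[k] (B ⊗[k] W) →ₗ[k] B ⊗[k] (V ⊗[k] W) :=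
  (LinearMap.mul' k B).rTensor (V ⊗[k] W) ∘ₗ
    (TensorProduct.tensorTensorTensorComm k B V B W).toLinearMap

@[simp] theorem coactMul_tmul (b c : B) (v : V) (w : W) :
    coactMul k B V W ((b ⊗ₜ v) ⊗ₜ (c ⊗ₜ w)) = (b * c) ⊗ₜ (v ⊗ₜ w) := by
  simp [coactMul]

theorem tensor_coact_tmul (X : YDData k B V) (Y : YDData k B W) (v : V) (w : W) :
    (X.tensor Y).coact (v ⊗ₜ w) = coactMul k B V W (X.coact v ⊗ₜ Y.coact w) := rfl

theorem braid_tmul (X : YDData k B V) (Y : YDData k B W) (v : V) (w : W) :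
    X.braid Y (v ⊗ₜ w) = (Y.orbit w).rTensor V (X.coact v) := by
  simp only [braid, LinearMap.comp_apply, LinearMap.rTensor_tmul]
  induction X.coact v using TensorProduct.induction_on with
  | zero => simp
  | add x y hx hy => simp only [TensorProduct.add_tmul, map_add, hx, hy]
  | tmul x y => simp

/-- `d ↦ (d₁ · v)₍₋₁₎ d₂ ⊗ (d₁ · v)₍₀₎`. -/
def adjR (X : YDData k B V) (v : V) : B ⊗[k] B →ₗ[k] B ⊗[k] V :=
  (LinearMap.mul' k B).rTensor V ∘ₗ (TensorProduct.rightComm k B V B).toLinearMap ∘ₗ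
    (X.coact ∘ₗ X.orbit v).rTensor B

/-- `d ↦ d₁ c ⊗ d₂ · v` for `t = c ⊗ v`. -/
def adjL (X : YDData k B V) (t : B ⊗[k] V) : B ⊗[k] B →ₗ[k] B ⊗[k] V :=
  TensorProduct.map (LinearMap.mul' k B) X.act ∘ₗ
    (TensorProduct.tensorTensorTensorComm k B B B V).toLinearMap ∘ₗ
    (TensorProduct.mk k (B ⊗[k] B) (B ⊗[k] V)).flip t

theorem adjR_tmul (X : YDData k B V) (v : V) (b c : B) : X.adjR v (b ⊗ₜ c) =
    (LinearMap.mulRight k c).rTensor V (X.coact (X.act (b ⊗ₜ v))) := by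
  simp only [adjR, LinearMap.comp_apply, LinearMap.rTensor_tmul, orbit_apply]
  induction X.coact (X.act (b ⊗ₜ v)) using TensorProduct.induction_on with
  | zero => simp
  | add x y hx hy => simp only [TensorProduct.add_tmul, map_add, hx, hy]
  | tmul x y => simp

@[simp] theorem adjL_tmul (X : YDData k B V) (b c d : B) (v : V) : X.adjL (d ⊗ₜ v) (b ⊗ₜ c) =
    (b * d) ⊗ₜ X.act (c ⊗ₜ v) := by
  simp [adjL]

@[simp] theorem adjL_zero (X : YDData k B V) : X.adjL 0 = 0 := by
  ext; simp [adjL]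

theorem adjL_add (X : YDData k B V) (s t : B ⊗[k] V) : X.adjL (s + t) = X.adjL s + X.adjL t := by
  simp [adjL, LinearMap.comp_add]

/-- With `v` fixed, both sides of the compatibility become linear maps on B ⊗ B evaluated at Δ(b),
so that Δ(b) can be replaced by pure tensors in later computations. -/
theorem adj_iff (X : YDData k B V) :
    (TensorProduct.map (LinearMap.mul' k B) X.act ∘ₗ
        (TensorProduct.tensorTensorTensorComm k B B B V).toLinearMap ∘ₗ
        TensorProduct.map Coalgebra.comul X.coact =
      (LinearMap.mul' k B).rTensor V ∘ₗ
        (TensorProduct.rightComm k B V B).toLinearMap ∘ₗ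
        (X.coact ∘ₗ X.act).rTensor B ∘ₗ
        (TensorProduct.rightComm k B B V).toLinearMap ∘ₗ
        (Coalgebra.comul (R := k) (A := B)).rTensor V) ↔
    ∀ v, X.adjL (X.coact v) ∘ₗ comul = X.adjR v ∘ₗ comul := by
  have key : ∀ (d : B ⊗[k] B) (v : V), (LinearMap.mul' k B).rTensor V
      (TensorProduct.rightComm k B V B ((X.coact ∘ₗ X.act).rTensor B
        (TensorProduct.rightComm k B B V (d ⊗ₜ v)))) = X.adjR v d := by
    intro d v
    induction d using TensorProduct.induction_on with
    | zero => simp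
    | add x y hx hy => simp only [TensorProduct.add_tmul, map_add, hx, hy]
    | tmul x y =>
      simp only [TensorProduct.rightComm_tmul, LinearMap.rTensor_tmul, LinearMap.comp_apply,
        adjR_tmul]
      induction X.coact (X.act (x ⊗ₜ v)) using TensorProduct.induction_on with
      | zero => simp
      | add x y hx hy => simp only [TensorProduct.add_tmul, map_add, hx, hy]
      | tmul x y => simp
  constructor
  · intro h v
    ext b
    have := congr($h (b ⊗ₜ v))
    simp only [LinearMap.comp_apply, LinearEquiv.coe_coe, TensorProduct.map_tmul,
      LinearMap.rTensor_tmul, key] at this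
    simpa [adjL] using this
  · intro h
    ext b v
    have := congr($(h v) b)
    simp only [LinearMap.comp_apply] at this
    simp only [TensorProduct.AlgebraTensorModule.curry_apply, LinearMap.restrictScalars_self,
      TensorProduct.curry_apply, LinearMap.comp_apply, LinearEquiv.coe_coe, TensorProduct.map_tmul,
      LinearMap.rTensor_tmul, key]
    rw [← this]; rfl

theorem IsYD.adj {X : YDData k B V} (hX : X.IsYD) (v : V) (b : B) :
    X.adjL (X.coact v) (comul (R := k) b) = X.adjR v (comul (R := k) b) :=
  congr($(X.adj_iff.1 hX.compat v) b)

theorem IsYD.coassoc_apply {X : YDData k B V} (hX : X.IsYD) (v : V) :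
    TensorProduct.assoc k B B V ((comul (R := k)).rTensor V (X.coact v)) =
      X.coact.lTensor B (X.coact v) := congr($hX.coassoc v)

theorem IsYD.counit_coact_apply {X : YDData k B V} (hX : X.IsYD) (v : V) :
    TensorProduct.lid k V ((counit (R := k)).rTensor V (X.coact v)) = v :=
  congr($hX.counit_coact v)

/-! ### Homomorphisms -/

theorem IsHom.act {X : YDData k B V} {Y : YDData k B W} {f : V →ₗ[k] W} (hf : X.IsHom Y f)
    (b : B) (v : V) : f (X.act (b ⊗ₜ v)) = Y.act (b ⊗ₜ f v) := congr($hf.linear (b ⊗ₜ v))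

theorem IsHom.coact {X : YDData k B V} {Y : YDData k B W} {f : V →ₗ[k] W} (hf : X.IsHom Y f)
    (v : V) : Y.coact (f v) = f.lTensor B (X.coact v) := congr($hf.colinear v)

theorem IsHom.orbit {X : YDData k B V} {Y : YDData k B W} {f : V →ₗ[k] W} (hf : X.IsHom Y f)
    (v : V) : Y.orbit (f v) = f ∘ₗ X.orbit v := by
  ext b; exact (hf.act b v).symm

theorem IsHom.mk' {X : YDData k B V} {Y : YDData k B W} {f : V →ₗ[k] W}
    (h₁ : ∀ b v, f (X.act (b ⊗ₜ v)) = Y.act (b ⊗ₜ f v))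
    (h₂ : ∀ v, Y.coact (f v) = f.lTensor B (X.coact v)) : X.IsHom Y f :=
  ⟨TensorProduct.ext' h₁, LinearMap.ext h₂⟩

theorem IsHom.id (X : YDData k B V) : X.IsHom X LinearMap.id := ⟨by simp, by simp⟩

theorem IsHom.comp {X : YDData k B U} {Y : YDData k B V} {Z : YDData k B W} {g : V →ₗ[k] W}
    {f : U →ₗ[k] V} (hg : Y.IsHom Z g) (hf : X.IsHom Y f) : X.IsHom Z (g ∘ₗ f) :=
  .mk' (fun b v => by simp [hf.act, hg.act])
    (fun v => by simp [hf.coact, hg.coact, LinearMap.lTensor_comp])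

theorem IsHom.map {X : YDData k B V} {Y : YDData k B W} {X' : YDData k B V'} {Y' : YDData k B W'}
    {f : V →ₗ[k] V'} {g : W →ₗ[k] W'} (hf : X.IsHom X' f) (hg : Y.IsHom Y' g) :
    (X.tensor Y).IsHom (X'.tensor Y') (TensorProduct.map f g) := by
  constructor
  · ext b v w
    simp only [TensorProduct.AlgebraTensorModule.curry_apply, LinearMap.restrictScalars_self,
      TensorProduct.curry_apply, LinearMap.comp_apply, LinearMap.lTensor_tmul,
      TensorProduct.map_tmul, tensor_act_tmul, hf.orbit, hg.orbit, TensorProduct.map_comp]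
  · ext v w
    simp only [TensorProduct.AlgebraTensorModule.curry_apply, LinearMap.restrictScalars_self,
      TensorProduct.curry_apply, LinearMap.comp_apply,
      TensorProduct.map_tmul, tensor_coact_tmul, hf.coact, hg.coact]
    induction X.coact v using TensorProduct.induction_on with
    | zero => simp
    | add x y hx hy => simp only [TensorProduct.add_tmul, map_add, hx, hy]
    | tmul x y =>
      induction Y.coact w using TensorProduct.induction_on with
      | zero => simp
      | add x y hx hy => simp only [TensorProduct.tmul_add, map_add, hx, hy]
      | tmul x y => simp

theorem IsHom.lTensor {X : YDData k B V} {Y : YDData k B W} {f : V →ₗ[k] W} (Z : YDData k B U)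
    (hf : X.IsHom Y f) : (Z.tensor X).IsHom (Z.tensor Y) (f.lTensor U) := (IsHom.id Z).map hf

theorem IsHom.rTensor {X : YDData k B V} {Y : YDData k B W} {f : V →ₗ[k] W} (Z : YDData k B U)
    (hf : X.IsHom Y f) : (X.tensor Z).IsHom (Y.tensor Z) (f.rTensor U) := hf.map (IsHom.id Z)

theorem IsHom.symm {X : YDData k B V} {Y : YDData k B W} {e : V ≃ₗ[k] W}
    (he : X.IsHom Y e.toLinearMap) : Y.IsHom X e.symm.toLinearMap := by
  refine .mk' (fun b w => ?_) (fun w => ?_)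
  · apply e.injective
    have := he.act b (e.symm w)
    simp_all
  · have := he.coact (e.symm w)
    simp only [LinearEquiv.coe_coe, LinearEquiv.apply_symm_apply] at this
    rw [this, ← LinearMap.lTensor_comp_apply]
    simp

/-- `b ⊗ (c ⊗ d) ↦ b · u ⊗ (c · v ⊗ d · w)`. -/
theorem tensor_tensor_act (X : YDData k B U) (Y : YDData k B V) (Z : YDData k B W) (b : B)
    (u : U) (v : V) (w : W) : (X.tensor (Y.tensor Z)).act (b ⊗ₜ (u ⊗ₜ (v ⊗ₜ w))) =
    TensorProduct.map (X.orbit u) (TensorProduct.map (Y.orbit v) (Z.orbit w))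
      ((comul (R := k)).lTensor B (comul (R := k) b)) := by
  rw [tensor_act_tmul]
  induction comul (R := k) b using TensorProduct.induction_on with
  | zero => simp
  | add x y hx hy => simp only [map_add, hx, hy]
  | tmul x y => simp [tensor_act_tmul]

theorem isHom_assoc (X : YDData k B U) (Y : YDData k B V) (Z : YDData k B W) :
    ((X.tensor Y).tensor Z).IsHom (X.tensor (Y.tensor Z))
      (TensorProduct.assoc k U V W).toLinearMap := by
  constructor
  · ext b u v w
    simp only [TensorProduct.AlgebraTensorModule.curry_apply, LinearMap.restrictScalars_self,
      TensorProduct.curry_apply, LinearMap.comp_apply, LinearMap.lTensor_tmul, LinearEquiv.coe_coe,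
      TensorProduct.assoc_tmul, tensor_tensor_act, ← Coalgebra.coassoc_apply]
    rw [tensor_act_tmul]
    induction comul (R := k) b using TensorProduct.induction_on with
    | zero => simp
    | add x y hx hy => simp only [map_add, hx, hy]
    | tmul x y =>
      simp only [TensorProduct.map_tmul, orbit_apply, tensor_act_tmul, LinearMap.rTensor_tmul]
      induction comul (R := k) x using TensorProduct.induction_on with
      | zero => simp
      | add x y hx hy => simp only [map_add, hx, hy, TensorProduct.add_tmul]
      | tmul x y => simp
  · ext u v w
    simp only [TensorProduct.AlgebraTensorModule.curry_apply, LinearMap.restrictScalars_self,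
      TensorProduct.curry_apply, LinearMap.comp_apply, LinearEquiv.coe_coe,
      TensorProduct.assoc_tmul, tensor_coact_tmul]
    induction X.coact u using TensorProduct.induction_on with
    | zero => simp
    | add x y hx hy => simp only [TensorProduct.add_tmul, map_add, hx, hy]
    | tmul x y =>
      induction Y.coact v using TensorProduct.induction_on with
      | zero => simp
      | add x y hx hy => simp only [TensorProduct.tmul_add, TensorProduct.add_tmul, map_add, hx, hy]
      | tmul x y =>
        induction Z.coact w using TensorProduct.induction_on with
        | zero => simp
        | add x y hx hy => simp only [TensorProduct.tmul_add, map_add, hx, hy]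
        | tmul x y => simp [mul_assoc]

theorem isHom_lid (X : YDData k B V) :
    ((unit k B).tensor X).IsHom X (TensorProduct.lid k V).toLinearMap := by
  constructor
  · ext b v
    simp only [TensorProduct.AlgebraTensorModule.curry_apply, LinearMap.restrictScalars_self,
      TensorProduct.curry_apply, LinearMap.comp_apply, LinearMap.lTensor_tmul, LinearEquiv.coe_coe,
      TensorProduct.lid_tmul, tensor_act_tmul, one_smul]
    trans X.orbit v (TensorProduct.lid k B ((counit (R := k)).rTensor B (comul (R := k) b)))
    · induction comul (R := k) b using TensorProduct.induction_on with
      | zero => simp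
      | add x y hx hy => simp only [map_add, hx, hy]
      | tmul x y => simp [unit]
    · simp
  · ext v
    simp only [TensorProduct.AlgebraTensorModule.curry_apply, LinearMap.restrictScalars_self,
      TensorProduct.curry_apply, LinearMap.comp_apply, LinearEquiv.coe_coe,
      TensorProduct.lid_tmul, tensor_coact_tmul, one_smul]
    induction X.coact v using TensorProduct.induction_on with
    | zero => simp
    | add x y hx hy => simp only [TensorProduct.tmul_add, map_add, ← hx, ← hy]
    | tmul x y => simp [unit]

/-- Linearity is the compatibility axiom of `V`; colinearity is that of `W` together with
coassociativity of the coaction on `V`. -/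
theorem isHom_braid {X : YDData k B V} {Y : YDData k B W} (hX : X.IsYD) (hY : Y.IsYD) :
    (X.tensor Y).IsHom (Y.tensor X) (X.braid Y) := by
  constructor
  · ext b v w
    simp only [TensorProduct.AlgebraTensorModule.curry_apply, LinearMap.restrictScalars_self,
      TensorProduct.curry_apply, LinearMap.comp_apply, LinearMap.lTensor_tmul]
    -- The common value is (b₁ · v)₍₋₁₎ b₂ · w ⊗ (b₁ · v)₍₀₎.
    trans (Y.orbit w).rTensor V (X.adjR v (comul (R := k) b))
    · rw [tensor_act_tmul]
      induction comul (R := k) b using TensorProduct.induction_on with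
      | zero => simp
      | add x y hx hy => simp only [map_add, hx, hy]
      | tmul x y =>
        rw [adjR_tmul, TensorProduct.map_tmul, braid_tmul, ← LinearMap.rTensor_comp_apply]
        congr 2
        ext c; simp [hY.mul_act]
    · rw [← hX.adj, braid_tmul]
      simp only [adjL, LinearMap.comp_apply, LinearMap.flip_apply, TensorProduct.mk_apply]
      induction X.coact v using TensorProduct.induction_on with
      | zero => simp
      | add x y hx hy => simp only [TensorProduct.tmul_add, map_add, hx, hy]
      | tmul x y =>
        rw [LinearMap.rTensor_tmul, tensor_act_tmul]
        induction comul (R := k) b using TensorProduct.induction_on with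
        | zero => simp
        | add x y hx hy => simp only [map_add, TensorProduct.add_tmul, hx, hy]
        | tmul x y => simp [hY.mul_act]
  · ext v w
    simp only [TensorProduct.AlgebraTensorModule.curry_apply, LinearMap.restrictScalars_self,
      TensorProduct.curry_apply, LinearMap.comp_apply, tensor_coact_tmul, braid_tmul]
    -- Both sides become functions of v₍₋₂₎ ⊗ v₍₋₁₎ ⊗ v₍₀₎; the compatibility of `W` enters in `hM`.
    have hL : ∀ s : B ⊗[k] V, (Y.tensor X).coact ((Y.orbit w).rTensor V s) =
        coactMul k B W V ((Y.coact ∘ₗ Y.orbit w).rTensor (B ⊗[k] V) (X.coact.lTensor B s)) := by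
      intro s
      induction s using TensorProduct.induction_on with
      | zero => simp
      | add x y hx hy => simp only [map_add, hx, hy]
      | tmul x y => simp [tensor_coact_tmul]
    have hM : ∀ s : B ⊗[k] V, coactMul k B W V ((Y.coact ∘ₗ Y.orbit w).rTensor (B ⊗[k] V)
        (TensorProduct.assoc k B B V ((comul (R := k)).rTensor V s))) =
        TensorProduct.assoc k B W V ((Y.adjL (Y.coact w)).rTensor V
          ((comul (R := k)).rTensor V s)) := by
      intro s
      induction s using TensorProduct.induction_on with
      | zero => simp
      | add x y hx hy => simp only [map_add, hx, hy]
      | tmul x y =>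
        simp only [LinearMap.rTensor_tmul, hY.adj]
        induction comul (R := k) x using TensorProduct.induction_on with
        | zero => simp
        | add x y hx hy => simp only [map_add, TensorProduct.add_tmul, hx, hy]
        | tmul a b =>
          simp only [TensorProduct.assoc_tmul, LinearMap.rTensor_tmul, adjR_tmul,
            LinearMap.comp_apply, orbit_apply]
          induction Y.coact (Y.act (a ⊗ₜ w)) using TensorProduct.induction_on with
          | zero => simp
          | add x y hx hy => simp only [map_add, TensorProduct.add_tmul, hx, hy]
          | tmul c d => simp
    have hR : ∀ (s : B ⊗[k] V) (t : B ⊗[k] W),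
        (X.braid Y).lTensor B (coactMul k B V W (s ⊗ₜ t)) =
        TensorProduct.assoc k B W V ((Y.adjL t).rTensor V
          ((TensorProduct.assoc k B B V).symm (X.coact.lTensor B s))) := by
      intro s t
      induction s using TensorProduct.induction_on with
      | zero => simp
      | add x y hx hy => simp only [map_add, TensorProduct.add_tmul, hx, hy]
      | tmul b v =>
        induction t using TensorProduct.induction_on with
        | zero => simp
        | add x y hx hy =>
          simp only [map_add, TensorProduct.tmul_add, hx, hy, adjL_add, LinearMap.rTensor_add,
            LinearMap.add_apply]
        | tmul c w =>
          simp only [coactMul_tmul, LinearMap.lTensor_tmul, braid_tmul]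
          induction X.coact v using TensorProduct.induction_on with
          | zero => simp
          | add x y hx hy => simp only [map_add, TensorProduct.tmul_add, hx, hy]
          | tmul c d => simp
    rw [hL, ← hX.coassoc_apply, hM, hR, ← hX.coassoc_apply, LinearEquiv.symm_apply_apply]

end Generic

end YDData

end

open scoped TensorProduct

noncomputable section

namespace YDData

/-! ### Tensor products and subobjects of Yetter–Drinfeld modules. -/

section Tensor

variable {k B U V W V' W' : Type*} [Field k] [Ring B] [HopfAlgebra k B]
  [AddCommMonoid U] [Module k U] [AddCommMonoid V] [Module k V] [AddCommMonoid W] [Module k W]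
  [AddCommMonoid V'] [Module k V'] [AddCommMonoid W'] [Module k W']

open Coalgebra (comul counit)

theorem orbit_add (X : YDData k B V) (v w : V) : X.orbit (v + w) = X.orbit v + X.orbit w := by
  ext; simp [TensorProduct.tmul_add]

@[simp] theorem orbit_zero (X : YDData k B V) : X.orbit 0 = 0 := by
  ext; simp

theorem adjR_add (X : YDData k B V) (v w : V) : X.adjR (v + w) = X.adjR v + X.adjR w := by
  simp [adjR, orbit_add, LinearMap.comp_add, LinearMap.rTensor_add]

@[simp] theorem adjR_zero (X : YDData k B V) : X.adjR 0 = 0 := by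
  simp [adjR]

theorem IsYD.tensor {X : YDData k B V} {Y : YDData k B W} (hX : X.IsYD) (hY : Y.IsYD) :
    (X.tensor Y).IsYD where
  one_act z := by
    induction z using TensorProduct.induction_on with
    | zero => simp
    | add x y hx hy => simp only [TensorProduct.tmul_add, map_add, hx, hy]
    | tmul v w => simp [tensor_act_tmul, Algebra.TensorProduct.one_def, hX.one_act, hY.one_act]
  mul_act a b z := by
    induction z using TensorProduct.induction_on with
    | zero => simp
    | add x y hx hy => simp only [TensorProduct.tmul_add, map_add, hx, hy]
    | tmul v w =>
      simp only [tensor_act_tmul, Bialgebra.comul_mul]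
      induction comul (R := k) b using TensorProduct.induction_on with
      | zero => simp
      | add x y hx hy => simp only [mul_add, TensorProduct.tmul_add, map_add, hx, hy]
      | tmul x y =>
        simp only [TensorProduct.map_tmul, orbit_apply, tensor_act_tmul]
        induction comul (R := k) a using TensorProduct.induction_on with
        | zero => simp
        | add x y hx hy => simp only [add_mul, map_add, hx, hy]
        | tmul x y => simp [hX.mul_act, hY.mul_act]
  coassoc := by
    ext v w
    simp only [TensorProduct.AlgebraTensorModule.curry_apply, LinearMap.restrictScalars_self,
      TensorProduct.curry_apply, LinearMap.comp_apply, tensor_coact_tmul, LinearEquiv.coe_coe]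
    let Ψ := TensorProduct.map (LinearMap.mul' k B) (coactMul k B V W) ∘ₗ
      (TensorProduct.tensorTensorTensorComm k B (B ⊗[k] V) B (B ⊗[k] W)).toLinearMap
    have h₁ : ∀ (s : B ⊗[k] V) (t : B ⊗[k] W),
        TensorProduct.assoc k B B (V ⊗[k] W)
          ((comul (R := k)).rTensor _ (coactMul k B V W (s ⊗ₜ t))) =
        Ψ (TensorProduct.assoc k B B V ((comul (R := k)).rTensor V s) ⊗ₜ
          TensorProduct.assoc k B B W ((comul (R := k)).rTensor W t)) := by
      intro s t
      induction s using TensorProduct.induction_on with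
      | zero => simp
      | add x y hx hy => simp only [map_add, TensorProduct.add_tmul, hx, hy]
      | tmul b v =>
        induction t using TensorProduct.induction_on with
        | zero => simp
        | add x y hx hy => simp only [map_add, TensorProduct.tmul_add, hx, hy]
        | tmul c w =>
          simp only [coactMul_tmul, LinearMap.rTensor_tmul, Bialgebra.comul_mul]
          induction comul (R := k) b using TensorProduct.induction_on with
          | zero => simp
          | add x y hx hy => simp only [map_add, TensorProduct.add_tmul, add_mul, hx, hy]
          | tmul b₁ b₂ =>
            induction comul (R := k) c using TensorProduct.induction_on with
            | zero => simp
            | add x y hx hy =>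
              simp only [map_add, TensorProduct.add_tmul, TensorProduct.tmul_add, mul_add, hx, hy]
            | tmul c₁ c₂ => simp [Ψ]
    have h₂ : ∀ (s : B ⊗[k] V) (t : B ⊗[k] W),
        (X.tensor Y).coact.lTensor B (coactMul k B V W (s ⊗ₜ t)) =
        Ψ (X.coact.lTensor B s ⊗ₜ Y.coact.lTensor B t) := by
      intro s t
      induction s using TensorProduct.induction_on with
      | zero => simp
      | add x y hx hy => simp only [map_add, TensorProduct.add_tmul, hx, hy]
      | tmul b v =>
        induction t using TensorProduct.induction_on with
        | zero => simp
        | add x y hx hy => simp only [map_add, TensorProduct.tmul_add, hx, hy]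
        | tmul c w => simp [Ψ, tensor_coact_tmul]
    rw [h₁, h₂, hX.coassoc_apply, hY.coassoc_apply]
  counit_coact := by
    ext v w
    simp only [TensorProduct.AlgebraTensorModule.curry_apply, LinearMap.restrictScalars_self,
      TensorProduct.curry_apply, LinearMap.comp_apply, tensor_coact_tmul, LinearEquiv.coe_coe]
    conv_rhs => rw [← hX.counit_coact_apply v, ← hY.counit_coact_apply w]
    induction X.coact v using TensorProduct.induction_on with
    | zero => simp
    | add x y hx hy => simp_all only [map_add, TensorProduct.add_tmul]
    | tmul x y =>
      induction Y.coact w using TensorProduct.induction_on with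
      | zero => simp
      | add x y hx hy => simp_all only [map_add, TensorProduct.tmul_add]
      | tmul x y =>
        simp [TensorProduct.smul_tmul', TensorProduct.tmul_smul, smul_smul, mul_comm]
  compat := by
    refine (adj_iff _).2 fun z => ?_
    induction z using TensorProduct.induction_on with
    | zero => simp
    | add x y hx hy => rw [map_add, adjL_add, adjR_add, LinearMap.add_comp, LinearMap.add_comp,
        hx, hy]
    | tmul v w =>
      ext b
      simp only [LinearMap.comp_apply, tensor_coact_tmul]
      -- The chain is b₁v₍₋₁₎w₍₋₁₎ ⊗ b₂v₍₀₎ ⊗ b₃w₍₀₎ = (b₁v)₍₋₁₎b₂w₍₋₁₎ ⊗ (b₁v)₍₀₎ ⊗ b₃w₍₀₎ =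
      -- (b₁v)₍₋₁₎(b₂w)₍₋₁₎b₃ ⊗ (b₁v)₍₀₎ ⊗ (b₂w)₍₀₎. The compatibility of `V` is used in `h₂`, that
      -- of `W` in `h₃`, with coassociativity of B in between.
      have h₁ : ∀ d : B ⊗[k] B,
          (X.tensor Y).adjL (coactMul k B V W (X.coact v ⊗ₜ Y.coact w)) d =
          coactMul k B V W (TensorProduct.map (X.adjL (X.coact v))
            (Y.adjL (Y.coact w) ∘ₗ TensorProduct.mk k B B 1)
            ((TensorProduct.assoc k B B B).symm ((comul (R := k)).lTensor B d))) := by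
        intro d
        induction d using TensorProduct.induction_on with
        | zero => simp
        | add x y hx hy => simp only [map_add, hx, hy]
        | tmul x y =>
          rw [LinearMap.lTensor_tmul]
          induction X.coact v using TensorProduct.induction_on with
          | zero => simp
          | add x y hx hy =>
            simp only [map_add, TensorProduct.add_tmul, adjL_add, LinearMap.add_apply,
              TensorProduct.map_add_left, hx, hy]
          | tmul b' v =>
            induction Y.coact w using TensorProduct.induction_on with
            | zero => simp
            | add x y hx hy =>
              simp only [map_add, TensorProduct.tmul_add, adjL_add, LinearMap.add_apply,
                TensorProduct.map_add_right, LinearMap.add_comp, hx, hy]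
            | tmul c w =>
              rw [coactMul_tmul, adjL_tmul, tensor_act_tmul]
              induction comul (R := k) y using TensorProduct.induction_on with
              | zero => simp
              | add x y hx hy => simp only [map_add, TensorProduct.tmul_add, hx, hy]
              | tmul y z => simp [mul_assoc]
      have h₂ : ∀ d : B ⊗[k] B, TensorProduct.map (X.adjL (X.coact v))
            (Y.adjL (Y.coact w) ∘ₗ TensorProduct.mk k B B 1) ((comul (R := k)).rTensor B d) =
          TensorProduct.map (X.adjR v)
            (Y.adjL (Y.coact w) ∘ₗ TensorProduct.mk k B B 1) ((comul (R := k)).rTensor B d) := by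
        intro d
        induction d using TensorProduct.induction_on with
        | zero => simp
        | add x y hx hy => simp only [map_add, hx, hy]
        | tmul x y => simp [hX.adj]
      have h₃ : ∀ d : B ⊗[k] B, coactMul k B V W (TensorProduct.map (X.adjR v)
            (Y.adjL (Y.coact w) ∘ₗ TensorProduct.mk k B B 1)
            ((TensorProduct.assoc k B B B).symm ((comul (R := k)).lTensor B d))) =
          coactMul k B V W (TensorProduct.map (X.coact ∘ₗ X.orbit v) (Y.adjR w)
            ((comul (R := k)).lTensor B d)) := by
        intro d
        induction d using TensorProduct.induction_on with
        | zero => simp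
        | add x y hx hy => simp only [map_add, hx, hy]
        | tmul x y =>
          rw [LinearMap.lTensor_tmul, TensorProduct.map_tmul, ← hY.adj]
          induction comul (R := k) y using TensorProduct.induction_on with
          | zero => simp
          | add x y hx hy => simp only [map_add, TensorProduct.tmul_add, hx, hy]
          | tmul y z =>
            simp only [TensorProduct.assoc_symm_tmul, TensorProduct.map_tmul, adjR_tmul,
              LinearMap.comp_apply, orbit_apply, TensorProduct.mk_apply]
            induction X.coact (X.act (x ⊗ₜ v)) using TensorProduct.induction_on with
            | zero => simp
            | add x y hx hy => simp only [map_add, TensorProduct.add_tmul, hx, hy]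
            | tmul b v =>
              induction Y.coact w using TensorProduct.induction_on with
              | zero => simp
              | add x y hx hy =>
                simp only [map_add, TensorProduct.tmul_add, adjL_add, LinearMap.add_apply, hx, hy]
              | tmul c w => simp [mul_assoc]
      have h₄ : ∀ d : B ⊗[k] B, (X.tensor Y).adjR (v ⊗ₜ w) d =
          coactMul k B V W (TensorProduct.map (X.coact ∘ₗ X.orbit v) (Y.adjR w)
            (TensorProduct.assoc k B B B ((comul (R := k)).rTensor B d))) := by
        intro d
        induction d using TensorProduct.induction_on with
        | zero => simp
        | add x y hx hy => simp only [map_add, hx, hy]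
        | tmul x y =>
          rw [adjR_tmul, tensor_act_tmul, LinearMap.rTensor_tmul]
          induction comul (R := k) x using TensorProduct.induction_on with
          | zero => simp
          | add x y hx hy => simp only [map_add, TensorProduct.add_tmul, hx, hy]
          | tmul x z =>
            simp only [TensorProduct.assoc_tmul, TensorProduct.map_tmul, adjR_tmul,
              LinearMap.comp_apply, orbit_apply, tensor_coact_tmul]
            induction X.coact (X.act (x ⊗ₜ v)) using TensorProduct.induction_on with
            | zero => simp
            | add x y hx hy => simp only [map_add, TensorProduct.add_tmul, hx, hy]
            | tmul b v =>
              induction Y.coact (Y.act (z ⊗ₜ w)) using TensorProduct.induction_on with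
              | zero => simp
              | add x y hx hy => simp only [map_add, TensorProduct.tmul_add, hx, hy]
              | tmul c w => simp [mul_assoc]
      rw [h₁, Coalgebra.coassoc_symm_apply, h₂, ← Coalgebra.coassoc_symm_apply, h₃, h₄,
        Coalgebra.coassoc_apply]

/-- Over a field, B ⊗ − preserves injectivity, so each axiom may be checked after mapping into `Y`.
-/
theorem IsYD.of_injective {X : YDData k B V} {Y : YDData k B W} {f : V →ₗ[k] W}
    (hY : Y.IsYD) (hf : X.IsHom Y f) (h : Function.Injective f) : X.IsYD := by
  have hB := Module.Flat.lTensor_preserves_injective_linearMap (M := B) f h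
  have hBB := Module.Flat.lTensor_preserves_injective_linearMap (M := B) _ hB
  refine ⟨fun v => h ?_, fun a b v => h ?_, LinearMap.ext fun v => hBB ?_,
    LinearMap.ext fun v => h ?_, X.adj_iff.2 fun v => LinearMap.ext fun b => hB ?_⟩
  · rw [hf.act, hY.one_act]
  · rw [hf.act, hf.act, hf.act, hY.mul_act]
  · have := hY.coassoc_apply (f v)
    rw [hf.coact, ← LinearMap.lTensor_comp_apply, hf.colinear, LinearMap.lTensor_comp_apply] at this
    simp only [LinearMap.comp_apply, LinearEquiv.coe_coe]
    rw [← this]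
    induction X.coact v using TensorProduct.induction_on with
    | zero => simp
    | add x y hx hy => simp only [map_add, hx, hy]
    | tmul b v =>
      simp only [LinearMap.rTensor_tmul, LinearMap.lTensor_tmul]
      induction comul (R := k) b using TensorProduct.induction_on with
      | zero => simp
      | add x y hx hy => simp only [map_add, TensorProduct.add_tmul, hx, hy]
      | tmul b c => simp
  · have := hY.counit_coact_apply (f v)
    rw [hf.coact] at this
    simp only [LinearMap.comp_apply, LinearEquiv.coe_coe, LinearMap.id_apply]
    rw [← this]
    induction X.coact v using TensorProduct.induction_on with
    | zero => simp
    | add x y hx hy => simp only [map_add, hx, hy]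
    | tmul b v => simp
  · have hR : ∀ d, f.lTensor B (X.adjR v d) = Y.adjR (f v) d := by
      intro d
      induction d using TensorProduct.induction_on with
      | zero => simp
      | add x y hx hy => simp only [map_add, hx, hy]
      | tmul b c =>
        rw [adjR_tmul, adjR_tmul, ← hf.act, hf.coact]
        induction X.coact (X.act (b ⊗ₜ v)) using TensorProduct.induction_on with
        | zero => simp
        | add x y hx hy => simp only [map_add, hx, hy]
        | tmul b v => simp
    have hL : ∀ s d, f.lTensor B (X.adjL s d) = Y.adjL (f.lTensor B s) d := by
      intro s d
      induction s using TensorProduct.induction_on with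
      | zero => simp
      | add x y hx hy => simp only [map_add, adjL_add, LinearMap.add_apply, hx, hy]
      | tmul b v =>
        induction d using TensorProduct.induction_on with
        | zero => simp
        | add x y hx hy => simp only [map_add, hx, hy]
        | tmul b c => simp [hf.act]
    simp only [LinearMap.comp_apply, hR, hL, ← hf.coact, hY.adj]

/-- The restriction of a Yetter–Drinfeld structure to a stable subspace. -/
theorem exists_restrict (X : YDData k B V) (N : Submodule k V)
    (h₁ : ∀ b, ∀ v ∈ N, X.act (b ⊗ₜ v) ∈ N)
    (h₂ : ∀ v ∈ N, X.coact v ∈ LinearMap.range (N.subtype.lTensor B)) :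
    ∃ Y : YDData k B N, Y.IsHom X N.subtype := by
  have hinj := Module.Flat.lTensor_preserves_injective_linearMap (M := B) N.subtype
    N.subtype_injective
  let e := LinearEquiv.ofInjective _ hinj
  refine ⟨⟨(X.act ∘ₗ N.subtype.lTensor B).codRestrict N fun z => ?_,
    e.symm.toLinearMap ∘ₗ (X.coact ∘ₗ N.subtype).codRestrict _ fun v => h₂ v v.2⟩, ?_, ?_⟩
  · induction z using TensorProduct.induction_on with
    | zero => simp
    | add x y hx hy => rw [map_add]; exact N.add_mem hx hy
    | tmul b v => exact h₁ b v v.2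
  · simp
  · ext v
    have := congr(Subtype.val $(e.apply_symm_apply
      ((X.coact ∘ₗ N.subtype).codRestrict _ (fun v => h₂ v v.2) v)))
    exact this.symm

end Tensor

end YDData

end

open scoped TensorProduct

noncomputable section

namespace YDData

/-! ### Calculus of maps acting on the first factors of a tensor product -/

section Tail

variable {k U V W T T' : Type*} [Field k]
  [AddCommMonoid U] [Module k U] [AddCommMonoid V] [Module k V] [AddCommMonoid W] [Module k W]
  [AddCommMonoid T] [Module k T] [AddCommMonoid T'] [Module k T']

/-- A map `U ⊗ V → W` acting on the first two factors. -/
def onPair (f : U ⊗[k] V →ₗ[k] W) : U ⊗[k] (V ⊗[k] T) →ₗ[k] W ⊗[k] T :=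
  f.rTensor T ∘ₗ (TensorProduct.assoc k U V T).symm.toLinearMap

/-- A map `U → V ⊗ W` acting on the first factor. -/
def toPair (f : U →ₗ[k] V ⊗[k] W) : U ⊗[k] T →ₗ[k] V ⊗[k] (W ⊗[k] T) :=
  (TensorProduct.assoc k V W T).toLinearMap ∘ₗ f.rTensor T

/-- A functional on `V` acting on the first factor. -/
def onFst (f : V →ₗ[k] k) : V ⊗[k] T →ₗ[k] T :=
  (TensorProduct.lid k T).toLinearMap ∘ₗ f.rTensor T

/-- A functional on `U ⊗ V` acting on the first two factors. -/
def onTwo (f : U ⊗[k] V →ₗ[k] k) : U ⊗[k] (V ⊗[k] T) →ₗ[k] T :=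
  (TensorProduct.lid k T).toLinearMap ∘ₗ onPair f

@[simp] theorem onPair_tmul (f : U ⊗[k] V →ₗ[k] W) (u : U) (v : V) (t : T) :
    onPair f (u ⊗ₜ (v ⊗ₜ t)) = f (u ⊗ₜ v) ⊗ₜ t := rfl

@[simp] theorem toPair_tmul (f : U →ₗ[k] V ⊗[k] W) (u : U) (t : T) :
    toPair f (u ⊗ₜ t) = TensorProduct.assoc k V W T (f u ⊗ₜ t) := rfl

@[simp] theorem onFst_tmul (f : V →ₗ[k] k) (v : V) (t : T) : onFst f (v ⊗ₜ t) = f v • t := rfl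

@[simp] theorem onTwo_tmul (f : U ⊗[k] V →ₗ[k] k) (u : U) (v : V) (t : T) :
    onTwo f (u ⊗ₜ (v ⊗ₜ t)) = f (u ⊗ₜ v) • t := rfl

theorem onPair_apply (f : U ⊗[k] V →ₗ[k] W) (z : U ⊗[k] (V ⊗[k] T)) :
    onPair f z = f.rTensor T ((TensorProduct.assoc k U V T).symm z) := rfl

theorem toPair_apply (f : U →ₗ[k] V ⊗[k] W) (z : U ⊗[k] T) :
    toPair f z = TensorProduct.assoc k V W T (f.rTensor T z) := rfl

theorem onFst_apply (f : V →ₗ[k] k) (z : V ⊗[k] T) :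
    onFst f z = (TensorProduct.lid k T).toLinearMap (f.rTensor T z) := rfl

theorem onTwo_apply (f : U ⊗[k] V →ₗ[k] k) (z : U ⊗[k] (V ⊗[k] T)) :
    onTwo f z = (TensorProduct.lid k T).toLinearMap (onPair f z) := rfl

theorem lTensor_onPair (f : U ⊗[k] V →ₗ[k] W) (z : T' ⊗[k] (U ⊗[k] (V ⊗[k] T))) :
    (onPair f).lTensor T' z = (f.rTensor T).lTensor T'
      ((TensorProduct.assoc k U V T).symm.toLinearMap.lTensor T' z) :=
  LinearMap.lTensor_comp_apply _ _ _ _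

theorem lTensor_toPair (f : U →ₗ[k] V ⊗[k] W) (z : T' ⊗[k] (U ⊗[k] T)) :
    (toPair f).lTensor T' z = (TensorProduct.assoc k V W T).toLinearMap.lTensor T'
      ((f.rTensor T).lTensor T' z) :=
  LinearMap.lTensor_comp_apply _ _ _ _

theorem lTensor_onFst (f : V →ₗ[k] k) (z : T' ⊗[k] (V ⊗[k] T)) :
    (onFst f).lTensor T' z = (TensorProduct.lid k T).toLinearMap.lTensor T'
      ((f.rTensor T).lTensor T' z) :=
  LinearMap.lTensor_comp_apply _ _ _ _

theorem lTensor_onTwo (f : U ⊗[k] V →ₗ[k] k) (z : T' ⊗[k] (U ⊗[k] (V ⊗[k] T))) :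
    (onTwo f).lTensor T' z = (TensorProduct.lid k T).toLinearMap.lTensor T'
      ((onPair f).lTensor T' z) :=
  LinearMap.lTensor_comp_apply _ _ _ _

theorem onPair_assoc (f : U ⊗[k] V →ₗ[k] W) (z : U ⊗[k] V) (t : T) :
    onPair f (TensorProduct.assoc k U V T (z ⊗ₜ t)) = f z ⊗ₜ t := by
  simp [onPair]

theorem rTensor_lTensor (f : U →ₗ[k] V) (φ : T →ₗ[k] T') (z : U ⊗[k] T) :
    f.rTensor T' (φ.lTensor U z) = φ.lTensor V (f.rTensor T z) := by
  rw [← LinearMap.comp_apply, LinearMap.rTensor_comp_lTensor, ← LinearMap.comp_apply,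
    LinearMap.lTensor_comp_rTensor]

theorem onPair_lTensor (f : U ⊗[k] V →ₗ[k] W) (φ : T →ₗ[k] T') (z : U ⊗[k] (V ⊗[k] T)) :
    onPair f ((φ.lTensor V).lTensor U z) = φ.lTensor W (onPair f z) := by
  induction z using TensorProduct.induction_on with
  | zero => simp
  | add x y hx hy => simp only [map_add, hx, hy]
  | tmul u z =>
    induction z using TensorProduct.induction_on with
    | zero => simp
    | add x y hx hy => simp only [map_add, TensorProduct.tmul_add, hx, hy]
    | tmul v t => simp

theorem lTensor_assoc (φ : T →ₗ[k] T') (z : (V ⊗[k] W) ⊗[k] T) :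
    (φ.lTensor W).lTensor V (TensorProduct.assoc k V W T z) =
      TensorProduct.assoc k V W T' (φ.lTensor (V ⊗[k] W) z) := by
  induction z using TensorProduct.induction_on with
  | zero => simp
  | add x y hx hy => simp only [map_add, hx, hy]
  | tmul u t =>
    induction u using TensorProduct.induction_on with
    | zero => simp
    | add x y hx hy => simp only [map_add, TensorProduct.add_tmul, hx, hy]
    | tmul v w => simp

theorem toPair_lTensor (f : U →ₗ[k] V ⊗[k] W) (φ : T →ₗ[k] T') (z : U ⊗[k] T) :
    toPair f (φ.lTensor U z) = (φ.lTensor W).lTensor V (toPair f z) := by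
  simp only [toPair, LinearMap.comp_apply, LinearEquiv.coe_coe, lTensor_assoc, rTensor_lTensor]

theorem onFst_lTensor (f : V →ₗ[k] k) (φ : T →ₗ[k] T') (z : V ⊗[k] T) :
    onFst f (φ.lTensor V z) = φ (onFst f z) := by
  induction z using TensorProduct.induction_on with
  | zero => simp
  | add x y hx hy => simp only [map_add, hx, hy]
  | tmul u t => simp

/-- Equality of linear maps persists below a tensor factor. -/
theorem lTensor_congr {p q : T →ₗ[k] T'} (h : ∀ z, p z = q z) (z : U ⊗[k] T) :
    p.lTensor U z = q.lTensor U z := by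
  rw [LinearMap.ext h]

variable {k B U V W U' V' W' T T' : Type*} [Field k] [Ring B] [HopfAlgebra k B]
  [AddCommMonoid U] [Module k U] [AddCommMonoid V] [Module k V] [AddCommMonoid W] [Module k W]
  [AddCommMonoid U'] [Module k U'] [AddCommMonoid V'] [Module k V']
  [AddCommMonoid W'] [Module k W']
  [AddCommMonoid T] [Module k T] [AddCommMonoid T'] [Module k T']

open Coalgebra (comul counit)

/-- The braiding of the first two factors. -/
def br (X : YDData k B V) (Y : YDData k B W) : V ⊗[k] (W ⊗[k] T) →ₗ[k] W ⊗[k] (V ⊗[k] T) :=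
  (TensorProduct.assoc k W V T).toLinearMap ∘ₗ onPair (X.braid Y)

theorem br_tmul (X : YDData k B V) (Y : YDData k B W) (v : V) (w : W) (t : T) :
    br X Y (v ⊗ₜ (w ⊗ₜ t)) = TensorProduct.assoc k W V T (X.braid Y (v ⊗ₜ w) ⊗ₜ t) := rfl

theorem br_tmul' (X : YDData k B V) (Y : YDData k B W) (v : V) (w : W) (t : T) :
    br X Y (v ⊗ₜ (w ⊗ₜ t)) =
      TensorProduct.map (Y.orbit w) ((TensorProduct.mk k V T).flip t) (X.coact v) := by
  rw [br_tmul, braid_tmul]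
  induction X.coact v using TensorProduct.induction_on with
  | zero => simp
  | add x y hx hy => simp only [map_add, TensorProduct.add_tmul, hx, hy]
  | tmul v w => simp

theorem br_lTensor (X : YDData k B V) (Y : YDData k B W) (φ : T →ₗ[k] T')
    (z : V ⊗[k] (W ⊗[k] T)) :
    br X Y ((φ.lTensor W).lTensor V z) = (φ.lTensor V).lTensor W (br X Y z) := by
  simp only [br, LinearMap.comp_apply, LinearEquiv.coe_coe, lTensor_assoc, onPair_lTensor]

/-- Two linear maps on `V ⊗ (W ⊗ T)` agree if they agree on pure tensors. -/
theorem ext_two {p q : U ⊗[k] (V ⊗[k] T) →ₗ[k] W}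
    (h : ∀ u v t, p (u ⊗ₜ (v ⊗ₜ t)) = q (u ⊗ₜ (v ⊗ₜ t))) (z) : p z = q z := by
  congr 1; ext u v t; exact h u v t

theorem ext_three {p q : U ⊗[k] (V ⊗[k] (W ⊗[k] T)) →ₗ[k] W'}
    (h : ∀ u v w t, p (u ⊗ₜ (v ⊗ₜ (w ⊗ₜ t))) = q (u ⊗ₜ (v ⊗ₜ (w ⊗ₜ t)))) (z) : p z = q z := by
  congr 1; ext u v w t; exact h u v w t

/-- Naturality of the braiding: in the first variable it is colinearity of the morphism, in the
second (`br_rTensor_right`) linearity. -/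
theorem br_rTensor_left {X : YDData k B V} {X' : YDData k B V'} (Y : YDData k B W)
    {f : V →ₗ[k] V'} (hf : X.IsHom X' f) (z : V ⊗[k] (W ⊗[k] T)) :
    br X' Y (f.rTensor _ z) = (f.rTensor T).lTensor W (br X Y z) := by
  refine ext_two (p := br X' Y ∘ₗ f.rTensor _) (q := (f.rTensor T).lTensor W ∘ₗ br X Y) ?_ z
  intro v w t
  simp only [LinearMap.comp_apply, LinearMap.rTensor_tmul, br_tmul', hf.coact]
  induction X.coact v using TensorProduct.induction_on with
  | zero => simp
  | add x y hx hy => simp only [map_add, hx, hy]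
  | tmul v w => simp

theorem br_rTensor_right (X : YDData k B V) {Y : YDData k B W} {Y' : YDData k B W'}
    {f : W →ₗ[k] W'} (hf : Y.IsHom Y' f) (z : V ⊗[k] (W ⊗[k] T)) :
    br X Y' ((f.rTensor T).lTensor V z) = f.rTensor _ (br X Y z) := by
  refine ext_two (p := br X Y' ∘ₗ (f.rTensor T).lTensor V) (q := f.rTensor _ ∘ₗ br X Y) ?_ z
  intro v w t
  simp only [LinearMap.comp_apply, LinearMap.rTensor_tmul, LinearMap.lTensor_tmul, br_tmul',
    hf.orbit]
  induction X.coact v using TensorProduct.induction_on with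
  | zero => simp
  | add x y hx hy => simp only [map_add, hx, hy]
  | tmul v w => simp

/-- A hexagon identity: the coaction of a tensor product multiplies in B, and (bc) · w = b · (c ·
w). -/
theorem br_tensor_left (X : YDData k B U) (Y : YDData k B V) {Z : YDData k B W} (hZ : Z.IsYD)
    (z : U ⊗[k] (V ⊗[k] (W ⊗[k] T))) :
    br (X.tensor Y) Z ((TensorProduct.assoc k U V _).symm z) =
      (TensorProduct.assoc k U V T).symm.toLinearMap.lTensor W
        (br X Z ((br Y Z).lTensor U z)) := by
  refine ext_three (p := br (X.tensor Y) Z ∘ₗ (TensorProduct.assoc k U V _).symm.toLinearMap)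
    (q := (TensorProduct.assoc k U V T).symm.toLinearMap.lTensor W ∘ₗ br X Z ∘ₗ
      (br Y Z).lTensor U) ?_ z
  intro u v w t
  simp only [LinearMap.comp_apply, LinearMap.lTensor_tmul, LinearEquiv.coe_coe,
    TensorProduct.assoc_symm_tmul, br_tmul', tensor_coact_tmul]
  induction Y.coact v using TensorProduct.induction_on with
  | zero => simp
  | add x y hx hy => simp only [map_add, TensorProduct.tmul_add, hx, hy]
  | tmul b v =>
    rw [TensorProduct.map_tmul, LinearMap.flip_apply, TensorProduct.mk_apply, br_tmul']
    induction X.coact u using TensorProduct.induction_on with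
    | zero => simp
    | add x y hx hy => simp only [map_add, TensorProduct.add_tmul, hx, hy]
    | tmul c u =>
      simp only [coactMul_tmul, TensorProduct.map_tmul, LinearMap.flip_apply,
        TensorProduct.mk_apply, orbit_apply, hZ.mul_act, LinearMap.lTensor_tmul,
        LinearEquiv.coe_coe, TensorProduct.assoc_symm_tmul]

/-- The other hexagon: B acts on V ⊗ W through Δ, and coassociativity of the coaction on `U` turns
Δ(u₍₋₁₎) ⊗ u₍₀₎ into an iterated coaction. -/
theorem br_tensor_right {X : YDData k B U} (hX : X.IsYD) (Y : YDData k B V) (Z : YDData k B W)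
    (z : U ⊗[k] (V ⊗[k] (W ⊗[k] T))) :
    br X (Y.tensor Z) ((TensorProduct.assoc k V W T).symm.toLinearMap.lTensor U z) =
      (TensorProduct.assoc k V W _).symm ((br X Z).lTensor V (br X Y z)) := by
  refine ext_three
    (p := br X (Y.tensor Z) ∘ₗ (TensorProduct.assoc k V W T).symm.toLinearMap.lTensor U)
    (q := (TensorProduct.assoc k V W _).symm.toLinearMap ∘ₗ (br X Z).lTensor V ∘ₗ br X Y) ?_ z
  intro u v w t
  simp only [LinearMap.comp_apply, LinearMap.lTensor_tmul, LinearEquiv.coe_coe,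
    TensorProduct.assoc_symm_tmul, br_tmul']
  let Ψ : B ⊗[k] (B ⊗[k] U) →ₗ[k] (V ⊗[k] W) ⊗[k] (U ⊗[k] T) :=
    (TensorProduct.assoc k V W _).symm.toLinearMap ∘ₗ
    TensorProduct.map (Y.orbit v)
      (TensorProduct.map (Z.orbit w) ((TensorProduct.mk k U T).flip t))
  trans Ψ (X.coact.lTensor B (X.coact u))
  · rw [← hX.coassoc_apply]
    induction X.coact u using TensorProduct.induction_on with
    | zero => simp
    | add x y hx hy => simp only [map_add, hx, hy]
    | tmul c u =>
      rw [TensorProduct.map_tmul, LinearMap.rTensor_tmul, orbit_apply, tensor_act_tmul]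
      induction comul (R := k) c using TensorProduct.induction_on with
      | zero => simp
      | add x y hx hy => simp only [map_add, TensorProduct.add_tmul, hx, hy]
      | tmul c d => simp [Ψ]
  · induction X.coact u using TensorProduct.induction_on with
    | zero => simp
    | add x y hx hy => simp only [map_add, hx, hy]
    | tmul c u => simp [Ψ, br_tmul']

theorem br_unit_left {Y : YDData k B W} (hY : Y.IsYD) (c : k) (w : W) (t : T) :
    br (unit k B) Y (c ⊗ₜ (w ⊗ₜ t)) = w ⊗ₜ (c ⊗ₜ t) := by
  simp [br_tmul', unit, hY.one_act]

theorem br_unit_right {X : YDData k B V} (hX : X.IsYD) (v : V) (c : k) (t : T) :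
    br X (unit k B) (v ⊗ₜ (c ⊗ₜ t)) = c ⊗ₜ (v ⊗ₜ t) := by
  rw [br_tmul']
  conv_rhs => rw [← hX.counit_coact_apply v]
  induction X.coact v using TensorProduct.induction_on with
  | zero => simp
  | add x y hx hy => simp only [map_add, TensorProduct.tmul_add, TensorProduct.add_tmul, hx, hy]
  | tmul b v => simp [unit, ← TensorProduct.smul_tmul', TensorProduct.tmul_smul, -smul_eq_mul]

/-! ### Sliding morphisms through the braiding -/

section Slide

variable {X : YDData k B U} {Y : YDData k B V} {Z : YDData k B W} {A : YDData k B U'}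

/-- Naturality combined with the hexagon: a strand that crosses the output of `f` may cross its two
inputs instead. The variants below treat maps with two outputs, and functionals, where the crossing
with the unit object disappears. -/
theorem br_onPair_left {f : U ⊗[k] V →ₗ[k] W} (hf : (X.tensor Y).IsHom Z f) (hA : A.IsYD)
    (z : U ⊗[k] (V ⊗[k] (U' ⊗[k] T))) :
    br Z A (onPair f z) = (onPair f).lTensor U' (br X A ((br Y A).lTensor U z)) := by
  rw [onPair_apply, br_rTensor_left A hf, br_tensor_left X Y hA, lTensor_onPair]

theorem br_onPair_right {f : U ⊗[k] V →ₗ[k] W} (hf : (X.tensor Y).IsHom Z f) (hA : A.IsYD)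
    (z : U' ⊗[k] (U ⊗[k] (V ⊗[k] T))) :
    br A Z ((onPair f).lTensor U' z) = onPair f ((br A Y).lTensor U (br A X z)) := by
  rw [lTensor_onPair, br_rTensor_right A hf, br_tensor_right hA X Y, onPair_apply]

theorem br_toPair_left {f : W →ₗ[k] U ⊗[k] V} (hf : Z.IsHom (X.tensor Y) f) (hA : A.IsYD)
    (z : W ⊗[k] (U' ⊗[k] T)) :
    br X A ((br Y A).lTensor U (toPair f z)) = (toPair f).lTensor U' (br Z A z) := by
  rw [toPair_apply, lTensor_toPair, ← br_rTensor_left A hf]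
  have := br_tensor_left (T := T) X Y hA (TensorProduct.assoc k U V _ (f.rTensor _ z))
  rw [LinearEquiv.symm_apply_apply] at this
  rw [this, ← LinearMap.lTensor_comp_apply]
  simp

theorem br_toPair_right {f : W →ₗ[k] U ⊗[k] V} (hf : Z.IsHom (X.tensor Y) f) (hA : A.IsYD)
    (z : U' ⊗[k] (W ⊗[k] T)) :
    (br A Y).lTensor U (br A X ((toPair f).lTensor U' z)) = toPair f (br A Z z) := by
  rw [toPair_apply, ← br_rTensor_right A hf]
  have := br_tensor_right (T := T) hA X Y ((toPair f).lTensor U' z)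
  rw [LinearEquiv.eq_symm_apply] at this
  rw [← this, lTensor_toPair, ← LinearMap.lTensor_comp_apply]
  congr 2
  simp

theorem br_onTwo_left {f : U ⊗[k] V →ₗ[k] k} (hf : (X.tensor Y).IsHom (unit k B) f) (hA : A.IsYD)
    (z : U ⊗[k] (V ⊗[k] (U' ⊗[k] T))) :
    onTwo f z = (onTwo f).lTensor U' (br X A ((br Y A).lTensor U z)) := by
  rw [lTensor_onTwo, ← br_onPair_left hf hA, onTwo_apply]
  refine ext_two (p := (TensorProduct.lid k _).toLinearMap)
    (q := (TensorProduct.lid k T).toLinearMap.lTensor U' ∘ₗ br (unit k B) A) ?_ _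
  intro c u t
  simp [br_unit_left hA, TensorProduct.smul_tmul']

theorem br_onTwo_right {f : U ⊗[k] V →ₗ[k] k} (hf : (X.tensor Y).IsHom (unit k B) f)
    (hA : A.IsYD) (z : U' ⊗[k] (U ⊗[k] (V ⊗[k] T))) :
    (onTwo f).lTensor U' z = onTwo f ((br A Y).lTensor U (br A X z)) := by
  rw [onTwo_apply, ← br_onPair_right hf hA, lTensor_onTwo]
  refine ext_two (p := (TensorProduct.lid k T).toLinearMap.lTensor U')
    (q := (TensorProduct.lid k _).toLinearMap ∘ₗ br A (unit k B)) ?_ _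
  intro c u t
  simp [br_unit_right hA]

theorem br_onFst_left {f : V →ₗ[k] k} (hf : Y.IsHom (unit k B) f) (hA : A.IsYD)
    (z : V ⊗[k] (U' ⊗[k] T)) :
    onFst f z = (onFst f).lTensor U' (br Y A z) := by
  rw [lTensor_onFst, ← br_rTensor_left _ hf, onFst_apply]
  refine ext_two (p := (TensorProduct.lid k _).toLinearMap)
    (q := (TensorProduct.lid k T).toLinearMap.lTensor U' ∘ₗ br (unit k B) A) ?_ _
  intro c u t
  simp [br_unit_left hA, TensorProduct.smul_tmul']

theorem br_onFst_right {f : V →ₗ[k] k} (hf : Y.IsHom (unit k B) f) (hA : A.IsYD)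
    (z : U' ⊗[k] (V ⊗[k] T)) :
    (onFst f).lTensor U' z = onFst f (br A Y z) := by
  rw [onFst_apply, ← br_rTensor_right _ hf, lTensor_onFst]
  refine ext_two (p := (TensorProduct.lid k T).toLinearMap.lTensor U')
    (q := (TensorProduct.lid k _).toLinearMap ∘ₗ br A (unit k B)) ?_ _
  intro c u t
  simp [br_unit_right hA]

theorem br_one_left {e : V} (he : (unit k B).IsHom Y (LinearMap.toSpanSingleton k V e))
    (hA : A.IsYD) (u : U') (t : T) : br Y A (e ⊗ₜ (u ⊗ₜ t)) = u ⊗ₜ (e ⊗ₜ t) := by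
  have := br_rTensor_left A he ((1 : k) ⊗ₜ (u ⊗ₜ t))
  simpa [br_unit_left hA] using this

theorem br_one_right {e : V} (he : (unit k B).IsHom Y (LinearMap.toSpanSingleton k V e))
    (hA : A.IsYD) (u : U') (t : T) : br A Y (u ⊗ₜ (e ⊗ₜ t)) = e ⊗ₜ (u ⊗ₜ t) := by
  have := br_rTensor_right A he (u ⊗ₜ ((1 : k) ⊗ₜ t))
  simpa [br_unit_right hA] using this

/-- The braid relation is the naturality of the crossing with `U` applied to the morphism C_{V,W}.
-/
theorem yang_baxter (hX : X.IsYD) (hY : Y.IsYD) (hZ : Z.IsYD) (z : U ⊗[k] (V ⊗[k] (W ⊗[k] T))) :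
    br Y Z ((br X Z).lTensor V (br X Y z)) = (br X Y).lTensor W (br X Z ((br Y Z).lTensor U z)) := by
  have := br_toPair_right (T := T) (isHom_braid hY hZ) hX
    ((TensorProduct.assoc k V W T).symm.toLinearMap.lTensor U z)
  rw [br_tensor_right hX, ← LinearMap.lTensor_comp_apply] at this
  exact this.symm

end Slide

end Tail

end YDData

end

open scoped TensorProduct

noncomputable section

namespace YDData

open Coalgebra (comul counit)
open HopfAlgebra (antipode)

/-! ### Separation of tensors by functionals -/

section Separation

variable {k V M A : Type*} [Field k] [AddCommMonoid V] [Module k V]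
  [AddCommGroup M] [Module k M] [AddCommGroup A] [Module k A]

/-- `a ⊗ f ↦ f(v) a`. -/
def applyAt (v : V) : A ⊗[k] Module.Dual k V →ₗ[k] A :=
  (TensorProduct.rid k A).toLinearMap ∘ₗ (Module.Dual.eval k V v).lTensor A

@[simp] theorem applyAt_tmul (v : V) (a : A) (f : Module.Dual k V) :
    applyAt v (a ⊗ₜ[k] f) = f v • a := by simp [applyAt]

/-- The map A ⊗ V^* → Hom(V, A) is injective for V of any dimension, as one sees on coordinates in a
basis of A. -/
theorem ext_applyAt {s t : A ⊗[k] Module.Dual k V} (h : ∀ v, applyAt v s = applyAt v t) :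
    s = t := by
  let b := Module.Free.chooseBasis k A
  have key : ∀ (s : A ⊗[k] Module.Dual k V) (v : V) i,
      TensorProduct.equivFinsuppOfBasisLeft b s i v = b.repr (applyAt v s) i := by
    intro s v i
    induction s using TensorProduct.induction_on with
    | zero => simp
    | add x y hx hy => simp [hx, hy]
    | tmul a f => simp [mul_comm]
  apply (TensorProduct.equivFinsuppOfBasisLeft b).injective
  ext i v
  rw [key, key, h]

theorem ext_onFst {M : Type*} [AddCommMonoid M] [Module k M] [Module.Free k M] {s t : A ⊗[k] M}
    (h : ∀ g : Module.Dual k A, onFst g s = onFst g t) : s = t := by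
  let b := Module.Free.chooseBasis k M
  have key : ∀ (s : A ⊗[k] M) (g : Module.Dual k A) i,
      g (TensorProduct.equivFinsuppOfBasisRight b s i) = b.repr (onFst g s) i := by
    intro s v i
    induction s using TensorProduct.induction_on with
    | zero => simp
    | add x y hx hy => simp [hx, hy]
    | tmul a f => simp [mul_comm]
  apply (TensorProduct.equivFinsuppOfBasisRight b).injective
  ext i
  rw [← sub_eq_zero, ← Module.forall_dual_apply_eq_zero_iff k]
  intro g
  rw [map_sub, key, key, h, sub_self]

instance free_submodule_dual (N : Submodule k (Module.Dual k V)) : Module.Free k N :=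
  Module.Free.of_divisionRing k N

/-- By exactness of A ⊗ −, it is enough that `s` vanishes in A ⊗ (M/N), and functionals on A detect
this. -/
theorem mem_range_lTensor_subtype {N : Submodule k M} {s : A ⊗[k] M}
    (h : ∀ g : Module.Dual k A, onFst g s ∈ N) : s ∈ LinearMap.range (N.subtype.lTensor A) := by
  have hex := lTensor_exact A (LinearMap.exact_subtype_mkQ N) N.mkQ_surjective
  refine (hex s).1 (ext_onFst fun g => ?_)
  rw [onFst_lTensor, map_zero]
  simpa using h g

end Separation

/-! ### The antipode of `B` -/

section Antipode

variable {k B V : Type*} [Field k] [Ring B] [HopfAlgebra k B]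

/-- Both sides are convolution inverses of Δ in Hom(B, B ⊗ B). -/
theorem comul_antipode (b : B) : comul (R := k) (antipode k b) =
    TensorProduct.comm k B B
      (TensorProduct.map (antipode k) (antipode k) (comul (R := k) b)) := by
  have h : (comul ∘ₗ antipode k : B →ₗ[k] B ⊗[k] B) =
      (TensorProduct.comm k B B).toLinearMap ∘ₗ
        TensorProduct.map (antipode k) (antipode k) ∘ₗ comul := by
    apply WithConv.toConv_injective
    refine (left_inv_eq_right_inv (a := WithConv.toConv (comul : B →ₗ[k] B ⊗[k] B)) ?_
      (LinearMap.comul_right_inv (R := k))).symm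
    ext b
    -- `Ψ` sends a ⊗ b ⊗ c ⊗ d to S(b)c ⊗ S(a)d. The convolution product is thus S(b₂)b₃ ⊗ S(b₁)b₄,
    -- which collapses from the inside outwards.
    let Ψ : B ⊗[k] (B ⊗[k] (B ⊗[k] B)) →ₗ[k] B ⊗[k] B :=
      TensorProduct.map (LinearMap.mul' k B ∘ₗ (antipode k).rTensor B)
        (LinearMap.mul' k B ∘ₗ (antipode k).rTensor B) ∘ₗ
      (TensorProduct.leftComm k B (B ⊗[k] B) B).toLinearMap ∘ₗ
      (TensorProduct.assoc k B B B).symm.toLinearMap.lTensor B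
    have h₁ : ∀ d : B ⊗[k] B, LinearMap.mul' k (B ⊗[k] B)
        (TensorProduct.map ((TensorProduct.comm k B B).toLinearMap ∘ₗ
        TensorProduct.map (antipode k) (antipode k) ∘ₗ comul) comul d) =
        Ψ (((comul (R := k)).lTensor B).lTensor B
          (TensorProduct.assoc k B B B ((comul (R := k)).rTensor B d))) := by
      intro d
      induction d using TensorProduct.induction_on with
      | zero => simp
      | add x y hx hy => simp only [map_add, hx, hy]
      | tmul x y =>
        simp only [TensorProduct.map_tmul, LinearMap.comp_apply, LinearMap.rTensor_tmul,
          LinearMap.mul'_apply]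
        induction comul (R := k) x using TensorProduct.induction_on with
        | zero => simp
        | add x y hx hy => simp only [map_add, TensorProduct.add_tmul, add_mul, hx, hy]
        | tmul a b =>
          simp only [TensorProduct.assoc_tmul, LinearMap.lTensor_tmul]
          induction comul (R := k) y using TensorProduct.induction_on with
          | zero => simp
          | add x y hx hy => simp only [map_add, TensorProduct.tmul_add, mul_add, hx, hy]
          | tmul c d => simp [Ψ]
    have h₂ : ∀ (x : B) (e : B ⊗[k] B),
        Ψ (x ⊗ₜ (TensorProduct.assoc k B B B ((comul (R := k)).rTensor B e))) =
        1 ⊗ₜ (antipode k x * TensorProduct.lid k B ((counit (R := k)).rTensor B e)) := by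
      intro x e
      induction e using TensorProduct.induction_on with
      | zero => simp
      | add x y hx hy => simp only [map_add, TensorProduct.tmul_add, mul_add, hx, hy]
      | tmul y z =>
        trans (LinearMap.mul' k B ((antipode k).rTensor B (comul (R := k) y))) ⊗ₜ[k]
          (antipode k x * z)
        · simp only [LinearMap.rTensor_tmul]
          induction comul (R := k) y using TensorProduct.induction_on with
          | zero => simp
          | add x y hx hy => simp only [map_add, TensorProduct.add_tmul, TensorProduct.tmul_add,
              hx, hy]
          | tmul a b => simp [Ψ]
        · simp [Algebra.algebraMap_eq_smul_one, TensorProduct.smul_tmul]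
    have h₃ : ∀ d : B ⊗[k] B, Ψ (((comul (R := k)).lTensor B).lTensor B
          ((comul (R := k)).lTensor B d)) =
        1 ⊗ₜ LinearMap.mul' k B ((antipode k).rTensor B d) := by
      intro d
      induction d using TensorProduct.induction_on with
      | zero => simp
      | add x y hx hy => simp only [map_add, TensorProduct.tmul_add, hx, hy]
      | tmul x y =>
        simp only [LinearMap.lTensor_tmul, ← Coalgebra.coassoc_apply, h₂]
        simp
    rw [LinearMap.convMul_apply]
    rw [h₁, Coalgebra.coassoc_apply, h₃]
    simp [Algebra.algebraMap_eq_smul_one, Algebra.TensorProduct.one_def]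
  exact congr($h b)

variable (hB : antipode k (A := B) ∘ₗ antipode k (A := B) = LinearMap.id)
include hB

theorem antipode_antipode (b : B) : antipode k (antipode k b) = b := congr($hB b)

theorem antipodeInv_eq : antipodeInv k B = antipode k (A := B) := by
  let u : (Module.End k B)ˣ := ⟨antipode k, antipode k, hB, hB⟩
  exact Ring.inverse_unit u

/-- S(b₂)b₁ = S(S(b₁)b₂), because S reverses products and S² = 1. Likewise b₂S(b₁) = S(b₁S(b₂)) in
`antipode_mul_comm`. -/
theorem mul_antipode_comm (b : B) : LinearMap.mul' k B ((antipode k).rTensor B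
    (TensorProduct.comm k B B (comul (R := k) b))) = algebraMap k B (counit (R := k) b) := by
  trans antipode k (LinearMap.mul' k B ((antipode k).rTensor B (comul (R := k) b)))
  · induction comul (R := k) b using TensorProduct.induction_on with
    | zero => simp
    | add x y hx hy => simp only [map_add, hx, hy]
    | tmul a b => simp [HopfAlgebra.antipode_mul_antidistrib, antipode_antipode hB]
  · simp [Algebra.algebraMap_eq_smul_one]

theorem antipode_mul_comm (b : B) : LinearMap.mul' k B ((antipode k).lTensor B
    (TensorProduct.comm k B B (comul (R := k) b))) = algebraMap k B (counit (R := k) b) := by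
  trans antipode k (LinearMap.mul' k B ((antipode k).lTensor B (comul (R := k) b)))
  · induction comul (R := k) b using TensorProduct.induction_on with
    | zero => simp
    | add x y hx hy => simp only [map_add, hx, hy]
    | tmul a b => simp [HopfAlgebra.antipode_mul_antidistrib, antipode_antipode hB]
  · simp [Algebra.algebraMap_eq_smul_one]

end Antipode

end YDData

end

open scoped TensorProduct

noncomputable section

namespace YDData

open Coalgebra (comul counit)
open HopfAlgebra (antipode)

/-! ### Spanning families of B ⊗ V. -/

section Galois

variable {k B U V W T : Type*} [Field k] [Ring B] [HopfAlgebra k B]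
  [AddCommMonoid U] [Module k U] [AddCommMonoid V] [Module k V] [AddCommMonoid W] [Module k W]
  [AddCommMonoid T] [Module k T]

theorem ext_of_rightInverse {g : V →ₗ[k] V} (hg : ∀ z, ∃ y, g y = z) {p q : V →ₗ[k] W}
    (h : p ∘ₗ g = q ∘ₗ g) : p = q := by
  ext z
  obtain ⟨y, rfl⟩ := hg z
  exact congr($h y)

theorem surjective_of_tmul {g : U ⊗[k] V →ₗ[k] W} {i : U ⊗[k] V →ₗ[k] U ⊗[k] V}
    {f : U ⊗[k] V →ₗ[k] W} (h : ∀ u v, g (i (u ⊗ₜ v)) = f (u ⊗ₜ v)) (z) : ∃ y, g y = f z :=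
  ⟨i z, congr($(TensorProduct.ext' (g := g ∘ₗ i) (h := f) h) z)⟩

/-- The tensors `b₁ ⊗ b₂ · v` span `B ⊗ V`. -/
theorem IsYD.ext_comul {X : YDData k B V} (hX : X.IsYD) {p q : B ⊗[k] V →ₗ[k] W}
    (h : ∀ b v, p ((X.orbit v).lTensor B (comul (R := k) b)) =
      q ((X.orbit v).lTensor B (comul (R := k) b))) : p = q := by
  let g : B ⊗[k] V →ₗ[k] B ⊗[k] V := X.act.lTensor B ∘ₗ
    (TensorProduct.assoc k B B V).toLinearMap ∘ₗ (comul (R := k)).rTensor V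
  have hg : ∀ b v, g (b ⊗ₜ v) = (X.orbit v).lTensor B (comul (R := k) b) := by
    intro b v
    simp only [g, LinearMap.comp_apply, LinearMap.rTensor_tmul]
    induction comul (R := k) b using TensorProduct.induction_on with
    | zero => simp
    | add x y hx hy => simp only [map_add, TensorProduct.add_tmul, hx, hy]
    | tmul a b => simp
  refine ext_of_rightInverse (g := g) ?_ (TensorProduct.ext' fun b v => by
    simpa only [LinearMap.comp_apply, hg] using h b v)
  -- A preimage of b ⊗ v is b₁ ⊗ S(b₂) · v.
  refine surjective_of_tmul (f := LinearMap.id) (i := X.act.lTensor B ∘ₗ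
    (TensorProduct.assoc k B B V).toLinearMap ∘ₗ
    ((antipode k).lTensor B ∘ₗ comul (R := k)).rTensor V) fun b v => ?_
  have h₁ : ∀ d : B ⊗[k] B, g (X.act.lTensor B (TensorProduct.assoc k B B V
        ((antipode k).lTensor B d ⊗ₜ v))) =
      (X.orbit v ∘ₗ LinearMap.mul' k B ∘ₗ (antipode k).lTensor B).lTensor B
        (TensorProduct.assoc k B B B ((comul (R := k)).rTensor B d)) := by
    intro d
    induction d using TensorProduct.induction_on with
    | zero => simp
    | add x y hx hy => simp only [map_add, TensorProduct.add_tmul, hx, hy]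
    | tmul x y =>
      simp only [LinearMap.lTensor_tmul, TensorProduct.assoc_tmul, hg, LinearMap.rTensor_tmul]
      induction comul (R := k) x using TensorProduct.induction_on with
      | zero => simp
      | add x y hx hy => simp only [map_add, TensorProduct.add_tmul, hx, hy]
      | tmul a b => simp [hX.mul_act]
  simp only [LinearMap.comp_apply, LinearMap.rTensor_tmul, LinearEquiv.coe_coe, LinearMap.id_apply]
  rw [h₁, Coalgebra.coassoc_apply, ← LinearMap.lTensor_comp_apply]
  trans (X.orbit v).lTensor B ((Algebra.linearMap k B).lTensor B
    ((counit (R := k)).lTensor B (comul (R := k) b)))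
  · rw [← LinearMap.lTensor_comp_apply, ← LinearMap.lTensor_comp_apply]
    congr 2
    ext c
    simp
  · simp [hX.one_act]

/-- The tensors `b v₍₋₁₎ ⊗ v₍₀₎` span `B ⊗ V`. -/
theorem IsYD.ext_coact {X : YDData k B V} (hX : X.IsYD) {p q : B ⊗[k] V →ₗ[k] W}
    (h : ∀ b v, p ((LinearMap.mulLeft k b).rTensor V (X.coact v)) =
      q ((LinearMap.mulLeft k b).rTensor V (X.coact v))) : p = q := by
  let g : B ⊗[k] V →ₗ[k] B ⊗[k] V := (LinearMap.mul' k B).rTensor V ∘ₗ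
    (TensorProduct.assoc k B B V).symm.toLinearMap ∘ₗ X.coact.lTensor B
  have hg : ∀ b v, g (b ⊗ₜ v) = (LinearMap.mulLeft k b).rTensor V (X.coact v) := by
    intro b v
    simp only [g, LinearMap.comp_apply, LinearMap.lTensor_tmul]
    induction X.coact v using TensorProduct.induction_on with
    | zero => simp
    | add x y hx hy => simp only [map_add, TensorProduct.tmul_add, hx, hy]
    | tmul a b => simp
  refine ext_of_rightInverse (g := g) ?_ (TensorProduct.ext' fun b v => by
    simpa only [LinearMap.comp_apply, hg] using h b v)
  -- A preimage of b ⊗ v is b S(v₍₋₁₎) ⊗ v₍₀₎.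
  refine surjective_of_tmul (f := LinearMap.id) (i := (LinearMap.mul' k B).rTensor V ∘ₗ
    (TensorProduct.assoc k B B V).symm.toLinearMap ∘ₗ
    ((antipode k).rTensor V ∘ₗ X.coact).lTensor B) fun b v => ?_
  have h₁ : ∀ s : B ⊗[k] V, g ((LinearMap.mul' k B).rTensor V ((TensorProduct.assoc k B B V).symm
        (b ⊗ₜ (antipode k).rTensor V s))) =
      (LinearMap.mulLeft k b ∘ₗ LinearMap.mul' k B ∘ₗ (antipode k).rTensor B).rTensor V
        ((TensorProduct.assoc k B B V).symm (X.coact.lTensor B s)) := by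
    intro s
    induction s using TensorProduct.induction_on with
    | zero => simp
    | add x y hx hy => simp only [map_add, TensorProduct.tmul_add, hx, hy]
    | tmul x y =>
      simp only [LinearMap.rTensor_tmul, TensorProduct.assoc_symm_tmul, hg, LinearMap.lTensor_tmul]
      induction X.coact y using TensorProduct.induction_on with
      | zero => simp
      | add x y hx hy => simp only [map_add, TensorProduct.tmul_add, hx, hy]
      | tmul a b => simp
  simp only [LinearMap.comp_apply, LinearMap.lTensor_tmul, LinearEquiv.coe_coe, LinearMap.id_apply]
  rw [h₁, ← hX.coassoc_apply, LinearEquiv.symm_apply_apply, ← LinearMap.rTensor_comp_apply]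
  conv_rhs => rw [← hX.counit_coact_apply v]
  induction X.coact v using TensorProduct.induction_on with
  | zero => simp
  | add x y hx hy => simp only [map_add, TensorProduct.tmul_add, hx, hy]
  | tmul a c => simp [Algebra.algebraMap_eq_smul_one, TensorProduct.smul_tmul]

variable (hB : antipode k (A := B) ∘ₗ antipode k (A := B) = LinearMap.id)
include hB

/-- The tensors `b₂ ⊗ b₁ · v` span `B ⊗ V`. -/
theorem IsYD.ext_comul_comm {X : YDData k B V} (hX : X.IsYD) {p q : B ⊗[k] V →ₗ[k] W}
    (h : ∀ b v, p ((X.orbit v).lTensor B (TensorProduct.comm k B B (comul (R := k) b))) =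
      q ((X.orbit v).lTensor B (TensorProduct.comm k B B (comul (R := k) b)))) : p = q := by
  let g : B ⊗[k] V →ₗ[k] B ⊗[k] V := X.act.lTensor B ∘ₗ
    (TensorProduct.assoc k B B V).toLinearMap ∘ₗ
    ((TensorProduct.comm k B B).toLinearMap ∘ₗ comul (R := k)).rTensor V
  have hg : ∀ b v, g (b ⊗ₜ v) =
      (X.orbit v).lTensor B (TensorProduct.comm k B B (comul (R := k) b)) := by
    intro b v
    simp only [g, LinearMap.comp_apply, LinearMap.rTensor_tmul]
    induction comul (R := k) b using TensorProduct.induction_on with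
    | zero => simp
    | add x y hx hy => simp only [map_add, TensorProduct.add_tmul, hx, hy]
    | tmul a b => simp
  refine ext_of_rightInverse (g := g) ?_ (TensorProduct.ext' fun b v => by
    simpa only [LinearMap.comp_apply, hg] using h b v)
  -- A preimage of b ⊗ v is b₂ ⊗ S(b₁) · v; it works because b₂S(b₁) = ε(b), which needs S² = 1.
  refine surjective_of_tmul (f := LinearMap.id) (i := X.act.lTensor B ∘ₗ
    (TensorProduct.assoc k B B V).toLinearMap ∘ₗ
    ((antipode k).lTensor B ∘ₗ (TensorProduct.comm k B B).toLinearMap ∘ₗ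
      comul (R := k)).rTensor V) fun b v => ?_
  have h₁ : ∀ d : B ⊗[k] B, g (X.act.lTensor B (TensorProduct.assoc k B B V
        ((antipode k).lTensor B (TensorProduct.comm k B B d) ⊗ₜ v))) =
      (X.orbit v ∘ₗ LinearMap.mul' k B ∘ₗ (antipode k).lTensor B ∘ₗ
        (TensorProduct.comm k B B).toLinearMap).lTensor B
        (TensorProduct.comm k (B ⊗[k] B) B ((TensorProduct.assoc k B B B).symm
          ((comul (R := k)).lTensor B d))) := by
    intro d
    induction d using TensorProduct.induction_on with
    | zero => simp
    | add x y hx hy => simp only [map_add, TensorProduct.add_tmul, hx, hy]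
    | tmul x y =>
      simp only [LinearMap.lTensor_tmul, TensorProduct.assoc_tmul, hg, TensorProduct.comm_tmul]
      induction comul (R := k) y using TensorProduct.induction_on with
      | zero => simp
      | add x y hx hy => simp only [map_add, TensorProduct.tmul_add, hx, hy]
      | tmul a b => simp [hX.mul_act]
  simp only [LinearMap.comp_apply, LinearMap.rTensor_tmul, LinearEquiv.coe_coe, LinearMap.id_apply]
  rw [h₁, Coalgebra.coassoc_symm_apply]
  trans (X.orbit v).lTensor B ((Algebra.linearMap k B).lTensor B
    (TensorProduct.comm k k B ((counit (R := k)).rTensor B (comul (R := k) b))))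
  · induction comul (R := k) b using TensorProduct.induction_on with
    | zero => simp
    | add x y hx hy => simp only [map_add, hx, hy]
    | tmul a b => simp [antipode_mul_comm hB]
  · simp [hX.one_act]

/-- The tensors `v₍₋₁₎ b ⊗ v₍₀₎` span `B ⊗ V`. -/
theorem IsYD.ext_coact_comm {X : YDData k B V} (hX : X.IsYD) {p q : B ⊗[k] V →ₗ[k] W}
    (h : ∀ b v, p ((LinearMap.mulRight k b).rTensor V (X.coact v)) =
      q ((LinearMap.mulRight k b).rTensor V (X.coact v))) : p = q := by
  let g : B ⊗[k] V →ₗ[k] B ⊗[k] V :=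
    (LinearMap.mul' k B ∘ₗ (TensorProduct.comm k B B).toLinearMap).rTensor V ∘ₗ
    (TensorProduct.assoc k B B V).symm.toLinearMap ∘ₗ X.coact.lTensor B
  have hg : ∀ b v, g (b ⊗ₜ v) = (LinearMap.mulRight k b).rTensor V (X.coact v) := by
    intro b v
    simp only [g, LinearMap.comp_apply, LinearMap.lTensor_tmul]
    induction X.coact v using TensorProduct.induction_on with
    | zero => simp
    | add x y hx hy => simp only [map_add, TensorProduct.tmul_add, hx, hy]
    | tmul a b => simp
  refine ext_of_rightInverse (g := g) ?_ (TensorProduct.ext' fun b v => by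
    simpa only [LinearMap.comp_apply, hg] using h b v)
  -- A preimage of b ⊗ v is S(v₍₋₁₎) b ⊗ v₍₀₎; the element to collapse is v₍₋₁₎S(v₍₋₂₎), again by S²
  -- = 1.
  refine surjective_of_tmul (f := LinearMap.id)
    (i := (LinearMap.mul' k B ∘ₗ (TensorProduct.comm k B B).toLinearMap).rTensor V ∘ₗ
    (TensorProduct.assoc k B B V).symm.toLinearMap ∘ₗ
    ((antipode k).rTensor V ∘ₗ X.coact).lTensor B) fun b v => ?_
  have h₁ : ∀ s : B ⊗[k] V,
      g ((LinearMap.mul' k B ∘ₗ (TensorProduct.comm k B B).toLinearMap).rTensor V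
        ((TensorProduct.assoc k B B V).symm (b ⊗ₜ (antipode k).rTensor V s))) =
      (LinearMap.mulRight k b ∘ₗ LinearMap.mul' k B ∘ₗ (antipode k).lTensor B ∘ₗ
        (TensorProduct.comm k B B).toLinearMap).rTensor V
        ((TensorProduct.assoc k B B V).symm (X.coact.lTensor B s)) := by
    intro s
    induction s using TensorProduct.induction_on with
    | zero => simp
    | add x y hx hy => simp only [map_add, TensorProduct.tmul_add, hx, hy]
    | tmul x y =>
      simp only [LinearMap.rTensor_tmul, TensorProduct.assoc_symm_tmul, LinearMap.comp_apply,
        LinearEquiv.coe_coe, TensorProduct.comm_tmul, LinearMap.mul'_apply, hg,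
        LinearMap.lTensor_tmul]
      induction X.coact y using TensorProduct.induction_on with
      | zero => simp
      | add x y hx hy => simp only [map_add, TensorProduct.tmul_add, hx, hy]
      | tmul a b => simp [mul_assoc]
  refine (h₁ _).trans ?_
  rw [ ← hX.coassoc_apply, LinearEquiv.symm_apply_apply, ← LinearMap.rTensor_comp_apply]
  conv_rhs => rw [← hX.counit_coact_apply v]
  rw [LinearMap.id_apply]
  induction X.coact v using TensorProduct.induction_on with
  | zero => simp
  | add x y hx hy => simp only [map_add, TensorProduct.tmul_add, hx, hy]
  | tmul a c =>
    simp [antipode_mul_comm hB, Algebra.algebraMap_eq_smul_one, TensorProduct.smul_tmul]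

end Galois

/-! ### The inverse of the braiding. -/

section BraidInv

variable {k B U V W T : Type*} [Field k] [Ring B] [HopfAlgebra k B]
  [AddCommMonoid U] [Module k U] [AddCommMonoid V] [Module k V] [AddCommMonoid W] [Module k W]
  [AddCommMonoid T] [Module k T]

/-- The map `w ⊗ v ↦ v₍₀₎ ⊗ S(v₍₋₁₎) · w`, inverse to the braiding if `S² = 1`. -/
def braidInv (X : YDData k B V) (Y : YDData k B W) : W ⊗[k] V →ₗ[k] V ⊗[k] W :=
  (TensorProduct.comm k W V).toLinearMap ∘ₗ Y.act.rTensor V ∘ₗ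
    (TensorProduct.rightComm k B V W).toLinearMap ∘ₗ
    ((antipode k).rTensor V ∘ₗ X.coact).rTensor W ∘ₗ (TensorProduct.comm k W V).toLinearMap

theorem braidInv_tmul (X : YDData k B V) (Y : YDData k B W) (v : V) (w : W) :
    X.braidInv Y (w ⊗ₜ v) =
      TensorProduct.comm k W V ((Y.orbit w ∘ₗ antipode k).rTensor V (X.coact v)) := by
  simp only [braidInv, LinearMap.comp_apply, LinearEquiv.coe_coe, TensorProduct.comm_tmul,
    LinearMap.rTensor_tmul]
  induction X.coact v using TensorProduct.induction_on with
  | zero => simp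
  | add x y hx hy => simp only [map_add, TensorProduct.add_tmul, hx, hy]
  | tmul a b => simp

variable (hB : antipode k (A := B) ∘ₗ antipode k (A := B) = LinearMap.id)
include hB

/-- The composite acts on `w` by v₍₋₁₎S(v₍₋₂₎), in the other order by S(v₍₋₁₎)v₍₋₂₎; both collapse
thanks to S² = 1. -/
theorem braid_braidInv {X : YDData k B V} {Y : YDData k B W} (hX : X.IsYD) (hY : Y.IsYD)
    (z : W ⊗[k] V) : X.braid Y (X.braidInv Y z) = z := by
  induction z using TensorProduct.induction_on with
  | zero => simp
  | add x y hx hy => simp only [map_add, hx, hy]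
  | tmul w v =>
    rw [braidInv_tmul]
    have h₁ : ∀ s : B ⊗[k] V, X.braid Y (TensorProduct.comm k W V
        ((Y.orbit w ∘ₗ antipode k).rTensor V s)) =
        (Y.orbit w ∘ₗ LinearMap.mul' k B ∘ₗ (antipode k).lTensor B ∘ₗ
          (TensorProduct.comm k B B).toLinearMap).rTensor V
          ((TensorProduct.assoc k B B V).symm (X.coact.lTensor B s)) := by
      intro s
      induction s using TensorProduct.induction_on with
      | zero => simp
      | add x y hx hy => simp only [map_add, hx, hy]
      | tmul a v =>
        simp only [LinearMap.rTensor_tmul, TensorProduct.comm_tmul, braid_tmul,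
          LinearMap.lTensor_tmul]
        induction X.coact v using TensorProduct.induction_on with
        | zero => simp
        | add x y hx hy => simp only [map_add, TensorProduct.tmul_add, hx, hy]
        | tmul a b => simp [hY.mul_act]
    rw [h₁, ← hX.coassoc_apply, LinearEquiv.symm_apply_apply]
    conv_rhs => rw [← hX.counit_coact_apply v]
    induction X.coact v using TensorProduct.induction_on with
    | zero => simp
    | add x y hx hy => simp only [map_add, TensorProduct.tmul_add, hx, hy]
    | tmul a c =>
      simp [antipode_mul_comm hB, Algebra.algebraMap_eq_smul_one, TensorProduct.smul_tmul,
        hY.one_act]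

theorem braidInv_braid {X : YDData k B V} {Y : YDData k B W} (hX : X.IsYD) (hY : Y.IsYD)
    (z : V ⊗[k] W) : X.braidInv Y (X.braid Y z) = z := by
  induction z using TensorProduct.induction_on with
  | zero => simp
  | add x y hx hy => simp only [map_add, hx, hy]
  | tmul v w =>
    rw [braid_tmul]
    have h₁ : ∀ s : B ⊗[k] V, X.braidInv Y ((Y.orbit w).rTensor V s) =
        TensorProduct.comm k W V ((Y.orbit w ∘ₗ LinearMap.mul' k B ∘ₗ (antipode k).rTensor B ∘ₗ
          (TensorProduct.comm k B B).toLinearMap).rTensor V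
          ((TensorProduct.assoc k B B V).symm (X.coact.lTensor B s))) := by
      intro s
      induction s using TensorProduct.induction_on with
      | zero => simp
      | add x y hx hy => simp only [map_add, hx, hy]
      | tmul a v =>
        simp only [LinearMap.rTensor_tmul, braidInv_tmul, LinearMap.lTensor_tmul]
        induction X.coact v using TensorProduct.induction_on with
        | zero => simp
        | add x y hx hy => simp only [map_add, TensorProduct.tmul_add, hx, hy]
        | tmul a b => simp [hY.mul_act]
    rw [h₁, ← hX.coassoc_apply, LinearEquiv.symm_apply_apply]
    conv_rhs => rw [← hX.counit_coact_apply v]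
    induction X.coact v using TensorProduct.induction_on with
    | zero => simp
    | add x y hx hy => simp only [map_add, TensorProduct.add_tmul, hx, hy]
    | tmul a c =>
      simp [mul_antipode_comm hB, Algebra.algebraMap_eq_smul_one, TensorProduct.smul_tmul,
        hY.one_act]

end BraidInv

/-! ### The dual Yetter–Drinfeld module. -/

section Dual

variable {k B U V W : Type*} [Field k] [Ring B] [HopfAlgebra k B] [FiniteDimensional k B]
  [AddCommMonoid U] [Module k U] [AddCommMonoid V] [Module k V] [AddCommMonoid W] [Module k W]

variable (hB : antipode k (A := B) ∘ₗ antipode k (A := B) = LinearMap.id)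
include hB

/-- The basis-free form of the dual coaction, with S⁻¹ replaced by S; through `ext_applyAt` it
determines the coaction. -/
theorem applyAt_dual_coact (X : YDData k B V) (f : Module.Dual k V) (v : V) :
    applyAt v (X.dual.coact f) = antipode k (TensorProduct.rid k B (f.lTensor B (X.coact v))) := by
  have h₁ : ∀ t : B ⊗[k] Module.Dual k V, TensorProduct.rid k B ((ev k V).lTensor B
      (TensorProduct.assoc k B (Module.Dual k V) V (t ⊗ₜ v))) = applyAt v t := by
    intro t
    induction t using TensorProduct.induction_on with
    | zero => simp
    | add x y hx hy => simp only [map_add, TensorProduct.add_tmul, hx, hy]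
    | tmul a b => simp
  rw [← h₁, dual_coact_eval, antipodeInv_eq hB]
  induction X.coact v using TensorProduct.induction_on with
  | zero => simp
  | add x y hx hy => simp only [map_add, hx, hy]
  | tmul a b => simp

/-- Every axiom is tested on elements of `V`. Since S reverses products and coproducts, the
compatibility of V^* at b is that of `V` at S(b) with its two sides exchanged. -/
theorem isYD_dual {X : YDData k B V} (hX : X.IsYD) : X.dual.IsYD where
  one_act f := by ext v; simp [dual_act_apply, hX.one_act]
  mul_act a b f := by
    ext v
    simp [dual_act_apply, hX.mul_act, HopfAlgebra.antipode_mul_antidistrib]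
  coassoc := by
    ext f
    simp only [LinearMap.comp_apply, LinearEquiv.coe_coe]
    apply (TensorProduct.assoc k B B (Module.Dual k V)).symm.injective
    rw [LinearEquiv.symm_apply_apply]
    refine ext_applyAt fun v => ?_
    have h₁ : ∀ t : B ⊗[k] Module.Dual k V, applyAt v ((comul (R := k)).rTensor _ t) =
        comul (R := k) (applyAt v t) := by
      intro t
      induction t using TensorProduct.induction_on with
      | zero => simp
      | add x y hx hy => simp only [map_add, hx, hy]
      | tmul a b => simp
    have h₂ : ∀ t : B ⊗[k] Module.Dual k V, applyAt v ((TensorProduct.assoc k B B _).symm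
        (X.dual.coact.lTensor B t)) = TensorProduct.comm k B B ((antipode k).rTensor B
          ((dualTensorHom k V B (TensorProduct.comm k _ _ t)).lTensor B (X.coact v))) := by
      intro t
      induction t using TensorProduct.induction_on with
      | zero => simp
      | add x y hx hy => simp only [map_add, LinearMap.lTensor_add, LinearMap.add_apply, hx, hy]
      | tmul a f =>
        rw [LinearMap.lTensor_tmul]
        trans a ⊗ₜ applyAt v (X.dual.coact f)
        · induction X.dual.coact f using TensorProduct.induction_on with
          | zero => simp
          | add x y hx hy => simp only [map_add, TensorProduct.tmul_add, hx, hy]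
          | tmul a b => simp
        · rw [applyAt_dual_coact hB]
          induction X.coact v using TensorProduct.induction_on with
          | zero => simp
          | add x y hx hy => simp only [map_add, TensorProduct.tmul_add, hx, hy]
          | tmul a b => simp
    -- The coaction of `f`, read as a map V → B, is w ↦ S(w₍₋₁₎) f(w₍₀₎).
    have h₃ : dualTensorHom k V B (TensorProduct.comm k _ _ (X.dual.coact f)) =
        antipode k ∘ₗ (TensorProduct.rid k B).toLinearMap ∘ₗ f.lTensor B ∘ₗ X.coact := by
      ext w
      refine Eq.trans ?_ (applyAt_dual_coact hB X f w)
      induction X.dual.coact f using TensorProduct.induction_on with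
      | zero => simp
      | add x y hx hy => simp only [map_add, LinearMap.add_apply, hx, hy]
      | tmul a b => simp
    rw [h₁, h₂, h₃, applyAt_dual_coact hB, ← LinearMap.comp_assoc, ← LinearMap.comp_assoc,
      LinearMap.lTensor_comp_apply, ← hX.coassoc_apply]
    induction X.coact v using TensorProduct.induction_on with
    | zero => simp
    | add x y hx hy => simp only [map_add, hx, hy]
    | tmul a v =>
      simp only [LinearMap.lTensor_tmul, TensorProduct.rid_tmul, map_smul, comul_antipode,
        LinearMap.rTensor_tmul]
      induction comul (R := k) a using TensorProduct.induction_on with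
      | zero => simp
      | add x y hx hy => simp only [map_add, TensorProduct.add_tmul, smul_add, hx, hy]
      | tmul a b => simp
  counit_coact := by
    ext f v
    simp only [LinearMap.comp_apply, LinearEquiv.coe_coe, LinearMap.id_apply]
    trans counit (R := k) (applyAt v (X.dual.coact f))
    · induction X.dual.coact f using TensorProduct.induction_on with
      | zero => simp
      | add x y hx hy => simp only [map_add, LinearMap.add_apply, hx, hy]
      | tmul a b => simp [mul_comm]
    · rw [applyAt_dual_coact hB]
      conv_rhs => rw [← hX.counit_coact_apply v]
      induction X.coact v using TensorProduct.induction_on with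
      | zero => simp
      | add x y hx hy => simp only [map_add, hx, hy]
      | tmul a b => simp [mul_comm]
  compat := by
    refine (adj_iff _).2 fun f => ?_
    ext b
    simp only [LinearMap.comp_apply]
    refine ext_applyAt fun v => ?_
    have hL : ∀ d : B ⊗[k] B, applyAt v (X.dual.adjL (X.dual.coact f) d) =
        antipode k (TensorProduct.rid k B (f.lTensor B (X.adjR v
          (TensorProduct.comm k B B (TensorProduct.map (antipode k) (antipode k) d))))) := by
      intro d
      induction d using TensorProduct.induction_on with
      | zero => simp
      | add x y hx hy => simp only [map_add, hx, hy]
      | tmul b c =>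
        trans b * applyAt (X.act (antipode k c ⊗ₜ v)) (X.dual.coact f)
        · induction X.dual.coact f using TensorProduct.induction_on with
          | zero => simp
          | add x y hx hy => simp only [map_add, adjL_add, LinearMap.add_apply, mul_add, hx, hy]
          | tmul a b => simp [dual_act_apply]
        · rw [applyAt_dual_coact hB, TensorProduct.map_tmul, TensorProduct.comm_tmul, adjR_tmul]
          induction X.coact (X.act (antipode k c ⊗ₜ v)) using TensorProduct.induction_on with
          | zero => simp
          | add x y hx hy => simp only [map_add, mul_add, hx, hy]
          | tmul a b => simp [HopfAlgebra.antipode_mul_antidistrib, antipode_antipode hB]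
    have hR : ∀ d : B ⊗[k] B, applyAt v (X.dual.adjR f d) =
        antipode k (TensorProduct.rid k B (f.lTensor B (X.adjL (X.coact v)
          (TensorProduct.comm k B B (TensorProduct.map (antipode k) (antipode k) d))))) := by
      intro d
      induction d using TensorProduct.induction_on with
      | zero => simp
      | add x y hx hy => simp only [map_add, hx, hy]
      | tmul b c =>
        trans applyAt v (X.dual.coact (X.dual.act (b ⊗ₜ f))) * c
        · rw [adjR_tmul]
          induction X.dual.coact (X.dual.act (b ⊗ₜ f)) using TensorProduct.induction_on with
          | zero => simp
          | add x y hx hy => simp only [map_add, add_mul, hx, hy]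
          | tmul a b => simp
        · rw [applyAt_dual_coact hB, TensorProduct.map_tmul, TensorProduct.comm_tmul]
          induction X.coact v using TensorProduct.induction_on with
          | zero => simp
          | add x y hx hy => simp only [map_add, adjL_add, LinearMap.add_apply, add_mul, hx, hy]
          | tmul a w =>
            simp [HopfAlgebra.antipode_mul_antidistrib, antipode_antipode hB, dual_act_apply]
    rw [hL, hR, ← comul_antipode, hX.adj]

end Dual

end YDData

end

open scoped TensorProduct

noncomputable section

namespace YDData

open Coalgebra (comul counit)
open HopfAlgebra (antipode)

section BrInv

variable {k B U V W T T' : Type*} [Field k] [Ring B] [HopfAlgebra k B]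
  [AddCommMonoid U] [Module k U] [AddCommMonoid V] [Module k V] [AddCommMonoid W] [Module k W]
  [AddCommMonoid T] [Module k T] [AddCommMonoid T'] [Module k T']

/-- The inverse braiding of the first two factors. -/
def brInv (X : YDData k B V) (Y : YDData k B W) : W ⊗[k] (V ⊗[k] T) →ₗ[k] V ⊗[k] (W ⊗[k] T) :=
  (TensorProduct.assoc k V W T).toLinearMap ∘ₗ onPair (X.braidInv Y)

theorem brInv_lTensor (X : YDData k B V) (Y : YDData k B W) (φ : T →ₗ[k] T')
    (z : W ⊗[k] (V ⊗[k] T)) :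
    brInv X Y ((φ.lTensor V).lTensor W z) = (φ.lTensor W).lTensor V (brInv X Y z) := by
  simp only [brInv, LinearMap.comp_apply, LinearEquiv.coe_coe, lTensor_assoc, onPair_lTensor]

theorem brInv_tmul (X : YDData k B V) (Y : YDData k B W) (v : V) (w : W) (t : T) :
    brInv X Y (w ⊗ₜ (v ⊗ₜ t)) = TensorProduct.assoc k V W T (X.braidInv Y (w ⊗ₜ v) ⊗ₜ t) := rfl

theorem br_assoc (X : YDData k B V) (Y : YDData k B W) (z : V ⊗[k] W) (t : T) :
    br X Y (TensorProduct.assoc k V W T (z ⊗ₜ t)) =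
      TensorProduct.assoc k W V T (X.braid Y z ⊗ₜ t) := by
  rw [br, LinearMap.comp_apply, onPair_assoc, LinearEquiv.coe_coe]

variable (hB : antipode k (A := B) ∘ₗ antipode k (A := B) = LinearMap.id)
include hB

theorem br_brInv {X : YDData k B V} {Y : YDData k B W} (hX : X.IsYD) (hY : Y.IsYD)
    (z : W ⊗[k] (V ⊗[k] T)) : br X Y (brInv X Y z) = z := by
  refine ext_two (p := br X Y ∘ₗ brInv X Y) (q := LinearMap.id) (fun w v t => ?_) z
  rw [LinearMap.comp_apply, brInv_tmul, br_assoc, braid_braidInv hB hX hY]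
  rfl

theorem brInv_br {X : YDData k B V} {Y : YDData k B W} (hX : X.IsYD) (hY : Y.IsYD)
    (z : V ⊗[k] (W ⊗[k] T)) : brInv X Y (br X Y z) = z := by
  refine ext_two (p := brInv X Y ∘ₗ br X Y) (q := LinearMap.id) (fun w v t => ?_) z
  rw [LinearMap.comp_apply, br_tmul, brInv, LinearMap.comp_apply, onPair_assoc,
    braidInv_braid hB hX hY]
  rfl

end BrInv

/-! ### Morphisms to the unit object, evaluation, and currying. -/

section UnitHom

variable {k B U V W : Type*} [Field k] [Ring B] [HopfAlgebra k B]
  [AddCommMonoid U] [Module k U] [AddCommMonoid V] [Module k V] [AddCommMonoid W] [Module k W]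

/-- `b ⊗ c` with `c` a scalar, as an element of `B`. -/
theorem unit_coact_eq_iff (c : k) (s : B ⊗[k] k) :
    (unit k B).coact c = s ↔ TensorProduct.rid k B s = algebraMap k B c := by
  rw [← (TensorProduct.rid k B).injective.eq_iff, Algebra.algebraMap_eq_smul_one]
  simp [unit, eq_comm]

theorem unit_act_tmul (b : B) (c : k) : (unit k B).act (b ⊗ₜ c) = counit (R := k) b * c := by
  simp [unit]

theorem isHom_unit_iff (X : YDData k B V) (f : V →ₗ[k] k) : X.IsHom (unit k B) f ↔
    (∀ b v, f (X.act (b ⊗ₜ v)) = counit (R := k) b * f v) ∧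
    ∀ v, TensorProduct.rid k B (f.lTensor B (X.coact v)) = algebraMap k B (f v) := by
  constructor
  · intro h
    refine ⟨fun b v => by rw [h.act, unit_act_tmul], fun v => ?_⟩
    rw [← unit_coact_eq_iff, h.coact]
  · rintro ⟨h₁, h₂⟩
    exact .mk' (fun b v => by rw [h₁, unit_act_tmul])
      (fun v => (unit_coact_eq_iff _ _).2 (h₂ v))

theorem isHom_tensor_unit_iff (X : YDData k B V) (Y : YDData k B W) (f : V ⊗[k] W →ₗ[k] k) :
    (X.tensor Y).IsHom (unit k B) f ↔
    (∀ b v w, f (TensorProduct.map (X.orbit v) (Y.orbit w) (comul (R := k) b)) =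
      counit (R := k) b * f (v ⊗ₜ w)) ∧
    ∀ v w, TensorProduct.rid k B (f.lTensor B (coactMul k B V W (X.coact v ⊗ₜ Y.coact w))) =
      algebraMap k B (f (v ⊗ₜ w)) := by
  rw [isHom_unit_iff]
  refine and_congr ⟨fun h b v w => ?_, fun h b z => ?_⟩ ⟨fun h v w => ?_, fun h z => ?_⟩
  · rw [← tensor_act_tmul, h]
  · induction z using TensorProduct.induction_on with
    | zero => simp
    | add x y hx hy => simp only [map_add, TensorProduct.tmul_add, mul_add, hx, hy]
    | tmul v w => rw [tensor_act_tmul, h]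
  · rw [← tensor_coact_tmul, h]
  · induction z using TensorProduct.induction_on with
    | zero => simp
    | add x y hx hy => simp only [map_add, hx, hy]
    | tmul v w => rw [tensor_coact_tmul, h]

end UnitHom

section DualHom

variable {k B U V W : Type*} [Field k] [Ring B] [HopfAlgebra k B] [FiniteDimensional k B]
  [AddCommMonoid U] [Module k U] [AddCommMonoid V] [Module k V] [AddCommMonoid W] [Module k W]

variable (hB : antipode k (A := B) ∘ₗ antipode k (A := B) = LinearMap.id)
include hB

/-- Linearity collapses S(b₁)b₂ and colinearity S(v₍₋₁₎)v₍₋₂₎; only the latter needs S² = 1. -/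
theorem isHom_ev {X : YDData k B V} (hX : X.IsYD) :
    (X.dual.tensor X).IsHom (unit k B) (ev k V) := by
  refine (isHom_tensor_unit_iff _ _ _).2 ⟨fun b f v => ?_, fun f v => ?_⟩
  · trans f (X.orbit v (LinearMap.mul' k B ((antipode k).rTensor B (comul (R := k) b))))
    · induction comul (R := k) b using TensorProduct.induction_on with
      | zero => simp
      | add x y hx hy => simp only [map_add, hx, hy]
      | tmul a b => simp [dual_act_apply, hX.mul_act]
    · simp [Algebra.algebraMap_eq_smul_one, hX.one_act]
  · trans TensorProduct.rid k B (f.lTensor B ((LinearMap.mul' k B ∘ₗ (antipode k).rTensor B ∘ₗ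
        (TensorProduct.comm k B B).toLinearMap).rTensor V
          ((TensorProduct.assoc k B B V).symm (X.coact.lTensor B (X.coact v)))))
    · induction X.coact v using TensorProduct.induction_on with
      | zero => simp
      | add x y hx hy => simp only [map_add, TensorProduct.tmul_add, hx, hy]
      | tmul a v =>
        trans applyAt v (X.dual.coact f) * a
        · induction X.dual.coact f using TensorProduct.induction_on with
          | zero => simp
          | add x y hx hy => simp only [map_add, TensorProduct.add_tmul, add_mul, hx, hy]
          | tmul a v => simp
        · rw [applyAt_dual_coact hB, LinearMap.lTensor_tmul]
          induction X.coact v using TensorProduct.induction_on with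
          | zero => simp
          | add x y hx hy => simp only [map_add, TensorProduct.tmul_add, add_mul, hx, hy]
          | tmul a v => simp
    · rw [← hX.coassoc_apply, LinearEquiv.symm_apply_apply]
      conv_rhs => rw [← hX.counit_coact_apply v]
      induction X.coact v using TensorProduct.induction_on with
      | zero => simp
      | add x y hx hy => simp only [map_add, TensorProduct.tmul_add, hx, hy]
      | tmul a v =>
        simp [mul_antipode_comm hB, Algebra.algebraMap_eq_smul_one, smul_smul, mul_comm]

/-- With the factors in the other order it is linearity, through S(b₂)b₁, that needs S² = 1, while
colinearity collapses v₍₋₂₎S(v₍₋₁₎). -/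
theorem isHom_ev_comm {X : YDData k B V} (hX : X.IsYD) :
    (X.tensor X.dual).IsHom (unit k B)
      (ev k V ∘ₗ (TensorProduct.comm k V (Module.Dual k V)).toLinearMap) := by
  refine (isHom_tensor_unit_iff _ _ _).2 ⟨fun b v f => ?_, fun v f => ?_⟩
  · trans f (X.orbit v (LinearMap.mul' k B ((antipode k).rTensor B
      (TensorProduct.comm k B B (comul (R := k) b)))))
    · induction comul (R := k) b using TensorProduct.induction_on with
      | zero => simp
      | add x y hx hy => simp only [map_add, hx, hy]
      | tmul a b => simp [dual_act_apply, hX.mul_act]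
    · simp [mul_antipode_comm hB, Algebra.algebraMap_eq_smul_one, hX.one_act]
  · trans TensorProduct.rid k B (f.lTensor B ((LinearMap.mul' k B ∘ₗ (antipode k).lTensor B).rTensor
      V ((TensorProduct.assoc k B B V).symm (X.coact.lTensor B (X.coact v)))))
    · induction X.coact v using TensorProduct.induction_on with
      | zero => simp
      | add x y hx hy => simp only [map_add, TensorProduct.add_tmul, hx, hy]
      | tmul a v =>
        trans a * applyAt v (X.dual.coact f)
        · induction X.dual.coact f using TensorProduct.induction_on with
          | zero => simp
          | add x y hx hy => simp only [map_add, TensorProduct.tmul_add, mul_add, hx, hy]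
          | tmul a v => simp
        · rw [applyAt_dual_coact hB, LinearMap.lTensor_tmul]
          induction X.coact v using TensorProduct.induction_on with
          | zero => simp
          | add x y hx hy => simp only [map_add, TensorProduct.tmul_add, mul_add, hx, hy]
          | tmul a v => simp
    · rw [← hX.coassoc_apply, LinearEquiv.symm_apply_apply]
      conv_rhs => rw [LinearMap.comp_apply, LinearEquiv.coe_coe, TensorProduct.comm_tmul,
        contractLeft_apply, ← hX.counit_coact_apply v]
      induction X.coact v using TensorProduct.induction_on with
      | zero => simp
      | add x y hx hy => simp only [map_add, hx, hy]
      | tmul a v =>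
        simp [Algebra.algebraMap_eq_smul_one, smul_smul, mul_comm]

/-- A morphism `U ⊗ V → k` gives a morphism `U → V^*`. -/
theorem IsHom.curry {X : YDData k B U} {Y : YDData k B V} (hY : Y.IsYD) {F : U ⊗[k] V →ₗ[k] k}
    (hF : (X.tensor Y).IsHom (unit k B) F) : X.IsHom Y.dual (TensorProduct.curry F) := by
  obtain ⟨h₁, h₂⟩ := (isHom_tensor_unit_iff _ _ _).1 hF
  refine .mk' (fun b u => ?_) (fun u => ?_)
  -- On the spanning tensors b₁ ⊗ b₂ · v both maps give ε(b)F(u ⊗ v).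
  · have := hY.ext_comul (p := F ∘ₗ (X.orbit u).rTensor V)
      (q := F ∘ₗ TensorProduct.mk k U V u ∘ₗ Y.act ∘ₗ (antipode k).rTensor V) ?_
    · ext v
      exact congr($this (b ⊗ₜ v))
    · intro b v
      trans counit (R := k) b * F (u ⊗ₜ v)
      · rw [← h₁, LinearMap.comp_apply, ← LinearMap.rTensor_comp_lTensor]
        rfl
      · trans F (u ⊗ₜ Y.orbit v (LinearMap.mul' k B ((antipode k).rTensor B (comul (R := k) b))))
        · simp [Algebra.algebraMap_eq_smul_one, hY.one_act]
        · induction comul (R := k) b using TensorProduct.induction_on with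
          | zero => simp
          | add x y hx hy => simp only [map_add, TensorProduct.tmul_add, hx, hy]
          | tmul a b => simp [hY.mul_act]
  · refine ext_applyAt fun v => ?_
    rw [applyAt_dual_coact hB]
    let q : B ⊗[k] V →ₗ[k] B := LinearMap.mul' k B ∘ₗ (TensorProduct.comm k B B).toLinearMap ∘ₗ
      (antipode k ∘ₗ (TensorProduct.rid k B).toLinearMap ∘ₗ
        (TensorProduct.curry F u).lTensor B ∘ₗ Y.coact).lTensor B
    let p : B ⊗[k] V →ₗ[k] B := (TensorProduct.rid k B).toLinearMap ∘ₗ F.lTensor B ∘ₗ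
      coactMul k B U V ∘ₗ TensorProduct.mk k _ _ (X.coact u)
    have hp : ∀ b v, p (b ⊗ₜ v) =
        applyAt v ((TensorProduct.curry F).lTensor B (X.coact u)) * b := by
      intro b v
      simp only [p, LinearMap.comp_apply, TensorProduct.mk_apply]
      induction X.coact u using TensorProduct.induction_on with
      | zero => simp
      | add x y hx hy => simp only [map_add, TensorProduct.add_tmul, add_mul, hx, hy]
      | tmul a b => simp
    -- On the spanning tensors v₍₋₁₎b ⊗ v₍₀₎ colinearity of `F` gives F(u ⊗ v) b for `p`, and
    -- S(v₍₋₁₎)v₍₋₂₎ collapses in `q`.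
    have := hY.ext_coact_comm hB (p := p) (q := q) ?_
    · have h := congr($this (1 ⊗ₜ v))
      rw [hp, mul_one] at h
      rw [h]
      simp [q]
    · intro b v
      trans algebraMap k B (F (u ⊗ₜ v)) * b
      · rw [← h₂]
        simp only [p, LinearMap.comp_apply, TensorProduct.mk_apply, LinearEquiv.coe_coe]
        induction Y.coact v using TensorProduct.induction_on with
        | zero => simp
        | add x y hx hy => simp only [map_add, TensorProduct.tmul_add, add_mul, hx, hy]
        | tmul c v =>
          induction X.coact u using TensorProduct.induction_on with
          | zero => simp
          | add x y hx hy => simp only [map_add, TensorProduct.add_tmul, add_mul, hx, hy]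
          | tmul a u => simp [mul_assoc]
      · have hq : ∀ s : B ⊗[k] V, q ((LinearMap.mulRight k b).rTensor V s) =
            TensorProduct.rid k B ((TensorProduct.curry F u).lTensor B
              ((LinearMap.mul' k B ∘ₗ (antipode k).rTensor B ∘ₗ
              (TensorProduct.comm k B B).toLinearMap).rTensor V
              ((TensorProduct.assoc k B B V).symm (Y.coact.lTensor B s)))) * b := by
          intro s
          induction s using TensorProduct.induction_on with
          | zero => simp
          | add x y hx hy => simp only [map_add, add_mul, hx, hy]
          | tmul a v =>
            simp only [q, LinearMap.comp_apply, LinearMap.rTensor_tmul, LinearMap.lTensor_tmul]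
            induction Y.coact v using TensorProduct.induction_on with
            | zero => simp
            | add x y hx hy =>
              simp only [map_add, TensorProduct.tmul_add, add_mul, hx, hy]
            | tmul a v => simp [mul_assoc]
        rw [hq, ← hY.coassoc_apply, LinearEquiv.symm_apply_apply]
        conv_lhs => rw [← hY.counit_coact_apply v]
        congr 1
        induction Y.coact v using TensorProduct.induction_on with
        | zero => simp
        | add x y hx hy => simp only [map_add, TensorProduct.tmul_add, hx, hy]
        | tmul a v =>
          simp [mul_antipode_comm hB, Algebra.algebraMap_eq_smul_one, smul_smul, mul_comm]

/-- A morphism `V ⊗ U → k` gives a morphism `U → V^*`, as `S² = 1`. -/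
theorem IsHom.curry_comm {X : YDData k B U} {Y : YDData k B V} (hY : Y.IsYD)
    {F : V ⊗[k] U →ₗ[k] k} (hF : (Y.tensor X).IsHom (unit k B) F) :
    X.IsHom Y.dual (TensorProduct.curry F).flip := by
  obtain ⟨h₁, h₂⟩ := (isHom_tensor_unit_iff _ _ _).1 hF
  refine .mk' (fun b u => ?_) (fun u => ?_)
  -- As `V` now stands on the left, the appropriate spanning tensors are b₂ ⊗ b₁ · v here and b
  -- v₍₋₁₎ ⊗ v₍₀₎ for the coaction.
  · have := hY.ext_comul_comm hB (p := F ∘ₗ (TensorProduct.comm k U V).toLinearMap ∘ₗ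
        (X.orbit u).rTensor V)
      (q := (TensorProduct.curry F).flip u ∘ₗ Y.act ∘ₗ (antipode k).rTensor V) ?_
    · ext v
      exact congr($this (b ⊗ₜ v))
    · intro b v
      trans counit (R := k) b * F (v ⊗ₜ u)
      · rw [← h₁]
        simp only [LinearMap.comp_apply]
        induction comul (R := k) b using TensorProduct.induction_on with
        | zero => simp
        | add x y hx hy => simp only [map_add, hx, hy]
        | tmul a b => simp
      · trans F (Y.orbit v (LinearMap.mul' k B ((antipode k).rTensor B
          (TensorProduct.comm k B B (comul (R := k) b)))) ⊗ₜ u)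
        · simp [mul_antipode_comm hB, Algebra.algebraMap_eq_smul_one, hY.one_act,
            ← TensorProduct.smul_tmul']
        · induction comul (R := k) b using TensorProduct.induction_on with
          | zero => simp
          | add x y hx hy => simp only [map_add, TensorProduct.add_tmul, hx, hy]
          | tmul a b => simp [hY.mul_act]
  · refine ext_applyAt fun v => ?_
    rw [applyAt_dual_coact hB]
    let q : B ⊗[k] V →ₗ[k] B := LinearMap.mul' k B ∘ₗ
      (antipode k ∘ₗ (TensorProduct.rid k B).toLinearMap ∘ₗ
        ((TensorProduct.curry F).flip u).lTensor B ∘ₗ Y.coact).lTensor B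
    let p : B ⊗[k] V →ₗ[k] B := (TensorProduct.rid k B).toLinearMap ∘ₗ F.lTensor B ∘ₗ
      coactMul k B V U ∘ₗ (TensorProduct.mk k _ _).flip (X.coact u)
    have hp : ∀ b v, p (b ⊗ₜ v) =
        b * applyAt v ((TensorProduct.curry F).flip.lTensor B (X.coact u)) := by
      intro b v
      simp only [p, LinearMap.comp_apply, TensorProduct.mk_apply, LinearMap.flip_apply]
      induction X.coact u using TensorProduct.induction_on with
      | zero => simp
      | add x y hx hy => simp only [map_add, TensorProduct.tmul_add, mul_add, hx, hy]
      | tmul a b => simp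
    have := hY.ext_coact (p := p) (q := q) ?_
    · have h := congr($this (1 ⊗ₜ v))
      rw [hp, one_mul] at h
      rw [h]
      simp [q]
    · intro b v
      trans b * algebraMap k B (F (v ⊗ₜ u))
      · rw [← h₂]
        simp only [p, LinearMap.comp_apply, TensorProduct.mk_apply, LinearEquiv.coe_coe,
          LinearMap.flip_apply]
        induction Y.coact v using TensorProduct.induction_on with
        | zero => simp
        | add x y hx hy => simp only [map_add, TensorProduct.add_tmul, mul_add, hx, hy]
        | tmul c v =>
          induction X.coact u using TensorProduct.induction_on with
          | zero => simp
          | add x y hx hy => simp only [map_add, TensorProduct.tmul_add, mul_add, hx, hy]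
          | tmul a u => simp [mul_assoc]
      · have hq : ∀ s : B ⊗[k] V, q ((LinearMap.mulLeft k b).rTensor V s) =
            b * TensorProduct.rid k B (((TensorProduct.curry F).flip u).lTensor B
              ((LinearMap.mul' k B ∘ₗ (antipode k).lTensor B).rTensor V
              ((TensorProduct.assoc k B B V).symm (Y.coact.lTensor B s)))) := by
          intro s
          induction s using TensorProduct.induction_on with
          | zero => simp
          | add x y hx hy => simp only [map_add, mul_add, hx, hy]
          | tmul a v =>
            simp only [q, LinearMap.comp_apply, LinearMap.rTensor_tmul, LinearMap.lTensor_tmul]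
            induction Y.coact v using TensorProduct.induction_on with
            | zero => simp
            | add x y hx hy =>
              simp only [map_add, TensorProduct.tmul_add, mul_add, hx, hy]
            | tmul a v => simp [mul_assoc]
        rw [hq, ← hY.coassoc_apply, LinearEquiv.symm_apply_apply]
        conv_lhs => rw [← hY.counit_coact_apply v]
        congr 1
        induction Y.coact v using TensorProduct.induction_on with
        | zero => simp
        | add x y hx hy => simp only [map_add, TensorProduct.add_tmul, hx, hy]
        | tmul a v =>
          simp [Algebra.algebraMap_eq_smul_one, smul_smul, ← TensorProduct.smul_tmul']

end DualHom

end YDData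

end

open scoped TensorProduct

noncomputable section

namespace YDData

open Coalgebra (comul counit)
open HopfAlgebra (antipode)

/-! ### Applying identities of maps below a tensor factor. -/

section Congr

variable {k U V W W' W'' V' T : Type*} [Field k] [AddCommMonoid U] [Module k U]
  [AddCommMonoid V] [Module k V] [AddCommMonoid W] [Module k W] [AddCommMonoid W'] [Module k W']
  [AddCommMonoid T] [Module k T] [AddCommMonoid V'] [Module k V']
  [AddCommMonoid W''] [Module k W'']

/-- The indices count the maps composed on the two sides of the identity; these lemmas allow such an
identity to be used as a rewrite rule behind a factor `U`. -/
theorem under₂₂ {g : T →ₗ[k] V} {f : V →ₗ[k] W} {q : T →ₗ[k] W'} {p : W' →ₗ[k] W}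
    (h : ∀ z, f (g z) = p (q z)) (z : U ⊗[k] T) :
    f.lTensor U (g.lTensor U z) = p.lTensor U (q.lTensor U z) := by
  rw [← LinearMap.lTensor_comp_apply, ← LinearMap.lTensor_comp_apply]
  exact lTensor_congr h z

theorem under₂₁ {g : T →ₗ[k] V} {f : V →ₗ[k] W} {q : T →ₗ[k] W}
    (h : ∀ z, f (g z) = q z) (z : U ⊗[k] T) :
    f.lTensor U (g.lTensor U z) = q.lTensor U z := by
  rw [← LinearMap.lTensor_comp_apply]
  exact lTensor_congr h z

theorem under₂₃ {g : T →ₗ[k] V} {f : V →ₗ[k] W} {r : T →ₗ[k] W''} {q : W'' →ₗ[k] W'}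
    {p : W' →ₗ[k] W} (h : ∀ z, f (g z) = p (q (r z))) (z : U ⊗[k] T) :
    f.lTensor U (g.lTensor U z) = p.lTensor U (q.lTensor U (r.lTensor U z)) := by
  rw [← LinearMap.lTensor_comp_apply, ← LinearMap.lTensor_comp_apply,
    ← LinearMap.lTensor_comp_apply]
  exact lTensor_congr h z

theorem under₃₂ {g : T →ₗ[k] V} {f : V →ₗ[k] W} {f' : W →ₗ[k] V'} {q : T →ₗ[k] W'}
    {p : W' →ₗ[k] V'} (h : ∀ z, f' (f (g z)) = p (q z)) (z : U ⊗[k] T) :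
    f'.lTensor U (f.lTensor U (g.lTensor U z)) = p.lTensor U (q.lTensor U z) := by
  rw [← LinearMap.lTensor_comp_apply, ← LinearMap.lTensor_comp_apply,
    ← LinearMap.lTensor_comp_apply]
  exact lTensor_congr h z

theorem under₃₃ {g : T →ₗ[k] V} {f : V →ₗ[k] W} {f' : W →ₗ[k] V'} {r : T →ₗ[k] W''}
    {q : W'' →ₗ[k] W'} {p : W' →ₗ[k] V'} (h : ∀ z, f' (f (g z)) = p (q (r z))) (z : U ⊗[k] T) :
    f'.lTensor U (f.lTensor U (g.lTensor U z)) = p.lTensor U (q.lTensor U (r.lTensor U z)) := by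
  rw [← LinearMap.lTensor_comp_apply, ← LinearMap.lTensor_comp_apply,
    ← LinearMap.lTensor_comp_apply, ← LinearMap.lTensor_comp_apply]
  exact lTensor_congr h z

theorem under₄₁ {g : T →ₗ[k] V} {f : V →ₗ[k] W} {f' : W →ₗ[k] V'} {f'' : V' →ₗ[k] W'}
    {q : T →ₗ[k] W'} (h : ∀ z, f'' (f' (f (g z))) = q z) (z : U ⊗[k] T) :
    f''.lTensor U (f'.lTensor U (f.lTensor U (g.lTensor U z))) = q.lTensor U z := by
  rw [← LinearMap.lTensor_comp_apply, ← LinearMap.lTensor_comp_apply,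
    ← LinearMap.lTensor_comp_apply]
  exact lTensor_congr h z

end Congr

/-! ### The antipode of H is braided anti-comultiplicative. -/

section BraidedHopf

variable {k B H M T T' : Type*} [Field k] [Ring B] [HopfAlgebra k B] [Ring H] [Algebra k H]
  [AddCommMonoid M] [Module k M] [AddCommMonoid T] [Module k T] [AddCommMonoid T'] [Module k T']

variable (k H T) in
/-- Multiplication of the first two factors. -/
abbrev mulF : H ⊗[k] (H ⊗[k] T) →ₗ[k] H ⊗[k] T := onPair (LinearMap.mul' k H)

theorem mulF_assoc (z : H ⊗[k] (H ⊗[k] (H ⊗[k] T))) :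
    mulF k H T (mulF k H _ z) = mulF k H T ((mulF k H T).lTensor H z) := by
  refine ext_three (p := mulF k H T ∘ₗ mulF k H _)
    (q := mulF k H T ∘ₗ (mulF k H T).lTensor H) (fun a b c t => ?_) z
  simp [mul_assoc]

theorem mulF_one (z : H ⊗[k] T) : mulF k H T (1 ⊗ₜ z) = z := by
  induction z using TensorProduct.induction_on with
  | zero => simp
  | add x y hx hy => simp only [TensorProduct.tmul_add, map_add, hx, hy]
  | tmul a t => simp

theorem mulF_lTensor_one (z : H ⊗[k] T) :
    mulF k H T ((TensorProduct.mk k H T 1).lTensor H z) = z := by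
  induction z using TensorProduct.induction_on with
  | zero => simp
  | add x y hx hy => simp only [map_add, hx, hy]
  | tmul a t => simp

/-- The product `(a ⊗ b) ⊗ (c ⊗ d) ↦ (m ⊗ m)(a ⊗ C(b ⊗ c) ⊗ d)` of `H ⊗ H`. -/
def mulTwo (X : YDData k B H) (T : Type*) [AddCommMonoid T] [Module k T] :
    H ⊗[k] (H ⊗[k] (H ⊗[k] (H ⊗[k] T))) →ₗ[k] H ⊗[k] (H ⊗[k] T) :=
  mulF k H _ ∘ₗ ((mulF k H _).lTensor H).lTensor H ∘ₗ (br X X).lTensor H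

theorem mulTwo_apply (X : YDData k B H) (z : H ⊗[k] (H ⊗[k] (H ⊗[k] (H ⊗[k] T)))) :
    mulTwo X T z = mulF k H _ (((mulF k H _).lTensor H).lTensor H ((br X X).lTensor H z)) := rfl

theorem mulTwo_lTensor (X : YDData k B H) (φ : T →ₗ[k] T')
    (z : H ⊗[k] (H ⊗[k] (H ⊗[k] (H ⊗[k] T)))) :
    mulTwo X T' ((((φ.lTensor H).lTensor H).lTensor H).lTensor H z) =
      (φ.lTensor H).lTensor H (mulTwo X T z) := by
  rw [mulTwo_apply, under₂₂ (br_lTensor X X (φ.lTensor H)),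
    under₂₂ (under₂₂ (onPair_lTensor (LinearMap.mul' k H) φ)), onPair_lTensor]
  rfl

/-- The braided tensor square H ⊗ H is associative: products slide through the middle crossings by
naturality, and what remains are maps on disjoint factors and associativity of `H`. -/
theorem mulTwo_assoc {X : YDData k B H} (hX : X.IsYD)
    (hm : (X.tensor X).IsHom X (LinearMap.mul' k H)) (z) :
    mulTwo X T (mulTwo X _ z) = mulTwo X T (((mulTwo X T).lTensor H).lTensor H z) := by
  rw [mulTwo_apply, mulTwo_apply, ← onPair_lTensor, ← onPair_lTensor, mulF_assoc,
    under₂₃ (under₂₃ (br_onPair_left (T := H ⊗[k] T) hm hX))]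
  have h : mulTwo X T = mulF k H _ ∘ₗ ((mulF k H T).lTensor H).lTensor H ∘ₗ
    (br X X (T := H ⊗[k] T)).lTensor H := rfl
  rw [h]
  simp only [LinearMap.lTensor_comp, LinearMap.comp_apply]
  rw [under₂₃ (br_onPair_right (T := H ⊗[k] T) hm hX),
    under₂₂ (br_lTensor X X ((mulF k H T).lTensor H)),
    under₂₂ (under₂₂ (br_lTensor X X (mulF k H T))),
    under₂₂ (onPair_lTensor (LinearMap.mul' k H) ((mulF k H T).lTensor H)),
    under₂₂ (br_lTensor X X (br X X (T := H ⊗[k] T))),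
    under₂₂ (onPair_lTensor (LinearMap.mul' k H) (mulF k H T)),
    under₂₂ (onPair_lTensor (LinearMap.mul' k H) (mulF k H (H ⊗[k] T))),
    under₂₂ (under₂₂ (mulF_assoc (T := T)))]

theorem mulTwo_one {X : YDData k B H} (hX : X.IsYD)
    (he : (unit k B).IsHom X (Algebra.linearMap k H)) (z : H ⊗[k] (H ⊗[k] T)) :
    mulTwo X T (1 ⊗ₜ (1 ⊗ₜ z)) = z := by
  have he' : (unit k B).IsHom X (LinearMap.toSpanSingleton k H 1) := by
    convert he using 1
    ext
    simp
  refine ext_two (p := mulTwo X T ∘ₗ TensorProduct.mk k H _ 1 ∘ₗ TensorProduct.mk k H _ 1)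
    (q := LinearMap.id) (fun a b t => ?_) z
  simp [mulTwo_apply, br_one_left he' hX]

theorem br_lTensor_one {X : YDData k B H} {Y : YDData k B M} (hY : Y.IsYD)
    (he : (unit k B).IsHom X (Algebra.linearMap k H)) (z : M ⊗[k] T) :
    br Y X ((TensorProduct.mk k H T 1).lTensor M z) = 1 ⊗ₜ z := by
  have he' : (unit k B).IsHom X (LinearMap.toSpanSingleton k H 1) := by
    convert he using 1
    ext
    simp
  induction z using TensorProduct.induction_on with
  | zero => simp
  | add x y hx hy => simp only [map_add, TensorProduct.tmul_add, hx, hy]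
  | tmul m t => simp [br_one_right he' hY]

theorem br_one_tmul {X : YDData k B H} {Y : YDData k B M} (hY : Y.IsYD)
    (he : (unit k B).IsHom X (Algebra.linearMap k H)) (z : M ⊗[k] T) :
    br X Y (1 ⊗ₜ z) = (TensorProduct.mk k H T 1).lTensor M z := by
  have he' : (unit k B).IsHom X (LinearMap.toSpanSingleton k H 1) := by
    convert he using 1
    ext
    simp
  induction z using TensorProduct.induction_on with
  | zero => simp
  | add x y hx hy => simp only [map_add, TensorProduct.tmul_add, hx, hy]
  | tmul m t => simp [br_one_left he' hY]

theorem mulTwo_lTensor_one {X : YDData k B H} (hX : X.IsYD)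
    (he : (unit k B).IsHom X (Algebra.linearMap k H)) (z : H ⊗[k] (H ⊗[k] T)) :
    mulTwo X T (((TensorProduct.mk k H _ 1 ∘ₗ TensorProduct.mk k H _ 1).lTensor H).lTensor H z)
      = z := by
  simp only [LinearMap.lTensor_comp, LinearMap.comp_apply]
  rw [mulTwo_apply, under₂₁ (q := TensorProduct.mk k H _ 1)
    (br_lTensor_one (X := X) (T := H ⊗[k] T) hX he)]
  refine ext_two (p := mulF k H _ ∘ₗ ((mulF k H T).lTensor H).lTensor H ∘ₗ
    (TensorProduct.mk k H _ 1).lTensor H ∘ₗ ((TensorProduct.mk k H _ 1).lTensor H).lTensor H)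
    (q := LinearMap.id) (fun a b t => ?_) z
  simp

variable [Coalgebra k H]

variable (k H T) in
/-- Comultiplication of the first factor. -/
abbrev comulF : H ⊗[k] T →ₗ[k] H ⊗[k] (H ⊗[k] T) := toPair (comul (R := k) (A := H))

variable (k H T) in
/-- The counit on the first factor. -/
abbrev counitF : H ⊗[k] T →ₗ[k] T := onFst (counit (R := k) (A := H))

theorem comulF_coassoc (z : H ⊗[k] T) :
    comulF k H _ (comulF k H T z) = (comulF k H T).lTensor H (comulF k H T z) := by
  induction z using TensorProduct.induction_on with
  | zero => simp
  | add x y hx hy => simp only [map_add, hx, hy]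
  | tmul h t =>
    have h₁ : ∀ d : H ⊗[k] H, comulF k H _ (TensorProduct.assoc k H H T (d ⊗ₜ t)) =
        (TensorProduct.assoc k H H T).toLinearMap.lTensor H
          (TensorProduct.assoc k H (H ⊗[k] H) T
            (TensorProduct.assoc k H H H ((comul (R := k)).rTensor H d) ⊗ₜ t)) := by
      intro d
      induction d using TensorProduct.induction_on with
      | zero => simp
      | add x y hx hy => simp only [map_add, TensorProduct.add_tmul, hx, hy]
      | tmul a b =>
        simp only [TensorProduct.assoc_tmul, toPair_tmul, LinearMap.rTensor_tmul]
        induction comul (R := k) a using TensorProduct.induction_on with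
        | zero => simp
        | add x y hx hy => simp only [map_add, TensorProduct.add_tmul, hx, hy]
        | tmul a b => simp
    have h₂ : ∀ d : H ⊗[k] H, (comulF k H T).lTensor H (TensorProduct.assoc k H H T (d ⊗ₜ t)) =
        (TensorProduct.assoc k H H T).toLinearMap.lTensor H
          (TensorProduct.assoc k H (H ⊗[k] H) T ((comul (R := k)).lTensor H d ⊗ₜ t)) := by
      intro d
      induction d using TensorProduct.induction_on with
      | zero => simp
      | add x y hx hy => simp only [map_add, TensorProduct.add_tmul, hx, hy]
      | tmul a b => simp
    rw [toPair_tmul, h₁, h₂, Coalgebra.coassoc_apply]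

theorem counitF_comulF (z : H ⊗[k] T) : counitF k H _ (comulF k H T z) = z := by
  induction z using TensorProduct.induction_on with
  | zero => simp
  | add x y hx hy => simp only [map_add, hx, hy]
  | tmul h t =>
    trans TensorProduct.lid k H ((counit (R := k)).rTensor H (comul (R := k) h)) ⊗ₜ t
    · rw [toPair_tmul]
      induction comul (R := k) h using TensorProduct.induction_on with
      | zero => simp
      | add x y hx hy => simp only [map_add, TensorProduct.add_tmul, hx, hy]
      | tmul a b => simp [← TensorProduct.smul_tmul']
    · simp

theorem lTensor_counitF_comulF (z : H ⊗[k] T) :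
    (counitF k H T).lTensor H (comulF k H T z) = z := by
  induction z using TensorProduct.induction_on with
  | zero => simp
  | add x y hx hy => simp only [map_add, hx, hy]
  | tmul h t =>
    trans TensorProduct.rid k H ((counit (R := k)).lTensor H (comul (R := k) h)) ⊗ₜ t
    · rw [toPair_tmul]
      induction comul (R := k) h using TensorProduct.induction_on with
      | zero => simp
      | add x y hx hy => simp only [map_add, TensorProduct.add_tmul, hx, hy]
      | tmul a b => simp [← TensorProduct.smul_tmul']
    · simp

/-- The map `C (S ⊗ S) Δ`, acting on the first factor. -/
def comulAntipode (X : YDData k B H) (S : H →ₗ[k] H) (T : Type*) [AddCommMonoid T] [Module k T] :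
    H ⊗[k] T →ₗ[k] H ⊗[k] (H ⊗[k] T) :=
  br X X ∘ₗ (S.rTensor T).lTensor H ∘ₗ S.rTensor _ ∘ₗ comulF k H T

theorem comulAntipode_apply (X : YDData k B H) (S : H →ₗ[k] H) (z : H ⊗[k] T) :
    comulAntipode X S T z =
      br X X ((S.rTensor T).lTensor H (S.rTensor _ (comulF k H T z))) := rfl

theorem comulAntipode_lTensor (X : YDData k B H) (S : H →ₗ[k] H) (φ : T →ₗ[k] T')
    (z : H ⊗[k] T) :
    comulAntipode X S T' (φ.lTensor H z) = (φ.lTensor H).lTensor H (comulAntipode X S T z) := by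
  rw [comulAntipode_apply, comulAntipode_apply, toPair_lTensor, rTensor_lTensor,
    under₂₂ (rTensor_lTensor S φ), br_lTensor]

section Hopf

variable {X : YDData k B H} {S : H →ₗ[k] H} (hH : X.IsBraidedHopfAlgebra S)
include hH

theorem comulF_mulF (z : H ⊗[k] (H ⊗[k] T)) : comulF k H T (mulF k H T z) =
    mulTwo X T (((comulF k H T).lTensor H).lTensor H (comulF k H _ z)) := by
  refine ext_two (p := comulF k H T ∘ₗ mulF k H T)
    (q := mulTwo X T ∘ₗ ((comulF k H T).lTensor H).lTensor H ∘ₗ comulF k H _) (fun a b t => ?_) z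
  have h := congr($hH.comul_mul (a ⊗ₜ b))
  simp only [LinearMap.comp_apply, LinearMap.mul'_apply, TensorProduct.map_tmul] at h
  simp only [LinearMap.comp_apply, toPair_tmul, onPair_tmul, LinearMap.mul'_apply, h]
  induction comul (R := k) a using TensorProduct.induction_on with
  | zero => simp
  | add x y hx hy => simp only [map_add, TensorProduct.add_tmul, hx, hy]
  | tmul a a' =>
    simp only [TensorProduct.assoc_tmul, LinearMap.lTensor_tmul, toPair_tmul]
    induction comul (R := k) b using TensorProduct.induction_on with
    | zero => simp
    | add x y hx hy => simp only [map_add, TensorProduct.add_tmul, TensorProduct.tmul_add, hx, hy]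
    | tmul b b' =>
      simp only [midBraid, LinearMap.comp_apply, LinearEquiv.coe_coe, TensorProduct.assoc_tmul,
        LinearMap.lTensor_tmul, TensorProduct.assoc_symm_tmul, LinearMap.rTensor_tmul,
        mulTwo_apply, br_tmul]
      induction X.braid X (a' ⊗ₜ b) using TensorProduct.induction_on with
      | zero => simp
      | add x y hx hy =>
        simp only [map_add, TensorProduct.add_tmul, TensorProduct.tmul_add, hx, hy]
      | tmul b a' => simp

theorem counitF_mulF (z : H ⊗[k] (H ⊗[k] T)) :
    counitF k H T (mulF k H T z) = counitF k H T (counitF k H _ z) := by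
  refine ext_two (p := counitF k H T ∘ₗ mulF k H T)
    (q := counitF k H T ∘ₗ counitF k H _) (fun a b t => ?_) z
  simp [hH.counit_mul, mul_smul]

theorem mulF_antipode_left (z : H ⊗[k] T) :
    mulF k H T (S.rTensor _ (comulF k H T z)) = 1 ⊗ₜ counitF k H T z := by
  induction z using TensorProduct.induction_on with
  | zero => simp
  | add x y hx hy => simp only [map_add, TensorProduct.tmul_add, hx, hy]
  | tmul h t =>
    have h₁ := congr($hH.mul_antipode_rTensor_comul h)
    trans (LinearMap.mul' k H (S.rTensor H (comul (R := k) h))) ⊗ₜ t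
    · rw [toPair_tmul]
      induction comul (R := k) h using TensorProduct.induction_on with
      | zero => simp
      | add x y hx hy => simp only [map_add, TensorProduct.add_tmul, hx, hy]
      | tmul a b => simp
    · simp only [LinearMap.comp_apply] at h₁
      rw [h₁]
      simp [Algebra.algebraMap_eq_smul_one, TensorProduct.smul_tmul]

theorem mulF_antipode_right (z : H ⊗[k] T) :
    mulF k H T ((S.rTensor _).lTensor H (comulF k H T z)) = 1 ⊗ₜ counitF k H T z := by
  induction z using TensorProduct.induction_on with
  | zero => simp
  | add x y hx hy => simp only [map_add, TensorProduct.tmul_add, hx, hy]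
  | tmul h t =>
    have h₁ := congr($hH.mul_antipode_lTensor_comul h)
    trans (LinearMap.mul' k H (S.lTensor H (comul (R := k) h))) ⊗ₜ t
    · rw [toPair_tmul]
      induction comul (R := k) h using TensorProduct.induction_on with
      | zero => simp
      | add x y hx hy => simp only [map_add, TensorProduct.add_tmul, hx, hy]
      | tmul a b => simp
    · simp only [LinearMap.comp_apply] at h₁
      rw [h₁]
      simp [Algebra.algebraMap_eq_smul_one, TensorProduct.smul_tmul]

/-- C(S ⊗ S)Δ is a left convolution inverse of Δ. Inside the braided product S(h₂)h₃ collapses,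
which brings together S(h₁) and the last factor. -/
theorem mulTwo_comulAntipode (z : H ⊗[k] T) :
    mulTwo X T (comulAntipode X S _ ((comulF k H T).lTensor H (comulF k H T z))) =
      1 ⊗ₜ (1 ⊗ₜ counitF k H T z) := by
  have hX := hH.isYD
  have he := hH.one_hom
  have hS := hH.antipode_hom
  have hw : comulF k H _ ((comulF k H T).lTensor H (comulF k H T z)) =
      (comulF k H _).lTensor H ((comulF k H T).lTensor H (comulF k H T z)) := by
    rw [← comulF_coassoc, comulF_coassoc, comulF_coassoc]
  rw [comulAntipode_apply, hw, ← rTensor_lTensor S, br_rTensor_left X hS, mulTwo_apply,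
    under₂₂ (br_rTensor_left (T := H ⊗[k] T) X hS), onPair_lTensor, onPair_lTensor,
    ← br_onPair_right hH.mul_hom hX,
    under₃₂ (q := counitF k H _) (p := TensorProduct.mk k H _ 1)
      (mulF_antipode_left hH (T := H ⊗[k] T)),
    br_lTensor_one hX he, under₂₁ (q := LinearMap.id) (counitF_comulF (T := T)),
    LinearMap.lTensor_id, LinearMap.id_apply, LinearMap.lTensor_tmul, LinearMap.lTensor_tmul,
    mulF_antipode_left hH]

/-- ΔS is a right convolution inverse of Δ, the product being Δ(h₁S(h₂)). -/
theorem mulTwo_comulF_antipode (z : H ⊗[k] T) :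
    mulTwo X T (((comulF k H T).lTensor H).lTensor H
      (comulF k H _ ((S.rTensor _).lTensor H (comulF k H T z)))) =
      1 ⊗ₜ (1 ⊗ₜ counitF k H T z) := by
  rw [← comulF_mulF hH, mulF_antipode_right hH]
  simp [hH.comul_one]

/-- The antipode is anti-comultiplicative: `Δ S = C (S ⊗ S) Δ`. -/
theorem comulF_antipode (z : H ⊗[k] T) : comulF k H T (S.rTensor T z) =
    br X X ((S.rTensor T).lTensor H (S.rTensor _ (comulF k H T z))) := by
  rw [← comulAntipode_apply]
  symm
  -- A left inverse L and a right inverse R of Δ agree: L = L * (Δ * R) = (L * Δ) * R = R, with `φ`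
  -- as R.
  let φ : H ⊗[k] T →ₗ[k] H ⊗[k] (H ⊗[k] T) := comulF k H T ∘ₗ S.rTensor T
  have h₁ : (TensorProduct.mk k H _ 1 ∘ₗ TensorProduct.mk k H T 1).lTensor H
      ((counitF k H T).lTensor H (comulF k H T z)) =
      (mulTwo X T).lTensor H (((φ.lTensor H).lTensor H).lTensor H
        ((comulF k H _).lTensor H ((comulF k H T).lTensor H (comulF k H T z)))) := by
    simp only [← LinearMap.lTensor_comp_apply]
    refine lTensor_congr (fun z => ?_) _
    have := mulTwo_comulF_antipode hH z
    rw [toPair_lTensor] at this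
    simp only [φ, LinearMap.lTensor_comp, LinearMap.comp_apply]
    exact this.symm
  rw [← mulTwo_lTensor_one hH.isYD hH.one_hom (comulAntipode X S T z), ← comulAntipode_lTensor]
  conv_lhs => rw [← lTensor_counitF_comulF z]
  rw [h₁, comulAntipode_lTensor, ← mulTwo_assoc hH.isYD hH.mul_hom, comulAntipode_lTensor,
    mulTwo_lTensor, ← comulF_coassoc, mulTwo_comulAntipode hH, counitF_comulF]
  simp only [LinearMap.lTensor_tmul]
  rw [mulTwo_one hH.isYD hH.one_hom]
  rfl

end Hopf

end BraidedHopf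

end YDData

end

open scoped TensorProduct

noncomputable section

namespace YDData

open Coalgebra (comul counit)
open HopfAlgebra (antipode)

/-! ### The antipode of H is braided antimultiplicative. -/

section BraidedHopf

variable {k B H M T T' : Type*} [Field k] [Ring B] [HopfAlgebra k B] [Ring H] [Algebra k H]
  [AddCommMonoid M] [Module k M] [AddCommMonoid T] [Module k T] [AddCommMonoid T'] [Module k T']

/-- The map `m C (S ⊗ H)`, acting on the first two factors. -/
def adF (X : YDData k B H) (S : H →ₗ[k] H) (T : Type*) [AddCommMonoid T] [Module k T] :
    H ⊗[k] (H ⊗[k] T) →ₗ[k] H ⊗[k] T :=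
  mulF k H T ∘ₗ br X X ∘ₗ S.rTensor _

theorem adF_apply (X : YDData k B H) (S : H →ₗ[k] H) (z : H ⊗[k] (H ⊗[k] T)) :
    adF X S T z = mulF k H T (br X X (S.rTensor _ z)) := rfl

theorem adF_lTensor (X : YDData k B H) (S : H →ₗ[k] H) (φ : T →ₗ[k] T')
    (z : H ⊗[k] (H ⊗[k] T)) :
    adF X S T' ((φ.lTensor H).lTensor H z) = φ.lTensor H (adF X S T z) := by
  rw [adF_apply, rTensor_lTensor, br_lTensor, onPair_lTensor, adF_apply]

theorem adF_lTensor_antipode (X : YDData k B H) (S : H →ₗ[k] H) (φ : T →ₗ[k] T')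
    (z : H ⊗[k] (H ⊗[k] T)) :
    adF X S T' ((S.rTensor T').lTensor H ((φ.lTensor H).lTensor H z)) =
      φ.lTensor H (adF X S T ((S.rTensor T).lTensor H z)) := by
  rw [under₂₂ (rTensor_lTensor S φ), adF_lTensor]

variable [Coalgebra k H]

/-- The coproduct `(H ⊗ C ⊗ H)(Δ ⊗ Δ)` of `H ⊗ H`. -/
def comulTwo (X : YDData k B H) (T : Type*) [AddCommMonoid T] [Module k T] :
    H ⊗[k] (H ⊗[k] T) →ₗ[k] H ⊗[k] (H ⊗[k] (H ⊗[k] (H ⊗[k] T))) :=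
  (br X X).lTensor H ∘ₗ ((comulF k H T).lTensor H).lTensor H ∘ₗ comulF k H _

theorem comulTwo_apply (X : YDData k B H) (z : H ⊗[k] (H ⊗[k] T)) :
    comulTwo X T z =
      (br X X).lTensor H (((comulF k H T).lTensor H).lTensor H (comulF k H _ z)) := rfl

section Hopf

variable {X : YDData k B H} {S : H →ₗ[k] H} (hH : X.IsBraidedHopfAlgebra S)
include hH

/-- The braided xS(h₁)h₂ = ε(h)x: S(h₁)h₂ is formed by sliding the product through the crossing with
x, then collapses. -/
theorem mulF_adF (z : H ⊗[k] (H ⊗[k] T)) :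
    mulF k H T (adF X S _ ((br X X).lTensor H (comulF k H _ z))) = counitF k H _ z := by
  rw [adF_apply, mulF_assoc, rTensor_lTensor, ← br_onPair_left hH.mul_hom hH.isYD,
    mulF_antipode_left hH, br_one_tmul hH.isYD hH.one_hom, mulF_lTensor_one]

/-- The dual of `mulTwo_assoc`: it provides the associativity of convolution on Hom(H ⊗ H, H). -/
theorem comulTwo_coassoc (z : H ⊗[k] (H ⊗[k] T)) :
    comulTwo X _ (comulTwo X T z) =
      ((comulTwo X T).lTensor H).lTensor H (comulTwo X T z) := by
  have hX := hH.isYD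
  have h : comulTwo X T = (br X X).lTensor H ∘ₗ ((comulF k H T).lTensor H).lTensor H ∘ₗ
    comulF k H _ := rfl
  have h' : comulTwo X (H ⊗[k] (H ⊗[k] T)) = (br X X).lTensor H ∘ₗ
    ((comulF k H _).lTensor H).lTensor H ∘ₗ comulF k H _ := rfl
  rw [h, h']
  simp only [LinearMap.lTensor_comp, LinearMap.comp_apply]
  rw [toPair_lTensor, toPair_lTensor, comulF_coassoc,
    under₂₃ (under₂₃ (fun z => (br_toPair_right (T := H ⊗[k] T) hH.comul_hom hX z).symm)),
    under₂₃ (fun z => (br_toPair_left (T := H ⊗[k] T) hH.comul_hom hX z).symm),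
    under₂₂ (toPair_lTensor (comul (R := k) (A := H)) (comulF k H T)),
    under₂₂ (under₂₂ (under₂₂ (comulF_coassoc (T := T)))),
    ← under₂₂ (br_lTensor X X ((comulF k H T).lTensor H)),
    ← under₂₂ (under₂₂ (br_lTensor X X (comulF k H T))),
    ← under₂₂ (br_lTensor X X (br X X (T := H ⊗[k] T)))]

theorem counitF_comulTwo (z : H ⊗[k] (H ⊗[k] T)) :
    counitF k H _ (counitF k H _ (comulTwo X T z)) = z := by
  rw [comulTwo_apply, onFst_lTensor, onFst_lTensor, counitF_comulF,
    ← br_onFst_right hH.counit_hom hH.isYD,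
    under₂₁ (q := LinearMap.id) (counitF_comulF (T := T)), LinearMap.lTensor_id]
  rfl

theorem lTensor_counitF_comulTwo (z : H ⊗[k] (H ⊗[k] T)) :
    ((counitF k H T).lTensor H).lTensor H (((counitF k H _).lTensor H).lTensor H
      (comulTwo X T z)) = z := by
  rw [comulTwo_apply,
    under₂₁ (fun z => (br_onFst_left (T := H ⊗[k] T) hH.counit_hom hH.isYD z).symm),
    under₂₂ (onFst_lTensor (counit (R := k) (A := H)) (comulF k H T)),
    lTensor_counitF_comulF,
    under₂₁ (q := LinearMap.id) (lTensor_counitF_comulF (T := T)), LinearMap.lTensor_id]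
  rfl

theorem mulF_mulF_comulTwo (z : H ⊗[k] (H ⊗[k] T)) :
    mulF k H _ (((mulF k H T).lTensor H).lTensor H (comulTwo X T z)) =
      comulF k H T (mulF k H T z) :=
  (comulF_mulF hH z).symm

/-- S m is a right convolution inverse of m, since m is comultiplicative; `mulF_adF_antipode`
exhibits m C (S ⊗ S) as a left inverse. -/
theorem mulF_antipode_mulF (z : H ⊗[k] (H ⊗[k] T)) :
    mulF k H T (mulF k H _ (((S.rTensor T).lTensor H).lTensor H
      (((mulF k H T).lTensor H).lTensor H (comulTwo X T z)))) =
      1 ⊗ₜ counitF k H T (counitF k H _ z) := by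
  rw [onPair_lTensor, mulF_mulF_comulTwo hH, mulF_antipode_right hH, counitF_mulF hH]

theorem mulF_adF_antipode (z : H ⊗[k] (H ⊗[k] T)) :
    mulF k H T (adF X S _ ((S.rTensor _).lTensor H
      (((mulF k H T).lTensor H).lTensor H (comulTwo X T z)))) =
      1 ⊗ₜ counitF k H T (counitF k H _ z) := by
  rw [under₂₂ (rTensor_lTensor S (mulF k H T)), adF_lTensor, ← mulF_assoc, comulTwo_apply,
    under₂₂ (fun z => (br_rTensor_right (T := H ⊗[k] T) X hH.antipode_hom z).symm),
    ← toPair_lTensor, ← toPair_lTensor, mulF_adF hH, onFst_lTensor, onFst_lTensor,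
    mulF_antipode_left hH]

/-- The antipode is antimultiplicative: `S m = m C (S ⊗ S)`. -/
theorem antipode_mulF (z : H ⊗[k] (H ⊗[k] T)) :
    S.rTensor T (mulF k H T z) = adF X S T ((S.rTensor T).lTensor H z) := by
  symm
  -- Uniqueness of convolution inverses again, now of m in Hom(H ⊗ H, H): the counit is expanded as
  -- m * (S m).
  have h₁ : ((TensorProduct.mk k H T 1).lTensor H).lTensor H (((counitF k H T).lTensor H).lTensor H
      (((counitF k H _).lTensor H).lTensor H (comulTwo X T z))) =
      ((mulF k H T).lTensor H).lTensor H (((mulF k H _).lTensor H).lTensor H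
      (((((S.rTensor T).lTensor H).lTensor H).lTensor H).lTensor H
      (((((mulF k H T).lTensor H).lTensor H).lTensor H).lTensor H
      (((comulTwo X T).lTensor H).lTensor H (comulTwo X T z))))) := by
    simp only [← LinearMap.lTensor_comp_apply, ← LinearMap.lTensor_comp]
    refine lTensor_congr (lTensor_congr fun z => ?_) _
    exact (mulF_antipode_mulF hH z).symm
  conv_lhs => rw [← lTensor_counitF_comulTwo hH z]
  rw [← mulF_lTensor_one (adF X S T _), ← adF_lTensor,
    under₂₂ (fun z => (rTensor_lTensor S (TensorProduct.mk k H T 1) z).symm), h₁,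
    adF_lTensor_antipode, adF_lTensor_antipode, adF_lTensor_antipode, adF_lTensor_antipode,
    ← mulF_assoc, under₂₂ (onPair_lTensor (LinearMap.mul' k H) (S.rTensor T)),
    under₂₂ (onPair_lTensor (LinearMap.mul' k H) (mulF k H T)), onPair_lTensor, onPair_lTensor,
    ← adF_lTensor_antipode, ← comulTwo_coassoc hH, mulF_adF_antipode hH, counitF_comulTwo hH,
    LinearMap.lTensor_tmul, LinearMap.lTensor_tmul, mulF_one]

/-- The braided (xS(h))S(g) = xS(gh), which makes ↼ an action. Antimultiplicativity of S leaves two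
braid words that differ by a braid relation. -/
theorem adF_adF (z : H ⊗[k] (H ⊗[k] (H ⊗[k] T))) :
    adF X S T ((adF X S T).lTensor H z) = adF X S T (mulF k H _ z) := by
  have hX := hH.isYD
  have h : adF X S T = mulF k H T ∘ₗ br X X ∘ₗ S.rTensor _ := rfl
  rw [adF_apply _ _ (mulF k H _ z), antipode_mulF hH, adF_apply, adF_apply, h,
    br_onPair_left hH.mul_hom hX, ← mulF_assoc]
  simp only [LinearMap.lTensor_comp, LinearMap.comp_apply]
  rw [rTensor_lTensor, rTensor_lTensor, br_onPair_right hH.mul_hom hX, ← yang_baxter hX hX hX]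

end Hopf

end BraidedHopf

end YDData

end

open scoped TensorProduct

noncomputable section

namespace YDData

open Coalgebra (comul counit)
open HopfAlgebra (antipode)

/-! ### The coproduct C⁻¹Δ and its behaviour on x S(h). -/

section BraidedHopf

variable {k B H M T T' : Type*} [Field k] [Ring B] [HopfAlgebra k B] [Ring H] [Algebra k H]
  [AddCommMonoid M] [Module k M] [AddCommMonoid T] [Module k T] [AddCommMonoid T'] [Module k T']
  [Coalgebra k H]

/-- The coproduct `C⁻¹ Δ`. -/
def comulInv (X : YDData k B H) : H →ₗ[k] H ⊗[k] H := X.braidInv X ∘ₗ comul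

/-- The coproduct `C⁻¹ Δ`, acting on the first factor. -/
abbrev comulInvF (X : YDData k B H) (T : Type*) [AddCommMonoid T] [Module k T] :
    H ⊗[k] T →ₗ[k] H ⊗[k] (H ⊗[k] T) := toPair (comulInv X)

section Hopf

variable (hB : antipode k (A := B) ∘ₗ antipode k (A := B) = LinearMap.id)
  {X : YDData k B H} {S : H →ₗ[k] H} (hH : X.IsBraidedHopfAlgebra S)
include hB hH

theorem comulInv_hom : X.IsHom (X.tensor X) (comulInv X) := by
  let e : H ⊗[k] H ≃ₗ[k] H ⊗[k] H := .ofLinearMap (X.braid X) (X.braidInv X)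
    (LinearMap.ext (braid_braidInv hB hH.isYD hH.isYD))
    (LinearMap.ext (braidInv_braid hB hH.isYD hH.isYD))
  have he : (X.tensor X).IsHom (X.tensor X) e.toLinearMap := isHom_braid hH.isYD hH.isYD
  exact he.symm.comp hH.comul_hom

theorem br_comulInvF (z : H ⊗[k] T) : br X X (comulInvF X T z) = comulF k H T z := by
  induction z using TensorProduct.induction_on with
  | zero => simp
  | add x y hx hy => simp only [map_add, hx, hy]
  | tmul h t =>
    rw [toPair_tmul, br_assoc, comulInv, LinearMap.comp_apply, braid_braidInv hB hH.isYD hH.isYD,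
      toPair_tmul]

theorem br_injective {z w : H ⊗[k] (H ⊗[k] T)} (h : br X X z = br X X w) : z = w := by
  rw [← brInv_br hB hH.isYD hH.isYD z, h, brInv_br hB hH.isYD hH.isYD]

/-- Substituting Δ = C(C⁻¹Δ) into coassociativity of Δ and sliding puts a word of three crossings on
each side; the words agree by the braid relation and can be cancelled. -/
theorem comulInvF_coassoc (z : H ⊗[k] T) : comulInvF X _ (comulInvF X T z) =
    (comulInvF X T).lTensor H (comulInvF X T z) := by
  have hX := hH.isYD
  have hD := comulInv_hom hB hH
  have h := comulF_coassoc z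
  have hc : comulF k H T = br X X ∘ₗ comulInvF X T :=
    LinearMap.ext fun z => (br_comulInvF hB hH z).symm
  rw [← br_comulInvF hB hH, ← br_comulInvF hB hH, ← br_toPair_right hD hX, hc] at h
  simp only [LinearMap.lTensor_comp, LinearMap.comp_apply] at h
  rw [← br_toPair_left hD hX, ← yang_baxter hX hX hX] at h
  have h₁ := br_injective hB hH h
  have h₂ := congr((brInv X X).lTensor H $h₁)
  rw [under₂₁ (q := LinearMap.id) (brInv_br (T := T) hB hX hX),
    under₂₁ (q := LinearMap.id) (brInv_br (T := T) hB hX hX)] at h₂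
  simp only [LinearMap.lTensor_id, LinearMap.id_apply] at h₂
  exact (br_injective hB hH h₂).symm

/-- Sliding ε through C exchanges the two counit laws of C⁻¹Δ and Δ. -/
theorem counitF_comulInvF (z : H ⊗[k] T) : counitF k H _ (comulInvF X T z) = z := by
  rw [br_onFst_left hH.counit_hom hH.isYD, br_comulInvF hB hH, lTensor_counitF_comulF]

theorem lTensor_counitF_comulInvF (z : H ⊗[k] T) :
    (counitF k H T).lTensor H (comulInvF X T z) = z := by
  rw [br_onFst_right hH.counit_hom hH.isYD, br_comulInvF hB hH, counitF_comulF]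

/-- Without the braiding: (xS(h))₂ ⊗ (xS(h))₁ = x₂S(h₁) ⊗ x₁S(h₂). After applying C, both sides are
m ⊗ m preceded by a braid on four strands. -/
theorem comulInvF_adF (z : H ⊗[k] (H ⊗[k] T)) : comulInvF X T (adF X S T z) =
    adF X S _ (((adF X S T).lTensor H).lTensor H ((br X X).lTensor H
      (((comulInvF X T).lTensor H).lTensor H (comulF k H _ z)))) := by
  have hX := hH.isYD
  have hm := hH.mul_hom
  have hS := hH.antipode_hom
  have hΔ := hH.comul_hom
  apply br_injective hB hH
  have h : adF X S T = mulF k H T ∘ₗ br X X ∘ₗ S.rTensor _ := rfl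
  set u := ((comulInvF X T).lTensor H).lTensor H (comulF k H _ z) with hu
  let v := S.rTensor _ ((S.rTensor _).lTensor H u)
  -- The crossings of strands 1 and 2, 2 and 3, 3 and 4.
  let a := br X X (T := H ⊗[k] (H ⊗[k] T))
  let b := (br X X (T := H ⊗[k] T)).lTensor H
  let c := ((br X X (T := T)).lTensor H).lTensor H
  have hL : br X X (comulInvF X T (adF X S T z)) =
      mulF k H _ (((mulF k H T).lTensor H).lTensor H (b (b (c (a (b (a (c v)))))))) := by
    rw [br_comulInvF hB hH, adF_apply, comulF_mulF hH, ← br_toPair_right hΔ hX,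
      under₂₃ (fun z => (br_toPair_left (T := T) hΔ hX z).symm), ← br_toPair_left hΔ hX,
      ← rTensor_lTensor, comulF_antipode hH, toPair_lTensor]
    have hc : (toPair comul : H ⊗[k] T →ₗ[k] _) = br X X ∘ₗ comulInvF X T :=
      LinearMap.ext fun z => (br_comulInvF hB hH z).symm
    rw [hc]
    simp only [LinearMap.lTensor_comp, LinearMap.comp_apply]
    rw [← hu, rTensor_lTensor, under₂₂ (rTensor_lTensor S (br X X (T := T))), ← rTensor_lTensor]
    rfl
  have hR : br X X (adF X S _ (((adF X S T).lTensor H).lTensor H (b u))) =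
      mulF k H _ (((mulF k H T).lTensor H).lTensor H (b (c (a (b (a (c (b v)))))))) := by
    rw [h, adF_apply]
    simp only [LinearMap.lTensor_comp, LinearMap.comp_apply]
    have hb : b u = (br X X).lTensor H u := rfl
    rw [hb, under₂₂ (fun z => (br_rTensor_left (T := H ⊗[k] T) X hS z).symm), rTensor_lTensor,
      rTensor_lTensor, rTensor_lTensor, br_lTensor, br_lTensor, onPair_lTensor,
      br_onPair_right hm hX, br_onPair_left hm hX, under₂₃ (br_onPair_left (T := T) hm hX)]
  have hab (v) : a (b (a v)) = b (a (b v)) := yang_baxter hX hX hX v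
  have hbc (v) : b (c (b v)) = c (b (c v)) :=
    under₃₃ (yang_baxter hX hX hX (T := T)) v
  have hac (v) : a (c v) = c (a v) := br_lTensor X X (br X X (T := T)) v
  rw [hL, hR]
  congr 2
  -- The words b b c a b a c and b c a b a c b both equal b c b a b c b.
  rw [hab (c v), hbc (a (b (c v))), ← hac (b (c v)), ← hbc v, hab (c (b v))]

/-- The braided (xS(h₁))₂ ⊗ (xS(h₁))₁h₂ = x₂S(h) ⊗ x₁. Expanding by `comulInvF_adF` leaves S(h₂)h₃
in the second factor, where `mulF_adF` removes it. -/
theorem comulInvF_mulF_adF (z : H ⊗[k] (H ⊗[k] T)) :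
    (mulF k H T).lTensor H (comulInvF X _ (adF X S _ ((br X X).lTensor H (comulF k H _ z)))) =
      adF X S _ ((comulInvF X T).lTensor H z) := by
  have hX := hH.isYD
  have hD := comulInv_hom hB hH
  rw [comulInvF_adF hB hH, toPair_lTensor, comulF_coassoc,
    under₂₃ (under₂₃ fun z => (br_toPair_right (T := T) hD hX z).symm)]
  rw [← under₂₂ (toPair_lTensor (comul (R := k) (A := H)) (comulInvF X T)), ← toPair_lTensor,
    under₂₂ (br_lTensor X X (br X X (T := T))),
    under₃₂ (br_toPair_left (T := H ⊗[k] T) hH.comul_hom hX), ← adF_lTensor,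
    under₄₁ (under₄₁ (mulF_adF (T := T) hH)),
    under₂₁ (fun z => (br_onFst_left (T := H ⊗[k] T) hH.counit_hom hX z).symm),
    lTensor_counitF_comulF]

end Hopf

end BraidedHopf

end YDData

end

open scoped TensorProduct

noncomputable section

namespace YDData

open Coalgebra (comul counit)
open HopfAlgebra (antipode)

/-! ### The algebra H^* and the actions of H on it. -/

section Hom

variable {k B U V W Z : Type*} [Field k] [Ring B] [HopfAlgebra k B]
  [AddCommMonoid U] [Module k U] [AddCommMonoid V] [Module k V] [AddCommMonoid W] [Module k W]
  [AddCommMonoid Z] [Module k Z]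

theorem isHom_assoc_symm (X : YDData k B U) (Y : YDData k B V) (Z : YDData k B W) :
    (X.tensor (Y.tensor Z)).IsHom ((X.tensor Y).tensor Z)
      (TensorProduct.assoc k U V W).symm.toLinearMap := (isHom_assoc X Y Z).symm

theorem isHom_midBraid {X : YDData k B V} {Y : YDData k B W} (hX : X.IsYD) (hY : Y.IsYD)
    (P : YDData k B U) (Q : YDData k B Z) :
    ((P.tensor X).tensor (Y.tensor Q)).IsHom ((P.tensor Y).tensor (X.tensor Q))
      (X.midBraid Y U Z) :=
  (isHom_assoc_symm _ _ _).comp ((((isHom_assoc _ _ _).comp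
    (((isHom_braid hX hY).rTensor Q).comp (isHom_assoc_symm _ _ _))).lTensor P).comp
    (isHom_assoc _ _ _))

variable (k B) in
theorem isHom_mul_unit :
    ((unit k B).tensor (unit k B)).IsHom (unit k B) (LinearMap.mul' k k) := by
  convert isHom_lid (unit k B) using 1
  ext; simp

end Hom

section Braiding

variable {k V T : Type*} [Field k]
  [AddCommMonoid V] [Module k V] [AddCommMonoid T] [Module k T]

theorem lTensor_onTwo_ev {A : Type*} [AddCommGroup A] [Module k A]
    (w : A ⊗[k] Module.Dual k V) (v : V) (t : T) :
    (onTwo (ev k V)).lTensor A (TensorProduct.assoc k A _ _ (w ⊗ₜ (v ⊗ₜ t))) =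
      applyAt v w ⊗ₜ t := by
  induction w using TensorProduct.induction_on with
  | zero => simp
  | add x y hx hy => simp only [map_add, TensorProduct.add_tmul, hx, hy]
  | tmul a f => simp [TensorProduct.smul_tmul]

end Braiding

section BraidedHopf

variable {k B H M T T' : Type*} [Field k] [Ring B] [HopfAlgebra k B] [Ring H] [Algebra k H]
  [AddCommMonoid M] [Module k M] [AddCommMonoid T] [Module k T] [AddCommMonoid T'] [Module k T']
  [FiniteDimensional k B]
  (hB : antipode k (A := B) ∘ₗ antipode k (A := B) = LinearMap.id)

theorem ext_onFst_dual {f g : Module.Dual k H}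
    (h : ∀ z : H ⊗[k] k, onFst f z = onFst g z) : f = g := by
  ext x
  simpa using h (x ⊗ₜ 1)

omit [FiniteDimensional k B] in
theorem onFst_dualAct (X : YDData k B H) (S : H →ₗ[k] H) (f : Module.Dual k H) (h : H)
    (z : H ⊗[k] T) : onFst (X.dualAct S (f ⊗ₜ h)) z = onFst f (adF X S T (h ⊗ₜ z)) := by
  induction z using TensorProduct.induction_on with
  | zero => simp
  | add x y hx hy => simp only [map_add, TensorProduct.tmul_add, hx, hy]
  | tmul x t =>
    rw [adF_apply, LinearMap.rTensor_tmul, br_tmul, onPair_assoc]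
    simp [dualAct]

include hB in
-- Under evaluation C_{H^*,H} is transposed to C_{H,H}⁻¹, and C_{H,H^*}⁻¹ to C_{H,H}. These coincide
-- when C_{H,H} is an involution, and evaluation separates.
theorem braid_dual_eq_braidInv {X : YDData k B H} (hX : X.IsYD)
    (hC : X.braid X ∘ₗ X.braid X = LinearMap.id) (w : Module.Dual k H ⊗[k] H) :
    X.dual.braid X w = X.braidInv X.dual w := by
  refine ext_applyAt fun v => ?_
  have hev := isHom_ev hB hX
  have hb (z : H ⊗[k] (H ⊗[k] k)) : br X X (br X X z) = z := by
    refine ext_two (p := br X X ∘ₗ br X X) (q := LinearMap.id) (fun w v t => ?_) z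
    rw [LinearMap.comp_apply, br_tmul, br_assoc]
    exact congr(TensorProduct.assoc k H H k ($hC (w ⊗ₜ v) ⊗ₜ t))
  apply (TensorProduct.rid k H).symm.injective
  rw [TensorProduct.rid_symm_apply, TensorProduct.rid_symm_apply, ← lTensor_onTwo_ev,
    ← lTensor_onTwo_ev, ← br_assoc]
  have h := br_brInv (T := H ⊗[k] k) hB hX (isYD_dual hB hX)
    (TensorProduct.assoc k (Module.Dual k H) H (H ⊗[k] k) (w ⊗ₜ (v ⊗ₜ (1 : k))))
  have h' : brInv X X.dual (TensorProduct.assoc k (Module.Dual k H) H (H ⊗[k] k) (w ⊗ₜ (v ⊗ₜ (1 : k)))) =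
    TensorProduct.assoc k H (Module.Dual k H) (H ⊗[k] k) (X.braidInv X.dual w ⊗ₜ (v ⊗ₜ (1 : k))) := by
    rw [brInv, LinearMap.comp_apply, onPair_assoc, LinearEquiv.coe_coe]
  rw [← h', br_onTwo_right hev hX (brInv X X.dual _), h, br_onTwo_left hev hX,
    under₂₁ (q := LinearMap.id) hb, LinearMap.lTensor_id, LinearMap.id_apply]

variable [Coalgebra k H]

section Hopf

variable {X : YDData k B H} {S : H →ₗ[k] H} (hH : X.IsBraidedHopfAlgebra S)
include hB hH

/-- C_{H,H^*} inside ⇀ cancels C_{H^*,H}, once S has been moved past it by colinearity. -/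
theorem dualAct_eq_rightHarpoon (hC : X.braid X ∘ₗ X.braid X = LinearMap.id) :
    X.dualAct S = X.rightHarpoon S := by
  have hX := hH.isYD
  ext f h x
  have h₁ : ∀ w : H ⊗[k] Module.Dual k H, X.braid X.dual (S.rTensor _ w) =
      S.lTensor _ (X.braid X.dual w) := by
    intro w
    induction w using TensorProduct.induction_on with
    | zero => simp
    | add x y hx hy => simp only [map_add, hx, hy]
    | tmul h f =>
      rw [LinearMap.rTensor_tmul, braid_tmul, braid_tmul, hH.antipode_hom.coact,
        rTensor_lTensor]
  have h₂ : X.braid X.dual (X.dual.braid X (f ⊗ₜ h)) = f ⊗ₜ h := by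
    rw [braid_dual_eq_braidInv hB hX hC, braid_braidInv hB hX (isYD_dual hB hX)]
  have h₃ : ∀ w : H ⊗[k] Module.Dual k H, X.harpoon w x =
      ev k H ((LinearMap.mul' k H ∘ₗ X.braid X).lTensor (Module.Dual k H)
        (TensorProduct.assoc k _ H H (X.braid X.dual w ⊗ₜ x))) := fun w => rfl
  simp only [TensorProduct.AlgebraTensorModule.curry_apply, LinearMap.restrictScalars_self,
    TensorProduct.curry_apply, rightHarpoon, LinearMap.comp_apply]
  rw [h₃, h₁, h₂]
  simp [dualAct]

theorem isHom_harpoon : (X.tensor X.dual).IsHom X.dual X.harpoon := by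
  have hX := hH.isYD
  have hX' := isYD_dual hB hX
  exact .curry hB hX ((isHom_ev hB hX).comp (((hH.mul_hom.comp (isHom_braid hX hX)).lTensor _).comp
    ((isHom_assoc _ _ _).comp ((isHom_braid hX hX').rTensor X))))

theorem isHom_dualAct : (X.dual.tensor X).IsHom X.dual (X.dualAct S) := by
  have hX := hH.isYD
  exact .curry hB hX ((isHom_ev hB hX).comp (((hH.mul_hom.comp ((isHom_braid hX hX).comp
    (hH.antipode_hom.rTensor X))).lTensor _).comp (isHom_assoc _ _ _)))

theorem isHom_dualMul : (X.dual.tensor X.dual).IsHom X.dual X.dualMul := by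
  have hX := hH.isYD
  have hX' := isYD_dual hB hX
  exact .curry hB hX ((isHom_mul_unit k B).comp (((isHom_ev hB hX).map (isHom_ev hB hX)).comp
    ((isHom_midBraid hX' hX _ _).comp (hH.comul_hom.lTensor _))))

/-- The pairing x ⊗ h ⊗ f ↦ f(xh) involves no crossing, but x stands on the left; this is why
evaluation and currying in the reversed order are needed. -/
theorem isHom_translate : (X.tensor X.dual).IsHom X.dual (translate k H) := by
  have hX := hH.isYD
  have := IsHom.curry_comm hB (X := X.tensor X.dual) hX
    ((isHom_ev_comm hB hX).comp ((hH.mul_hom.rTensor X.dual).comp (isHom_assoc_symm _ _ _)))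
  convert this using 1
  ext h f x
  simp [translate, Module.Dual.transpose_apply]

/-- In the definition g crosses the first factor of Δ(x) before it is evaluated on the second.
Writing Δ = C(C⁻¹Δ), the two crossings are undone by pulling the strand across the evaluation. -/
theorem onFst_dualMul (f g : Module.Dual k H) (z : H ⊗[k] T) :
    onFst (X.dualMul (f ⊗ₜ g)) z = onFst f (onFst g (comulInvF X T z)) := by
  have hX := hH.isYD
  have h : ∀ d : H ⊗[k] H, LinearMap.mul' k k (TensorProduct.map (ev k H) (ev k H)
      (X.dual.midBraid X (Module.Dual k H) H ((f ⊗ₜ g) ⊗ₜ X.braid X d))) = f (onFst g d) := by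
    intro d
    have h₁ : ∀ s : H ⊗[k] H, LinearMap.mul' k k (TensorProduct.map (ev k H) (ev k H)
      (X.dual.midBraid X (Module.Dual k H) H ((f ⊗ₜ g) ⊗ₜ s))) =
      f (TensorProduct.rid k H ((onTwo (ev k H)).lTensor H
        (br X.dual X (g ⊗ₜ TensorProduct.assoc k H H k (s ⊗ₜ 1))))) := by
      intro s
      induction s using TensorProduct.induction_on with
      | zero => simp
      | add x y hx hy => simp only [map_add, TensorProduct.tmul_add, TensorProduct.add_tmul, hx, hy]
      | tmul a b =>
        simp only [midBraid, LinearMap.comp_apply, LinearEquiv.coe_coe, TensorProduct.assoc_tmul,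
          LinearMap.lTensor_tmul, TensorProduct.assoc_symm_tmul, LinearMap.rTensor_tmul, br_tmul]
        induction X.dual.braid X (g ⊗ₜ a) using TensorProduct.induction_on with
        | zero => simp
        | add x y hx hy =>
          simp only [map_add, TensorProduct.tmul_add, TensorProduct.add_tmul, hx, hy]
        | tmul a g => simp [mul_comm]
    rw [h₁, ← br_assoc, ← LinearMap.lTensor_tmul, ← br_onTwo_left (isHom_ev hB hX) hX]
    induction d using TensorProduct.induction_on with
    | zero => simp
    | add x y hx hy => simp only [map_add, TensorProduct.tmul_add, TensorProduct.add_tmul, hx, hy]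
    | tmul a b => simp
  induction z using TensorProduct.induction_on with
  | zero => simp
  | add x y hx hy => simp only [map_add, hx, hy]
  | tmul x t =>
    have h₁ : X.dualMul (f ⊗ₜ g) x = f (onFst g (comulInv X x)) := by
      rw [← h, comulInv, LinearMap.comp_apply, braid_braidInv hB hX hX]
      rfl
    rw [onFst_tmul, h₁, toPair_tmul]
    induction comulInv X x using TensorProduct.induction_on with
    | zero => simp
    | add x y hx hy => simp only [map_add, TensorProduct.add_tmul, add_smul, hx, hy]
    | tmul a b => simp [mul_smul]

theorem dualMul_assoc (f g h : Module.Dual k H) :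
    X.dualMul (X.dualMul (f ⊗ₜ g) ⊗ₜ h) = X.dualMul (f ⊗ₜ X.dualMul (g ⊗ₜ h)) := by
  refine ext_onFst_dual fun z => ?_
  rw [onFst_dualMul hB hH, onFst_dualMul hB hH, onFst_dualMul hB hH, onFst_dualMul hB hH,
    comulInvF_coassoc hB hH, onFst_lTensor]

theorem isYDAlgebra_dual : X.dual.IsYDAlgebra X.dualMul (counit (R := k)) where
  isYD := isYD_dual hB hH.isYD
  mul_hom := isHom_dualMul hB hH
  one_hom := by
    have := IsHom.curry hB hH.isYD (hH.counit_hom.comp (isHom_lid X))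
    convert this using 1
    ext
    simp
  one_mul f := ext_onFst_dual fun z => by
    rw [onFst_dualMul hB hH, ← onFst_lTensor, lTensor_counitF_comulInvF hB hH]
  mul_one f := ext_onFst_dual fun z => by
    rw [onFst_dualMul hB hH, counitF_comulInvF hB hH]
  mul_assoc := dualMul_assoc hB hH

end Hopf

end BraidedHopf

end YDData

end

open scoped TensorProduct

noncomputable section

namespace YDData

open Coalgebra (comul counit)
open HopfAlgebra (antipode)

/-! ### Transport of the Yetter–Drinfeld structure along pairings. -/

section Pairing

variable {k B U V W W' : Type*} [Field k] [Ring B] [HopfAlgebra k B]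
  [AddCommMonoid U] [Module k U] [AddCommMonoid V] [Module k V] [AddCommMonoid W] [Module k W]
  [AddCommMonoid W'] [Module k W']

/-- `u ⊗ (v ⊗ w) ↦ f(u, v) w` is a morphism when `f` is. -/
theorem isHom_onTwo {X : YDData k B U} {Y : YDData k B V} (Z : YDData k B W)
    {f : U ⊗[k] V →ₗ[k] k} (hf : (X.tensor Y).IsHom (unit k B) f) :
    (X.tensor (Y.tensor Z)).IsHom Z (onTwo f) :=
  (isHom_lid Z).comp ((hf.rTensor Z).comp (isHom_assoc_symm _ _ _))

theorem lTensor_coactMul_mulLeft (p : V ⊗[k] W →ₗ[k] U) (b : B) (s : B ⊗[k] V) (t : B ⊗[k] W) :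
    p.lTensor B (coactMul k B V W ((LinearMap.mulLeft k b).rTensor V s ⊗ₜ t)) =
      (LinearMap.mulLeft k b).rTensor U (p.lTensor B (coactMul k B V W (s ⊗ₜ t))) := by
  induction s using TensorProduct.induction_on with
  | zero => simp
  | add x y hx hy => simp only [map_add, TensorProduct.add_tmul, hx, hy]
  | tmul a v =>
    induction t using TensorProduct.induction_on with
    | zero => simp
    | add x y hx hy => simp only [map_add, TensorProduct.tmul_add, hx, hy]
    | tmul c w => simp [mul_assoc]

theorem lTensor_coactMul_one (p : V ⊗[k] W →ₗ[k] U) (v : V) (t : B ⊗[k] W) :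
    p.lTensor B (coactMul k B V W ((1 ⊗ₜ v) ⊗ₜ t)) =
      (p ∘ₗ TensorProduct.mk k V W v).lTensor B t := by
  induction t using TensorProduct.induction_on with
  | zero => simp
  | add x y hx hy => simp only [map_add, TensorProduct.tmul_add, hx, hy]
  | tmul c w => simp

section Congr

variable {X : YDData k B V} {Y : YDData k B W} {Y' : YDData k B W'} {Z : YDData k B U}
  {p : V ⊗[k] W →ₗ[k] U} {q : V ⊗[k] W' →ₗ[k] U}

/-- Linearity fixes p(b₁x ⊗ b₂y) and q(b₁x ⊗ b₂y'), and the tensors b₂ ⊗ b₁x span B ⊗ V. Thus a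
condition on all values p(x ⊗ y) is inherited by b · y; `IsHom.coact_congr` does the same for the
coaction with b x₍₋₁₎ ⊗ x₍₀₎. -/
theorem IsHom.act_congr (hB : antipode k (A := B) ∘ₗ antipode k (A := B) = LinearMap.id)
    (hX : X.IsYD) (hp : (X.tensor Y).IsHom Z p) (hq : (X.tensor Y').IsHom Z q) {y : W} {y' : W'}
    (h : ∀ x, p (x ⊗ₜ y) = q (x ⊗ₜ y')) (b : B) (x : V) :
    p (x ⊗ₜ Y.act (b ⊗ₜ y)) = q (x ⊗ₜ Y'.act (b ⊗ₜ y')) := by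
  have key := hX.ext_comul_comm hB
    (p := p ∘ₗ (TensorProduct.comm k W V).toLinearMap ∘ₗ (Y.orbit y).rTensor V)
    (q := q ∘ₗ (TensorProduct.comm k W' V).toLinearMap ∘ₗ (Y'.orbit y').rTensor V) ?_
  · simpa using congr($key (b ⊗ₜ x))
  · intro b v
    have h₁ : ∀ s : B ⊗[k] B, (p ∘ₗ (TensorProduct.comm k W V).toLinearMap ∘ₗ
        (Y.orbit y).rTensor V) ((X.orbit v).lTensor B (TensorProduct.comm k B B s)) =
        p (TensorProduct.map (X.orbit v) (Y.orbit y) s) := by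
      intro s
      induction s using TensorProduct.induction_on with
      | zero => simp
      | add x y hx hy => simp only [map_add, hx, hy]
      | tmul a b => simp
    have h₂ : ∀ s : B ⊗[k] B, (q ∘ₗ (TensorProduct.comm k W' V).toLinearMap ∘ₗ
        (Y'.orbit y').rTensor V) ((X.orbit v).lTensor B (TensorProduct.comm k B B s)) =
        q (TensorProduct.map (X.orbit v) (Y'.orbit y') s) := by
      intro s
      induction s using TensorProduct.induction_on with
      | zero => simp
      | add x y hx hy => simp only [map_add, hx, hy]
      | tmul a b => simp
    rw [h₁, h₂, ← tensor_act_tmul, ← tensor_act_tmul, hp.act, hq.act, h]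

theorem IsHom.coact_congr (hX : X.IsYD) (hp : (X.tensor Y).IsHom Z p)
    (hq : (X.tensor Y').IsHom Z q) {y : W} {y' : W'}
    (h : ∀ x, p (x ⊗ₜ y) = q (x ⊗ₜ y')) (x : V) :
    (p ∘ₗ TensorProduct.mk k V W x).lTensor B (Y.coact y) =
      (q ∘ₗ TensorProduct.mk k V W' x).lTensor B (Y'.coact y') := by
  have key := hX.ext_coact
    (p := p.lTensor B ∘ₗ coactMul k B V W ∘ₗ (TensorProduct.mk k _ _).flip (Y.coact y))
    (q := q.lTensor B ∘ₗ coactMul k B V W' ∘ₗ (TensorProduct.mk k _ _).flip (Y'.coact y')) ?_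
  · rw [← lTensor_coactMul_one, ← lTensor_coactMul_one]
    exact congr($key (1 ⊗ₜ x))
  · intro b v
    simp only [LinearMap.comp_apply, LinearMap.flip_apply, TensorProduct.mk_apply]
    rw [lTensor_coactMul_mulLeft, lTensor_coactMul_mulLeft, ← tensor_coact_tmul, ← tensor_coact_tmul, ← hp.coact, ← hq.coact, h]

end Congr

end Pairing

section Separation

variable {k B U V W W' : Type*} [Field k] [Ring B] [HopfAlgebra k B]
  [AddCommMonoid U] [Module k U] [AddCommMonoid V] [Module k V] [AddCommMonoid W] [Module k W]
  [AddCommMonoid W'] [Module k W'] [Module.Free k W']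

/-- A linear map determined by a separating pairing with morphisms is a morphism. -/
theorem IsHom.of_pairing (hB : antipode k (A := B) ∘ₗ antipode k (A := B) = LinearMap.id)
    {X : YDData k B V} {Y : YDData k B W} {Y' : YDData k B W'} {Z : YDData k B U}
    {p : V ⊗[k] W →ₗ[k] U} {q : V ⊗[k] W' →ₗ[k] U}
    (hX : X.IsYD) (hp : (X.tensor Y).IsHom Z p) (hq : (X.tensor Y').IsHom Z q)
    (hsep : ∀ s t, (∀ x, q (x ⊗ₜ s) = q (x ⊗ₜ t)) → s = t) (r : W →ₗ[k] W')
    (h : ∀ x w, p (x ⊗ₜ w) = q (x ⊗ₜ r w)) : Y.IsHom Y' r := by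
  refine .mk' (fun b w => hsep _ _ fun x => ?_) (fun w => ext_onFst fun φ => hsep _ _ fun x => ?_)
  · rw [← h, hp.act_congr hB hX hq (fun x => h x w)]
  · have h₁ := congr(onFst φ $(hp.coact_congr hX hq (fun x => h x w) x))
    rw [onFst_lTensor, onFst_lTensor] at h₁
    rw [onFst_lTensor, ← h]
    exact h₁.symm

end Separation

end YDData

end

open scoped TensorProduct

noncomputable section

namespace YDData

open Coalgebra (comul counit)
open HopfAlgebra (antipode)

/-! ### The rational part and the integrals as Yetter–Drinfeld submodules. -/

section BraidedHopf

variable {k B H M T T' : Type*} [Field k] [Ring B] [HopfAlgebra k B] [Ring H] [Algebra k H]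
  [AddCommMonoid M] [Module k M] [AddCommMonoid T] [Module k T] [AddCommMonoid T'] [Module k T']
  [FiniteDimensional k B]
  (hB : antipode k (A := B) ∘ₗ antipode k (A := B) = LinearMap.id)

omit [FiniteDimensional k B] in
theorem onTwo_ev_tmul (g : Module.Dual k H) (z : H ⊗[k] T) :
    onTwo (ev k H) (g ⊗ₜ z) = onFst g z := by
  induction z using TensorProduct.induction_on with
  | zero => simp
  | add x y hx hy => simp only [map_add, TensorProduct.tmul_add, hx, hy]
  | tmul a t => simp

variable [Coalgebra k H]

/-- The functionals `f` for which `g ↦ g f` comes from an element of `H ⊗ H^*`. -/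
def finSub (X : YDData k B H) : Submodule k (Module.Dual k H) where
  carrier := {f | ∃ l : H ⊗[k] Module.Dual k H, ∀ g, X.dualMul (g ⊗ₜ f) = onFst g l}
  add_mem' := by
    rintro f f' ⟨l, hl⟩ ⟨l', hl'⟩
    exact ⟨l + l', fun g => by rw [TensorProduct.tmul_add, map_add, map_add, hl, hl']⟩
  zero_mem' := ⟨0, fun g => by simp⟩
  smul_mem' := by
    rintro c f ⟨l, hl⟩
    exact ⟨c • l, fun g => by rw [TensorProduct.tmul_smul, map_smul, map_smul, hl]⟩

include hB in
omit [Coalgebra k H] in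
-- Pulling the strand `M` across the evaluation removes C_{H^*,M} at the price of C⁻¹ on ρ(m);
-- rationality becomes the usual condition for the left coaction C⁻¹ρ.
theorem inducedAct_tmul {X : YDData k B H} {Y : YDData k B M} (hX : X.IsYD) (hY : Y.IsYD)
    (ρ : M →ₗ[k] M ⊗[k] H) (g : Module.Dual k H) (m : M) :
    X.inducedAct Y ρ (g ⊗ₜ m) = onFst g (X.braidInv Y (ρ m)) := by
  have h₁ : ∀ w : M ⊗[k] H, TensorProduct.rid k M ((ev k H).lTensor M
      (TensorProduct.assoc k M (Module.Dual k H) H ((X.dual.braid Y).rTensor H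
        ((TensorProduct.assoc k (Module.Dual k H) M H).symm (g ⊗ₜ w))))) =
      TensorProduct.rid k M ((onTwo (ev k H)).lTensor M
        (br X.dual Y (g ⊗ₜ TensorProduct.assoc k M H k (w ⊗ₜ 1)))) := by
    intro w
    induction w using TensorProduct.induction_on with
    | zero => simp
    | add x y hx hy => simp only [map_add, TensorProduct.tmul_add, TensorProduct.add_tmul, hx, hy]
    | tmul m h =>
      simp only [TensorProduct.assoc_symm_tmul, LinearMap.rTensor_tmul, TensorProduct.assoc_tmul,
        br_tmul]
      induction X.dual.braid Y (g ⊗ₜ m) using TensorProduct.induction_on with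
      | zero => simp
      | add x y hx hy =>
        simp only [map_add, TensorProduct.add_tmul, hx, hy]
      | tmul a g => simp
  have h₂ : ∀ z : H ⊗[k] M, TensorProduct.rid k M (onFst g (TensorProduct.assoc k H M k
      (z ⊗ₜ 1))) = onFst g z := by
    intro z
    induction z using TensorProduct.induction_on with
    | zero => simp
    | add x y hx hy => simp only [map_add, TensorProduct.add_tmul, hx, hy]
    | tmul h m => simp
  trans TensorProduct.rid k M ((onTwo (ev k H)).lTensor M
        (br X.dual Y (g ⊗ₜ TensorProduct.assoc k M H k (ρ m ⊗ₜ 1))))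
  · exact h₁ (ρ m)
  · rw [← braid_braidInv hB hX hY (ρ m), ← br_assoc, ← LinearMap.lTensor_tmul,
      ← br_onTwo_left (isHom_ev hB hX) hY, onTwo_ev_tmul, h₂, braidInv_braid hB hX hY]

section Hopf

variable {X : YDData k B H} {S : H →ₗ[k] H} (hH : X.IsBraidedHopfAlgebra S)
include hB hH

theorem dualMul_mem_finSub {f : Module.Dual k H} (hf : f ∈ X.finSub) (g : Module.Dual k H) :
    X.dualMul (g ⊗ₜ f) ∈ X.finSub := by
  obtain ⟨l, hl⟩ := hf
  -- g'(g f) = (g'g)f is l with its first leg paired with g'g, and that pairing goes through C⁻¹Δ.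
  refine ⟨onFst g (comulInvF X _ l), fun g' => ?_⟩
  rw [← dualMul_assoc hB hH, hl, onFst_dualMul hB hH]

theorem isHom_onTwo_ev (Y : YDData k B M) :
    (X.dual.tensor (X.tensor Y)).IsHom Y (onTwo (ev k H)) :=
  isHom_onTwo Y (isHom_ev hB hH.isYD)

/-- If `l` represents g ↦ g f, then b · l represents g ↦ g (b · f), as both pairings are morphisms;
the coaction is treated alike, one functional on B at a time. -/
theorem exists_finSub_isHom : ∃ Y : YDData k B X.finSub, Y.IsHom X.dual X.finSub.subtype := by
  have hX' := isYD_dual hB hH.isYD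
  have hmul := isHom_dualMul hB hH
  refine exists_restrict _ _ ?_ ?_
  · rintro b f ⟨l, hl⟩
    refine ⟨(X.tensor X.dual).act (b ⊗ₜ l), fun g => ?_⟩
    rw [← onTwo_ev_tmul]
    exact hmul.act_congr hB hX' (isHom_onTwo_ev hB hH X.dual)
      (fun g => by rw [hl, onTwo_ev_tmul]) b g
  · rintro f ⟨l, hl⟩
    refine mem_range_lTensor_subtype fun φ => ⟨onFst φ ((X.tensor X.dual).coact l), fun g => ?_⟩
    have h := hmul.coact_congr hX' (isHom_onTwo_ev hB hH X.dual)
      (fun g => by rw [hl, onTwo_ev_tmul]) g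
    have h₁ := congr(onFst φ $h)
    rw [onFst_lTensor, onFst_lTensor] at h₁
    rw [← onTwo_ev_tmul g]
    exact h₁

/-- The tensor representing `f` is unique, hence linear in `f`. It lies in H ⊗ `finSub` because all
its contractions g f do. -/
theorem exists_finSub_linearMap : ∃ l : X.finSub →ₗ[k] H ⊗[k] X.finSub,
    ∀ g (f : X.finSub), X.dualMul (g ⊗ₜ f.1) = (onFst g (l f)).1 := by
  have h : ∀ f : X.finSub, ∃ s : H ⊗[k] X.finSub,
      ∀ g, X.dualMul (g ⊗ₜ f.1) = (onFst g s).1 := by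
    rintro ⟨f, hf⟩
    obtain ⟨t, ht⟩ := id hf
    obtain ⟨s, rfl⟩ := mem_range_lTensor_subtype (N := X.finSub) (s := t) fun g => by
      rw [← ht]
      exact dualMul_mem_finSub hB hH hf g
    exact ⟨s, fun g => by rw [ht, onFst_lTensor]; rfl⟩
  choose l hl using h
  refine ⟨⟨⟨l, fun f f' => ?_⟩, fun c f => ?_⟩, fun g f => hl f g⟩
  · refine ext_onFst fun g => Subtype.ext ?_
    rw [map_add, ← hl, Submodule.coe_add, Submodule.coe_add, ← hl, ← hl, TensorProduct.tmul_add,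
      map_add]
  · refine ext_onFst fun g => Subtype.ext ?_
    rw [map_smul, ← hl, RingHom.id_apply, Submodule.coe_smul, Submodule.coe_smul, ← hl,
      TensorProduct.tmul_smul, map_smul]

theorem exists_finSub :
    ∃ (Y : YDData k B X.finSub) (l : X.finSub →ₗ[k] H ⊗[k] X.finSub),
      Y.IsHom X.dual X.finSub.subtype ∧ Y.IsHom (X.tensor Y) l ∧
      ∀ g (f : X.finSub), X.dualMul (g ⊗ₜ f.1) = (onFst g (l f)).1 := by
  obtain ⟨Y, hY⟩ := exists_finSub_isHom hB hH
  obtain ⟨l, hl⟩ := exists_finSub_linearMap hB hH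
  refine ⟨Y, l, hY, ?_, hl⟩
  refine .of_pairing hB (isYD_dual hB hH.isYD) ((isHom_dualMul hB hH).comp (hY.lTensor X.dual))
    (hY.comp (isHom_onTwo_ev hB hH Y)) (fun s t h => ?_) l fun g f => ?_
  · refine ext_onFst fun g => Subtype.ext ?_
    have := h g
    simp only [LinearMap.comp_apply, onTwo_ev_tmul] at this
    exact this
  · rw [LinearMap.comp_apply, LinearMap.comp_apply, onTwo_ev_tmul]
    exact hl g f

/-- The coaction ρ = C l makes `finSub` rational. Conversely, for f in a rational N, the tensor
C⁻¹ρ(f) represents g ↦ g f. -/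
theorem isGreatest_finSub : IsGreatest {N | X.IsRationalSubmodule N} X.finSub := by
  have hX := hH.isYD
  have hX' := isYD_dual hB hX
  refine ⟨?_, ?_⟩
  · obtain ⟨Y, l, hY, hl, h⟩ := exists_finSub hB hH
    have hYD := hX'.of_injective hY Subtype.val_injective
    refine ⟨Y, _, hY, ?_, X.braid Y ∘ₗ l, (isHom_braid hX hYD).comp hl, rfl⟩
    ext g f : 3
    simp only [TensorProduct.AlgebraTensorModule.curry_apply, LinearMap.restrictScalars_self,
      TensorProduct.curry_apply, LinearMap.comp_apply, LinearMap.lTensor_tmul,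
      inducedAct_tmul hB hX hYD, braidInv_braid hB hX hYD]
    exact (h g f).symm
  · rintro N ⟨Y, α, hY, hα, ρ, -, hρ⟩ f hf
    have hYD := hX'.of_injective hY Subtype.val_injective
    refine ⟨N.subtype.lTensor H (X.braidInv Y (ρ ⟨f, hf⟩)), fun g => ?_⟩
    rw [onFst_lTensor, ← inducedAct_tmul hB hX hYD, hρ]
    exact congr($hα (g ⊗ₜ ⟨f, hf⟩)).symm

theorem rat_eq_finSub : X.rat = X.finSub := (isGreatest_finSub hB hH).isLUB.sSup_eq

/-- Integrals are the `f` on which the morphisms g ⊗ f ↦ g f and g ⊗ f ↦ g(1)f agree for every g, so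
the congruence lemmas apply. -/
theorem exists_integrals : ∃ Z : YDData k B X.integrals, Z.IsHom X.dual X.integrals.subtype := by
  have hX := hH.isYD
  have hX' := isYD_dual hB hX
  have hmul := isHom_dualMul hB hH
  -- Writing g(1)f as the evaluation of g on an inserted unit displays it as a composite of
  -- morphisms.
  let q : Module.Dual k H ⊗[k] Module.Dual k H →ₗ[k] Module.Dual k H :=
    onTwo (ev k H) ∘ₗ (TensorProduct.mk k H _ 1).lTensor _
  have hq : (X.dual.tensor X.dual).IsHom X.dual q := by
    have h₁ : (TensorProduct.mk k H (Module.Dual k H) 1) =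
        (Algebra.linearMap k H).rTensor _ ∘ₗ (TensorProduct.lid k _).symm.toLinearMap := by
      ext; simp
    simp only [q, h₁]
    exact (isHom_onTwo_ev hB hH X.dual).comp
      (((hH.one_hom.rTensor X.dual).comp (isHom_lid X.dual).symm).lTensor X.dual)
  have hq' : ∀ g f, q (g ⊗ₜ f) = g 1 • f := fun g f => by simp [q]
  refine exists_restrict _ _ (fun b f hf g => ?_) fun f hf => ?_
  · rw [← hq']
    exact hmul.act_congr hB hX' hq (fun g => by rw [hf g, hq']) b g
  · refine mem_range_lTensor_subtype fun φ g => ?_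
    have h₁ := congr(onFst φ $(hmul.coact_congr hX' hq (fun g => by rw [hf g, hq']) g))
    rw [onFst_lTensor, onFst_lTensor] at h₁
    rw [← hq']
    exact h₁

end Hopf

end BraidedHopf

end YDData

end

open scoped TensorProduct

noncomputable section

namespace YDData

open Coalgebra (comul counit)
open HopfAlgebra (antipode)

/-! ### The action ↼ on the rational part. -/

section Restrict

variable {k B U V W : Type*} [Field k] [Ring B] [HopfAlgebra k B]
  [AddCommMonoid U] [Module k U] [AddCommMonoid V] [Module k V] [AddCommMonoid W] [Module k W]

theorem IsHom.of_comp_injective {X : YDData k B U} {Y : YDData k B V} {Z : YDData k B W}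
    {f : V →ₗ[k] W} {g : U →ₗ[k] V} (hf : Y.IsHom Z f) (hfg : X.IsHom Z (f ∘ₗ g))
    (h : Function.Injective f) : X.IsHom Y g := by
  refine .mk' (fun b u => h ?_) fun u =>
    Module.Flat.lTensor_preserves_injective_linearMap (M := B) f h ?_
  · rw [hf.act]
    exact hfg.act b u
  · rw [← hf.coact, ← LinearMap.lTensor_comp_apply]
    exact hfg.coact u

end Restrict

section BraidedHopf

variable {k B H M M' T T' : Type*} [Field k] [Ring B] [HopfAlgebra k B] [Ring H] [Algebra k H]
  [AddCommMonoid M] [Module k M] [AddCommMonoid M'] [Module k M'] [AddCommMonoid T] [Module k T]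
  [AddCommMonoid T'] [Module k T']

/-- The map `(m ⊗ a)(H ⊗ C⁻¹ ⊗ H) : H ⊗ M ⊗ H ⊗ H → H ⊗ M`. -/
def diagAct (X : YDData k B H) (Y : YDData k B M) (a : M ⊗[k] H →ₗ[k] M) :
    H ⊗[k] (M ⊗[k] (H ⊗[k] H)) →ₗ[k] H ⊗[k] M :=
  mulF k H M ∘ₗ (a.lTensor H).lTensor H ∘ₗ (brInv X Y).lTensor H

theorem diagAct_tmul (X : YDData k B H) (Y : YDData k B M) (a : M ⊗[k] H →ₗ[k] M) (u : H) (m : M)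
    (g h : H) : diagAct X Y a (u ⊗ₜ (m ⊗ₜ (g ⊗ₜ h))) = mulF k H M (u ⊗ₜ a.lTensor H
      (TensorProduct.assoc k H M H (X.braidInv Y (m ⊗ₜ g) ⊗ₜ h))) := rfl

variable (hB : antipode k (A := B) ∘ₗ antipode k (A := B) = LinearMap.id)
include hB

theorem braidInv_rTensor {X : YDData k B H} {Y : YDData k B M} {Y' : YDData k B M'}
    (hX : X.IsYD) (hY : Y.IsYD) (hY' : Y'.IsYD) {f : M →ₗ[k] M'} (hf : Y.IsHom Y' f)
    (z : M ⊗[k] H) : X.braidInv Y' (f.rTensor H z) = f.lTensor H (X.braidInv Y z) := by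
  have h : ∀ w : H ⊗[k] M, X.braid Y' (f.lTensor H w) = f.rTensor H (X.braid Y w) := by
    intro w
    induction w using TensorProduct.induction_on with
    | zero => simp
    | add x y hx hy => simp only [map_add, hx, hy]
    | tmul h m =>
      rw [LinearMap.lTensor_tmul, braid_tmul, braid_tmul, hf.orbit, LinearMap.rTensor_comp,
        LinearMap.comp_apply]
  conv_lhs => rw [← braid_braidInv hB hX hY z, ← h, braidInv_braid hB hX hY']

/-- Carries the formula for g(f ↼ h) from H^* to a submodule. -/
theorem diagAct_naturality {X : YDData k B H} {Y : YDData k B M} {Y' : YDData k B M'}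
    (hX : X.IsYD) (hY : Y.IsYD) (hY' : Y'.IsYD) {f : M →ₗ[k] M'} (hf : Y.IsHom Y' f)
    {a : M ⊗[k] H →ₗ[k] M} {a' : M' ⊗[k] H →ₗ[k] M'} (ha : f ∘ₗ a = a' ∘ₗ f.rTensor H)
    (z : H ⊗[k] (M ⊗[k] (H ⊗[k] H))) :
    diagAct X Y' a' ((f.rTensor _).lTensor H z) = f.lTensor H (diagAct X Y a z) := by
  refine ext_three (p := diagAct X Y' a' ∘ₗ (f.rTensor _).lTensor H)
    (q := f.lTensor H ∘ₗ diagAct X Y a) (fun u m g h => ?_) z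
  simp only [LinearMap.comp_apply, LinearMap.lTensor_tmul, LinearMap.rTensor_tmul, diagAct_tmul]
  have h₁ := braidInv_rTensor hB hX hY hY' hf (m ⊗ₜ g)
  rw [LinearMap.rTensor_tmul] at h₁
  rw [h₁]
  induction X.braidInv Y (m ⊗ₜ g) using TensorProduct.induction_on with
  | zero => simp
  | add x y hx hy => simp only [map_add, TensorProduct.add_tmul, TensorProduct.tmul_add, hx, hy]
  | tmul g m =>
    have := congr($ha (m ⊗ₜ h))
    simp only [LinearMap.comp_apply, LinearMap.rTensor_tmul] at this
    simp [this]

variable [FiniteDimensional k B] [Coalgebra k H]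

section Hopf

omit hB [FiniteDimensional k B] [Coalgebra k H] [HopfAlgebra k B] [Ring B] in
theorem onFst_add (f g : Module.Dual k H) (z : H ⊗[k] T) :
    onFst (f + g) z = onFst f z + onFst g z := by
  simp [onFst, LinearMap.rTensor_add]

omit hB [FiniteDimensional k B] [Coalgebra k H] [HopfAlgebra k B] [Ring B] in
theorem onFst_smul (c : k) (f : Module.Dual k H) (z : H ⊗[k] T) :
    onFst (c • f) z = c • onFst f z := by
  simp [onFst, LinearMap.rTensor_smul]

variable {X : YDData k B H} {S : H →ₗ[k] H} (hH : X.IsBraidedHopfAlgebra S)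
include hH

omit hB [FiniteDimensional k B] in
theorem br_lTensor_adF (z : H ⊗[k] (H ⊗[k] (H ⊗[k] T))) :
    br X X ((adF X S T).lTensor H z) = adF X S _ ((br X X).lTensor H (br X X z)) := by
  have hX := hH.isYD
  have h : adF X S T = mulF k H T ∘ₗ br X X ∘ₗ S.rTensor _ := rfl
  rw [adF_apply, h]
  simp only [LinearMap.lTensor_comp, LinearMap.comp_apply]
  rw [br_onPair_right hH.mul_hom hX, ← yang_baxter hX hX hX, br_rTensor_right X hH.antipode_hom,
    rTensor_lTensor]

/-- Pulling a strand across the evaluation of the H^*-leg of `t` trades the C⁻¹ of the diagonal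
action for crossings on H alone, the shape needed to apply `comulInvF_mulF_adF`. -/
theorem onFst_diagAct_dualAct (g : Module.Dual k H) (t : H ⊗[k] Module.Dual k H) (d : H ⊗[k] H)
    (z : H ⊗[k] T) :
    onFst (onFst g (diagAct X X.dual (X.dualAct S) (TensorProduct.assoc k _ _ _ (t ⊗ₜ d)))) z =
      onFst g (mulF k H T ((onTwo (ev k H)).lTensor H (TensorProduct.assoc k _ _ _ (t ⊗ₜ
        adF X S _ ((br X X).lTensor H (br X X (TensorProduct.assoc k H H _ (d ⊗ₜ z)))))))) := by
  have hX := hH.isYD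
  have hX' := isYD_dual hB hX
  induction t using TensorProduct.induction_on with
  | zero => simp [onFst]
  | add x y hx hy =>
    simp only [map_add, TensorProduct.add_tmul, onFst_add, hx, hy]
  | tmul u w =>
    induction d using TensorProduct.induction_on with
    | zero => simp [onFst]
    | add x y hx hy =>
      simp only [map_add, TensorProduct.add_tmul, TensorProduct.tmul_add, onFst_add, hx, hy]
    | tmul d d' =>
      have h₁ : ∀ s : H ⊗[k] Module.Dual k H, onFst (onFst g (mulF k H _ (u ⊗ₜ
          (X.dualAct S).lTensor H (TensorProduct.assoc k _ _ _ (s ⊗ₜ d'))))) z =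
          onFst g (mulF k H T (u ⊗ₜ (onTwo (ev k H)).lTensor H (((adF X S T).lTensor _).lTensor H
            (TensorProduct.assoc k _ _ _ (s ⊗ₜ (d' ⊗ₜ z)))))) := by
        intro s
        induction s using TensorProduct.induction_on with
        | zero => simp [onFst]
        | add x y hx hy =>
          simp only [map_add, TensorProduct.add_tmul, TensorProduct.tmul_add, onFst_add, hx, hy]
        | tmul h w =>
          simp only [TensorProduct.assoc_tmul, LinearMap.lTensor_tmul, onPair_tmul,
            LinearMap.mul'_apply, onFst_tmul, onTwo_ev_tmul, onFst_smul, onFst_dualAct]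
      simp only [TensorProduct.assoc_tmul, diagAct_tmul, LinearMap.lTensor_tmul, onTwo_ev_tmul]
      rw [h₁, ← brInv_tmul, ← brInv_lTensor, br_onTwo_right (isHom_ev hB hX) hX,
        br_brInv hB hX hX', LinearMap.lTensor_tmul, LinearMap.lTensor_tmul, LinearMap.lTensor_tmul,
        onTwo_ev_tmul, ← br_lTensor_adF hH, LinearMap.lTensor_tmul]

/-- This is the hypothesis on `f` applied not to `g` but to the translated functional u ↦ g(uh). -/
theorem onFst_mulF_comulInvF {f : Module.Dual k H} {t : H ⊗[k] Module.Dual k H}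
    (ht : ∀ g, X.dualMul (g ⊗ₜ f) = onFst g t) (g : Module.Dual k H) (y : H ⊗[k] (H ⊗[k] T)) :
    onFst g (mulF k H T (onFst f (comulInvF X _ y))) =
      onFst g (mulF k H T ((onTwo (ev k H)).lTensor H (TensorProduct.assoc k _ _ _ (t ⊗ₜ y)))) := by
  refine ext_two (p := onFst g ∘ₗ mulF k H T ∘ₗ onFst f ∘ₗ comulInvF X _)
    (q := onFst g ∘ₗ mulF k H T ∘ₗ (onTwo (ev k H)).lTensor H ∘ₗ
      (TensorProduct.assoc k _ _ _).toLinearMap ∘ₗ TensorProduct.mk k _ _ t) (fun a h z => ?_) y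
  simp only [LinearMap.comp_apply, LinearEquiv.coe_coe, TensorProduct.mk_apply]
  let g' := g ∘ₗ LinearMap.mulRight k h
  trans onFst (onFst g' t) (a ⊗ₜ z)
  · rw [← ht, onFst_dualMul hB hH, toPair_tmul, toPair_tmul]
    induction comulInv X a using TensorProduct.induction_on with
    | zero => simp
    | add x y hx hy => simp only [map_add, TensorProduct.add_tmul, hx, hy]
    | tmul a b => simp [g']
  · clear ht
    induction t using TensorProduct.induction_on with
    | zero => simp [onFst]
    | add x y hx hy => simp only [map_add, TensorProduct.add_tmul, onFst_add, hx, hy]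
    | tmul u w => simp [g', mul_smul, smul_comm (w a)]

/-- Without the braiding, ⟨g(f ↼ h), x⟩ = f(x₂S(h)) g(x₁) = f((xS(h₁))₂) g((xS(h₁))₁h₂), which is
g(t₁h₂) (t₂ ↼ h₁)(x). So the diagonal action on t represents f ↼ h. -/
theorem dualMul_dualAct {f : Module.Dual k H} {t : H ⊗[k] Module.Dual k H}
    (ht : ∀ g, X.dualMul (g ⊗ₜ f) = onFst g t) (g : Module.Dual k H) (h : H) :
    X.dualMul (g ⊗ₜ X.dualAct S (f ⊗ₜ h)) = onFst g (diagAct X X.dual (X.dualAct S)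
      (TensorProduct.assoc k _ _ _ (t ⊗ₜ comulInv X h))) := by
  refine ext_onFst_dual fun z => ?_
  rw [onFst_dualMul hB hH, onFst_dualAct, ← LinearMap.lTensor_tmul, ← comulInvF_mulF_adF hB hH,
    onFst_lTensor, onFst_mulF_comulInvF hB hH ht, onFst_diagAct_dualAct hB hH,
    ← toPair_tmul, br_comulInvF hB hH]

theorem dualAct_mem_finSub {f : Module.Dual k H} (hf : f ∈ X.finSub) (h : H) :
    X.dualAct S (f ⊗ₜ h) ∈ X.finSub := by
  obtain ⟨t, ht⟩ := hf
  exact ⟨_, fun g => dualMul_dualAct hB hH ht g h⟩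

omit hB [FiniteDimensional k B] in
theorem antipode_one : S 1 = 1 := by
  have := congr($hH.mul_antipode_rTensor_comul 1)
  simpa [hH.comul_one, hH.counit_one] using this

omit hB [FiniteDimensional k B] in
theorem dualAct_one (f : Module.Dual k H) : X.dualAct S (f ⊗ₜ 1) = f := by
  refine ext_onFst_dual fun z => ?_
  rw [onFst_dualAct, adF_apply, LinearMap.rTensor_tmul, antipode_one hH,
    br_one_tmul hH.isYD hH.one_hom, mulF_lTensor_one]

omit hB [FiniteDimensional k B] in
theorem dualAct_mul (f : Module.Dual k H) (g h : H) :
    X.dualAct S (f ⊗ₜ (g * h)) = X.dualAct S (X.dualAct S (f ⊗ₜ g) ⊗ₜ h) := by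
  refine ext_onFst_dual fun z => ?_
  rw [onFst_dualAct, onFst_dualAct, onFst_dualAct, ← LinearMap.lTensor_tmul, adF_adF hH,
    onPair_tmul, LinearMap.mul'_apply]

end Hopf

end BraidedHopf

end YDData

end

open scoped TensorProduct

noncomputable section

namespace YDData

open Coalgebra (comul counit)
open HopfAlgebra (antipode)

/-! ### The Hopf module axioms in the presence of a tail. -/

section HopfModule

variable {k B H M T T' : Type*} [Field k] [Ring B] [HopfAlgebra k B] [Ring H] [Algebra k H]
  [AddCommMonoid M] [Module k M] [AddCommMonoid T] [Module k T]
  [AddCommMonoid T'] [Module k T'] [Coalgebra k H]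
  {X : YDData k B H} {Y : YDData k B M} {a : M ⊗[k] H →ₗ[k] M} {ρ : M →ₗ[k] M ⊗[k] H}

omit [Coalgebra k H] in
theorem map_midBraid_tmul (X : YDData k B H) (a : M ⊗[k] H →ₗ[k] M)
    (w : M ⊗[k] H) (d : H ⊗[k] H) (t : T) :
    TensorProduct.assoc k M H T (TensorProduct.map a (LinearMap.mul' k H)
      (X.midBraid X M H (w ⊗ₜ d)) ⊗ₜ t) =
    onPair a (((mulF k H T).lTensor H).lTensor M ((br X X).lTensor M
      (TensorProduct.assoc k M H _ (w ⊗ₜ TensorProduct.assoc k H H T (d ⊗ₜ t))))) := by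
  induction w using TensorProduct.induction_on with
  | zero => simp
  | add x y hx hy => simp only [map_add, TensorProduct.add_tmul, hx, hy]
  | tmul m h =>
    induction d using TensorProduct.induction_on with
    | zero => simp
    | add x y hx hy => simp only [map_add, TensorProduct.add_tmul, TensorProduct.tmul_add, hx, hy]
    | tmul g g' =>
      simp only [midBraid, LinearMap.comp_apply, LinearEquiv.coe_coe, TensorProduct.assoc_tmul,
        LinearMap.lTensor_tmul, TensorProduct.assoc_symm_tmul, LinearMap.rTensor_tmul, br_tmul]
      induction X.braid X (h ⊗ₜ g) using TensorProduct.induction_on with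
      | zero => simp
      | add x y hx hy => simp only [map_add, TensorProduct.add_tmul, TensorProduct.tmul_add, hx, hy]
      | tmul g h => simp

theorem tail_compat_tmul (X : YDData k B H) (a : M ⊗[k] H →ₗ[k] M) (ρ : M →ₗ[k] M ⊗[k] H)
    (m : M) (x : H) (t : T) :
    onPair a (((mulF k H T).lTensor H).lTensor M ((br X X).lTensor M
      (((comulF k H T).lTensor H).lTensor M (toPair ρ (m ⊗ₜ (x ⊗ₜ t)))))) =
    TensorProduct.assoc k M H T (TensorProduct.map a (LinearMap.mul' k H)
      (X.midBraid X M H (ρ m ⊗ₜ comul (R := k) x)) ⊗ₜ t) := by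
  rw [map_midBraid_tmul, toPair_tmul, lTensor_assoc, LinearMap.lTensor_tmul, toPair_tmul]

/-- The tail `k` suffices to recover the axiom, whereas `compat_tail` yields it for every tail; the
next lemmas do this for coassociativity and counit. -/
theorem compat_of_tail (h : ∀ z : M ⊗[k] (H ⊗[k] k), toPair ρ (onPair a z) = onPair a
      (((mulF k H k).lTensor H).lTensor M ((br X X).lTensor M
        (((comulF k H k).lTensor H).lTensor M (toPair ρ z))))) :
    ρ ∘ₗ a = TensorProduct.map a (LinearMap.mul' k H) ∘ₗ X.midBraid X M H ∘ₗ
      TensorProduct.map ρ comul := by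
  refine TensorProduct.ext' fun m x => ?_
  have h₁ := h (m ⊗ₜ (x ⊗ₜ 1))
  rw [tail_compat_tmul, onPair_tmul, toPair_tmul] at h₁
  exact (TensorProduct.rid k _).symm.injective ((TensorProduct.assoc k M H k).injective h₁)

theorem compat_tail (h : ρ ∘ₗ a = TensorProduct.map a (LinearMap.mul' k H) ∘ₗ X.midBraid X M H ∘ₗ
      TensorProduct.map ρ comul) (z : M ⊗[k] (H ⊗[k] T)) :
    toPair ρ (onPair a z) = onPair a (((mulF k H T).lTensor H).lTensor M ((br X X).lTensor M
      (((comulF k H T).lTensor H).lTensor M (toPair ρ z)))) := by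
  refine ext_two (p := toPair ρ ∘ₗ onPair a) (q := onPair a ∘ₗ ((mulF k H T).lTensor H).lTensor M ∘ₗ
    (br X X).lTensor M ∘ₗ ((comulF k H T).lTensor H).lTensor M ∘ₗ toPair ρ) (fun m x t => ?_) z
  simp only [LinearMap.comp_apply]
  rw [tail_compat_tmul, onPair_tmul, toPair_tmul]
  exact congr(TensorProduct.assoc k M H T ($h (m ⊗ₜ x) ⊗ₜ t))

omit [Coalgebra k H] in
theorem toPair_assoc (ρ : M →ₗ[k] M ⊗[k] H) (w : M ⊗[k] H) (t : T) :
    toPair ρ (TensorProduct.assoc k M H T (w ⊗ₜ t)) =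
      (TensorProduct.assoc k H H T).toLinearMap.lTensor M (TensorProduct.assoc k M (H ⊗[k] H) T
        (TensorProduct.assoc k M H H (ρ.rTensor H w) ⊗ₜ t)) := by
  induction w using TensorProduct.induction_on with
  | zero => simp
  | add x y hx hy => simp only [map_add, TensorProduct.add_tmul, hx, hy]
  | tmul m h =>
    simp only [TensorProduct.assoc_tmul, toPair_tmul, LinearMap.rTensor_tmul]
    induction ρ m using TensorProduct.induction_on with
    | zero => simp
    | add x y hx hy => simp only [map_add, TensorProduct.add_tmul, hx, hy]
    | tmul m h => simp

theorem lTensor_comulF_assoc (w : M ⊗[k] H) (t : T) :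
    (comulF k H T).lTensor M (TensorProduct.assoc k M H T (w ⊗ₜ t)) =
      (TensorProduct.assoc k H H T).toLinearMap.lTensor M (TensorProduct.assoc k M (H ⊗[k] H) T
        ((comul (R := k)).lTensor M w ⊗ₜ t)) := by
  induction w using TensorProduct.induction_on with
  | zero => simp
  | add x y hx hy => simp only [map_add, TensorProduct.add_tmul, hx, hy]
  | tmul m h => simp

theorem coassoc_of_tail (h : ∀ z : M ⊗[k] k, toPair ρ (toPair ρ z) =
      (comulF k H k).lTensor M (toPair ρ z)) :
    (TensorProduct.assoc k M H H).toLinearMap ∘ₗ ρ.rTensor H ∘ₗ ρ =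
      (comul (R := k) (A := H)).lTensor M ∘ₗ ρ := by
  ext m
  have h₁ := h (m ⊗ₜ 1)
  rw [toPair_tmul, toPair_assoc, lTensor_comulF_assoc] at h₁
  exact (TensorProduct.rid k _).symm.injective ((TensorProduct.assoc k M (H ⊗[k] H) k).injective
    (((TensorProduct.assoc k H H k).lTensor M).injective h₁))

theorem coassoc_tail (h : (TensorProduct.assoc k M H H).toLinearMap ∘ₗ ρ.rTensor H ∘ₗ ρ =
      (comul (R := k) (A := H)).lTensor M ∘ₗ ρ) (z : M ⊗[k] T) :
    toPair ρ (toPair ρ z) = (comulF k H T).lTensor M (toPair ρ z) := by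
  induction z using TensorProduct.induction_on with
  | zero => simp
  | add x y hx hy => simp only [map_add, hx, hy]
  | tmul m t =>
    have h₁ := congr($h m)
    simp only [LinearMap.comp_apply, LinearEquiv.coe_coe] at h₁
    rw [toPair_tmul, toPair_assoc, lTensor_comulF_assoc, h₁]

theorem counit_of_tail (h : ∀ z : M ⊗[k] k, (counitF k H k).lTensor M (toPair ρ z) = z) :
    (TensorProduct.rid k M).toLinearMap ∘ₗ (counit (R := k) (A := H)).lTensor M ∘ₗ ρ =
      LinearMap.id := by
  ext m
  have h₁ := congr(TensorProduct.rid k M $(h (m ⊗ₜ 1)))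
  rw [toPair_tmul, TensorProduct.rid_tmul, one_smul] at h₁
  conv_rhs => rw [LinearMap.id_apply, ← h₁]
  simp only [LinearMap.comp_apply, LinearEquiv.coe_coe]
  induction ρ m using TensorProduct.induction_on with
  | zero => simp
  | add x y hx hy => simp only [map_add, TensorProduct.add_tmul, hx, hy]
  | tmul m h => simp

theorem counit_tail (h : (TensorProduct.rid k M).toLinearMap ∘ₗ
      (counit (R := k) (A := H)).lTensor M ∘ₗ ρ = LinearMap.id) (z : M ⊗[k] T) :
    (counitF k H T).lTensor M (toPair ρ z) = z := by
  induction z using TensorProduct.induction_on with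
  | zero => simp
  | add x y hx hy => simp only [map_add, hx, hy]
  | tmul m t =>
    conv_rhs => rw [← LinearMap.id_apply (R := k) m, ← h]
    simp only [LinearMap.comp_apply, LinearEquiv.coe_coe, toPair_tmul]
    induction ρ m using TensorProduct.induction_on with
    | zero => simp
    | add x y hx hy => simp only [map_add, TensorProduct.add_tmul, hx, hy]
    | tmul m h => simp [TensorProduct.smul_tmul]

end HopfModule

end YDData

end

open scoped TensorProduct

noncomputable section

namespace YDData

open Coalgebra (comul counit)
open HopfAlgebra (antipode)

/-! ### The fundamental theorem of Hopf modules. -/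

section HopfModule

variable {k B H M N T : Type*} [Field k] [Ring B] [HopfAlgebra k B] [Ring H] [Algebra k H]
  [AddCommMonoid M] [Module k M] [AddCommMonoid N] [Module k N] [AddCommMonoid T] [Module k T]
  [Coalgebra k H]
  {X : YDData k B H} {S : H →ₗ[k] H} (hH : X.IsBraidedHopfAlgebra S)
  {Y : YDData k B M} {Z : YDData k B N} {a : M ⊗[k] H →ₗ[k] M} {ρ : M →ₗ[k] M ⊗[k] H}
  (hM : X.IsHopfModule Y a ρ)

/-- The projection `m ↦ m₍₀₎ S(m₍₁₎)` onto the coinvariants of a Hopf module. -/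
def coinvProj (S : H →ₗ[k] H) (a : M ⊗[k] H →ₗ[k] M) (ρ : M →ₗ[k] M ⊗[k] H) : M →ₗ[k] M :=
  a ∘ₗ S.lTensor M ∘ₗ ρ

omit [Coalgebra k H] in
theorem coinvProj_rTensor (S : H →ₗ[k] H) (a : M ⊗[k] H →ₗ[k] M) (ρ : M →ₗ[k] M ⊗[k] H)
    (z : M ⊗[k] T) :
    (coinvProj S a ρ).rTensor T z = onPair a ((S.rTensor T).lTensor M (toPair ρ z)) := by
  induction z using TensorProduct.induction_on with
  | zero => simp
  | add x y hx hy => simp only [map_add, hx, hy]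
  | tmul m t =>
    simp only [LinearMap.rTensor_tmul, toPair_tmul, coinvProj, LinearMap.comp_apply]
    induction ρ m using TensorProduct.induction_on with
    | zero => simp
    | add x y hx hy => simp only [map_add, TensorProduct.add_tmul, hx, hy]
    | tmul m h => simp

include hM

theorem IsHopfModule.onPair_onPair (z : M ⊗[k] (H ⊗[k] (H ⊗[k] T))) :
    onPair a (onPair a z) = onPair a ((mulF k H T).lTensor M z) := by
  refine ext_three (p := onPair a ∘ₗ onPair a) (q := onPair a ∘ₗ (mulF k H T).lTensor M)
    (fun m g h t => ?_) z
  simp [hM.act_mul]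

theorem IsHopfModule.onPair_one (z : M ⊗[k] T) :
    onPair a ((TensorProduct.mk k H T 1).lTensor M z) = z := by
  induction z using TensorProduct.induction_on with
  | zero => simp
  | add x y hx hy => simp only [map_add, hx, hy]
  | tmul m t => simp [hM.act_one]

include hH

/-- As S is anti-comultiplicative, ρ(m₀S(m₁)) is the braided form of m₀S(m₃) ⊗ m₁S(m₂), and m₁S(m₂)
collapses: the projection lands in the coinvariants. -/
theorem toPair_coinvProj_rTensor (z : M ⊗[k] T) :
    toPair ρ ((coinvProj S a ρ).rTensor T z) =
      (TensorProduct.mk k H T 1).lTensor M ((coinvProj S a ρ).rTensor T z) := by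
  have hX := hH.isYD
  have hm := hH.mul_hom
  have hc : ∀ z : H ⊗[k] T, comulF k H T (S.rTensor T z) =
    (br X X ∘ₗ (S.rTensor T).lTensor H ∘ₗ S.rTensor _ ∘ₗ comulF k H T) z := comulF_antipode hH
  rw [coinvProj_rTensor, compat_tail hM.compat, toPair_lTensor, coassoc_tail hM.coassoc,
    under₂₁ (under₂₁ hc)]
  simp only [LinearMap.lTensor_comp, LinearMap.comp_apply]
  rw [under₃₂ (fun z => (br_onPair_left (T := T) hm hX z).symm),
    under₂₂ (onPair_lTensor (LinearMap.mul' k H) (S.rTensor T)),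
    ← under₂₂ (comulF_coassoc (T := T)),
    under₃₂ (q := counitF k H _) (p := TensorProduct.mk k H _ 1)
      (mulF_antipode_right hH (T := H ⊗[k] T)),
    under₂₁ (q := LinearMap.id) (counitF_comulF (T := T)), LinearMap.lTensor_id,
    LinearMap.id_apply,
    under₂₂ (p := TensorProduct.mk k H _ 1) (q := S.rTensor T)
      (fun z => LinearMap.lTensor_tmul _ _ _ _),
    under₂₁ (q := (TensorProduct.mk k H T 1).lTensor H)
      (br_one_tmul (X := X) (Y := X) (T := T) hX hH.one_hom), onPair_lTensor]

/-- m₀S(m₁)m₂ = m. This makes (coinvariants) ⊗ H → M surjective. -/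
theorem onPair_coinvProj_rTensor (z : M ⊗[k] T) :
    onPair a ((coinvProj S a ρ).rTensor _ (toPair ρ z)) = z := by
  rw [coinvProj_rTensor, coassoc_tail hM.coassoc, hM.onPair_onPair,
    under₃₂ (q := counitF k H _) (p := TensorProduct.mk k H _ 1) (mulF_antipode_left hH (T := T)),
    hM.onPair_one, counit_tail hM.counit_coact]

theorem toPair_onPair_coinv {z : M ⊗[k] (H ⊗[k] T)}
    (hz : toPair ρ z = (TensorProduct.mk k H _ 1).lTensor M z) :
    toPair ρ (onPair a z) = onPair a ((comulF k H T).lTensor M z) := by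
  rw [compat_tail hM.compat, hz,
    under₂₂ (p := TensorProduct.mk k H _ 1) (q := comulF k H T)
      (fun z => LinearMap.lTensor_tmul _ _ _ _),
    under₂₁ (q := (TensorProduct.mk k H _ 1).lTensor H)
      (br_one_tmul (X := X) (Y := X) (T := H ⊗[k] T) hH.isYD hH.one_hom),
    under₂₁ (under₂₁ (q := LinearMap.id) (mulF_one (T := T))), LinearMap.lTensor_id,
    LinearMap.lTensor_id, LinearMap.id_apply]

/-- On a coinvariant m, the projection of mh is m h₁S(h₂) = ε(h)m. This gives the injectivity half.
-/
theorem coinvProj_rTensor_onPair {z : M ⊗[k] (H ⊗[k] T)}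
    (hz : toPair ρ z = (TensorProduct.mk k H _ 1).lTensor M z) :
    (coinvProj S a ρ).rTensor T (onPair a z) = (counitF k H T).lTensor M z := by
  rw [coinvProj_rTensor, toPair_onPair_coinv hH hM hz, ← onPair_lTensor, hM.onPair_onPair,
    under₃₂ (q := counitF k H _) (p := TensorProduct.mk k H _ 1) (mulF_antipode_right hH (T := T)),
    hM.onPair_one]

theorem coact_coinvProj (m : M) : ρ (coinvProj S a ρ m) = coinvProj S a ρ m ⊗ₜ 1 := by
  have h := toPair_coinvProj_rTensor hH hM (m ⊗ₜ (1 : k))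
  exact (TensorProduct.rid k _).symm.injective ((TensorProduct.assoc k M H k).injective h)

theorem act_coinvProj_rTensor (m : M) : a ((coinvProj S a ρ).rTensor H (ρ m)) = m := by
  have h := onPair_coinvProj_rTensor hH hM (m ⊗ₜ (1 : k))
  apply (TensorProduct.rid k _).symm.injective
  refine Eq.trans ?_ h
  rw [TensorProduct.rid_symm_apply, toPair_tmul]
  induction ρ m using TensorProduct.induction_on with
  | zero => simp
  | add x y hx hy => simp only [map_add, TensorProduct.add_tmul, hx, hy]
  | tmul m h => simp

theorem coact_act_coinv {m : M} (hm : ρ m = m ⊗ₜ 1) (h : H) :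
    ρ (a (m ⊗ₜ h)) =
      a.rTensor H ((TensorProduct.assoc k M H H).symm (m ⊗ₜ comul (R := k) h)) := by
  have h₁ := toPair_onPair_coinv hH hM (z := m ⊗ₜ (h ⊗ₜ (1 : k))) (by simp [hm])
  apply (TensorProduct.rid k _).symm.injective
  apply (TensorProduct.assoc k M H k).injective
  refine Eq.trans h₁ ?_
  rw [LinearMap.lTensor_tmul, toPair_tmul, TensorProduct.rid_symm_apply]
  induction comul (R := k) h using TensorProduct.induction_on with
  | zero => simp
  | add x y hx hy => simp only [map_add, TensorProduct.add_tmul, TensorProduct.tmul_add, hx, hy]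
  | tmul g h => simp

theorem coinvProj_act {m : M} (hm : ρ m = m ⊗ₜ 1) (h : H) :
    coinvProj S a ρ (a (m ⊗ₜ h)) = counit (R := k) h • m := by
  have h₁ := coinvProj_rTensor_onPair hH hM (z := m ⊗ₜ (h ⊗ₜ (1 : k))) (by simp [hm])
  apply (TensorProduct.rid k _).symm.injective
  refine Eq.trans h₁ ?_
  rw [TensorProduct.rid_symm_apply, TensorProduct.smul_tmul]
  simp

/-- The fundamental theorem of Hopf modules: a Hopf module is `N ⊗ H` for its module `N` of
coinvariants. -/
theorem exists_equiv_of_coinv {i : N →ₗ[k] M} (hi : Z.IsHom Y i) (hinj : Function.Injective i)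
    (hco : ∀ n, ρ (i n) = i n ⊗ₜ 1) (hex : ∀ m, ρ m = m ⊗ₜ 1 → ∃ n, i n = m) :
    ∃ e : M ≃ₗ[k] N ⊗[k] H, Y.IsHom (Z.tensor X) e.toLinearMap ∧
      e.toLinearMap ∘ₗ a = (LinearMap.mul' k H).lTensor N ∘ₗ
        (TensorProduct.assoc k N H H).toLinearMap ∘ₗ e.toLinearMap.rTensor H ∧
      e.toLinearMap.rTensor H ∘ₗ ρ = (TensorProduct.assoc k N H H).symm.toLinearMap ∘ₗ
        (comul (R := k) (A := H)).lTensor N ∘ₗ e.toLinearMap := by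
  -- The projection onto the coinvariants, corestricted along `i`; linearity follows from
  -- injectivity of `i`.
  choose p hp using fun m => hex _ (coact_coinvProj hH hM m)
  let P : M →ₗ[k] N :=
    { toFun := p
      map_add' := fun x y => hinj (by simp only [map_add, hp])
      map_smul' := fun c x => hinj (by simp only [map_smul, hp, RingHom.id_apply]) }
  have hP : i ∘ₗ P = coinvProj S a ρ := LinearMap.ext hp
  have hP' : ∀ n h, P (a (i n ⊗ₜ h)) = counit (R := k) h • n := fun n h => hinj (by
    rw [map_smul, ← coinvProj_act hH hM (hco n), ← hP]
    rfl)
  let f : N ⊗[k] H →ₗ[k] M := a ∘ₗ i.rTensor H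
  have hf : (Z.tensor X).IsHom Y f := hM.act_hom.comp (hi.rTensor X)
  have hfρ : ∀ w, ρ (f w) = f.rTensor H ((TensorProduct.assoc k N H H).symm
      ((comul (R := k) (A := H)).lTensor N w)) := by
    intro w
    induction w using TensorProduct.induction_on with
    | zero => simp
    | add x y hx hy => simp only [map_add, hx, hy]
    | tmul n h =>
      simp only [f, LinearMap.comp_apply, LinearMap.rTensor_tmul, LinearMap.lTensor_tmul]
      rw [coact_act_coinv hH hM (hco n)]
      induction comul (R := k) h using TensorProduct.induction_on with
      | zero => simp
      | add x y hx hy => simp only [map_add, TensorProduct.tmul_add, hx, hy]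
      | tmul g h => simp
  have hfa : ∀ w h, f ((LinearMap.mul' k H).lTensor N (TensorProduct.assoc k N H H (w ⊗ₜ h))) =
      a (f w ⊗ₜ h) := by
    intro w h
    induction w using TensorProduct.induction_on with
    | zero => simp
    | add x y hx hy => simp only [map_add, TensorProduct.add_tmul, hx, hy]
    | tmul n g => simp [f, hM.act_mul]
  -- The map n ⊗ h ↦ i(n)h has inverse m ↦ P(m₀) ⊗ m₁. All structure is checked on `f`, a composite
  -- of morphisms, and passes to the inverse.
  let e : N ⊗[k] H ≃ₗ[k] M := .ofLinearMap f (P.rTensor H ∘ₗ ρ)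
    (by
      ext m
      simp only [f, LinearMap.comp_apply, LinearMap.id_apply]
      rw [← LinearMap.rTensor_comp_apply, hP, act_coinvProj_rTensor hH hM])
    (by
      refine TensorProduct.ext' fun n h => ?_
      rw [LinearMap.comp_apply, LinearMap.comp_apply, hfρ, LinearMap.lTensor_tmul,
        LinearMap.id_apply]
      trans n ⊗ₜ TensorProduct.lid k H ((counit (R := k)).rTensor H (comul (R := k) h))
      · induction comul (R := k) h using TensorProduct.induction_on with
        | zero => simp
        | add x y hx hy => simp only [map_add, TensorProduct.tmul_add, hx, hy]
        | tmul g h => simp [f, hP', TensorProduct.smul_tmul]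
      · simp)
  have he : ∀ w, e w = f w := fun _ => rfl
  refine ⟨e.symm, IsHom.symm (e := e) hf, ?_, ?_⟩
  · refine TensorProduct.ext' fun m h => ?_
    apply e.injective
    change e (e.symm (a (m ⊗ₜ h))) =
      f ((LinearMap.mul' k H).lTensor N (TensorProduct.assoc k N H H (e.symm m ⊗ₜ h)))
    rw [hfa, ← he, e.apply_symm_apply, e.apply_symm_apply]
  · ext m
    obtain ⟨w, rfl⟩ := e.surjective m
    have h : e.symm.toLinearMap ∘ₗ f = LinearMap.id := LinearMap.ext e.symm_apply_apply
    change e.symm.toLinearMap.rTensor H (ρ (f w)) = (TensorProduct.assoc k N H H).symm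
      ((comul (R := k) (A := H)).lTensor N (e.symm (e w)))
    rw [hfρ, e.symm_apply_apply, ← LinearMap.rTensor_comp_apply, h, LinearMap.rTensor_id,
      LinearMap.id_apply]

end HopfModule

end YDData

end

open scoped TensorProduct

noncomputable section

namespace YDData

open Coalgebra (comul counit)
open HopfAlgebra (antipode)

/-! ### The Hopf modules N ⊗ H and H^{*rat}. -/

section HopfModule

variable {k B H M N T : Type*} [Field k] [Ring B] [HopfAlgebra k B] [Ring H] [Algebra k H]
  [AddCommMonoid M] [Module k M] [AddCommMonoid N] [Module k N] [AddCommMonoid T] [Module k T]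

theorem assoc_tmul_eq (w : H ⊗[k] M) (t : T) : TensorProduct.assoc k H M T (w ⊗ₜ t) =
    ((TensorProduct.mk k M T).flip t).lTensor H w := by
  induction w using TensorProduct.induction_on with
  | zero => simp
  | add x y hx hy => simp only [map_add, TensorProduct.add_tmul, hx, hy]
  | tmul h m => simp

theorem diagAct_tail (X : YDData k B H) (Y : YDData k B M) (a : M ⊗[k] H →ₗ[k] M) (w : H ⊗[k] M)
    (d : H ⊗[k] H) (t : T) :
    TensorProduct.assoc k H M T (diagAct X Y a (TensorProduct.assoc k _ _ _ (w ⊗ₜ d)) ⊗ₜ t) =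
      mulF k H _ (((onPair a).lTensor H).lTensor H ((brInv X Y).lTensor H
        (TensorProduct.assoc k _ _ _ (w ⊗ₜ TensorProduct.assoc k H H T (d ⊗ₜ t))))) := by
  induction w using TensorProduct.induction_on with
  | zero => simp
  | add x y hx hy => simp only [map_add, TensorProduct.add_tmul, hx, hy]
  | tmul u m =>
    induction d using TensorProduct.induction_on with
    | zero => simp
    | add x y hx hy => simp only [map_add, TensorProduct.add_tmul, TensorProduct.tmul_add, hx, hy]
    | tmul g g' =>
      simp only [TensorProduct.assoc_tmul, diagAct_tmul, LinearMap.lTensor_tmul, brInv_tmul]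
      induction X.braidInv Y (m ⊗ₜ g) using TensorProduct.induction_on with
      | zero => simp
      | add x y hx hy => simp only [map_add, TensorProduct.add_tmul, TensorProduct.tmul_add, hx, hy]
      | tmul g m => simp

theorem toPair_braid_comp (X : YDData k B H) (Y : YDData k B M) (l : M →ₗ[k] H ⊗[k] M)
    (z : M ⊗[k] T) : toPair (X.braid Y ∘ₗ l) z = br X Y (toPair l z) := by
  induction z using TensorProduct.induction_on with
  | zero => simp
  | add x y hx hy => simp only [map_add, hx, hy]
  | tmul m t => rw [toPair_tmul, toPair_tmul, br_assoc, LinearMap.comp_apply]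

theorem braid_one_tmul {X : YDData k B H} {Y : YDData k B M} (hY : Y.IsYD)
    (he : (unit k B).IsHom X (Algebra.linearMap k H)) (m : M) :
    X.braid Y (1 ⊗ₜ m) = m ⊗ₜ 1 := by
  have h := br_one_tmul (T := k) hY he (m ⊗ₜ 1)
  exact (TensorProduct.rid k _).symm.injective ((TensorProduct.assoc k M H k).injective h)

variable [Coalgebra k H] {X : YDData k B H} {S : H →ₗ[k] H} (hH : X.IsBraidedHopfAlgebra S)
include hH

/-- `N ⊗ H` is a Hopf module through the second factor. -/
theorem isHopfModule_tensor {Z : YDData k B N} (hZ : Z.IsYD) :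
    X.IsHopfModule (Z.tensor X)
      ((LinearMap.mul' k H).lTensor N ∘ₗ (TensorProduct.assoc k N H H).toLinearMap)
      ((TensorProduct.assoc k N H H).symm.toLinearMap ∘ₗ
        (comul (R := k) (A := H)).lTensor N) where
  isYD := hZ.tensor hH.isYD
  act_hom := (hH.mul_hom.lTensor Z).comp (isHom_assoc _ _ _)
  coact_hom := (isHom_assoc_symm _ _ _).comp (hH.comul_hom.lTensor Z)
  act_one z := by
    induction z using TensorProduct.induction_on with
    | zero => simp
    | add x y hx hy => simp only [map_add, TensorProduct.add_tmul, hx, hy]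
    | tmul n h => simp
  act_mul z g h := by
    induction z using TensorProduct.induction_on with
    | zero => simp
    | add x y hx hy => simp only [map_add, TensorProduct.add_tmul, hx, hy]
    | tmul n h => simp [mul_assoc]
  coassoc := by
    refine TensorProduct.ext' fun n h => ?_
    have h₁ : ∀ d : H ⊗[k] H, TensorProduct.assoc k (N ⊗[k] H) H H
        (((TensorProduct.assoc k N H H).symm.toLinearMap ∘ₗ
          (comul (R := k) (A := H)).lTensor N).rTensor H
          ((TensorProduct.assoc k N H H).symm (n ⊗ₜ d))) =
        (TensorProduct.assoc k N H (H ⊗[k] H)).symm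
          (n ⊗ₜ TensorProduct.assoc k H H H ((comul (R := k)).rTensor H d)) := by
      intro d
      induction d using TensorProduct.induction_on with
      | zero => simp
      | add x y hx hy => simp only [map_add, TensorProduct.tmul_add, hx, hy]
      | tmul g g' =>
        simp only [TensorProduct.assoc_symm_tmul, LinearMap.rTensor_tmul, LinearMap.comp_apply,
          LinearMap.lTensor_tmul, LinearEquiv.coe_coe]
        induction comul (R := k) g using TensorProduct.induction_on with
        | zero => simp
        | add x y hx hy => simp only [map_add, TensorProduct.add_tmul, TensorProduct.tmul_add, hx, hy]
        | tmul g h => simp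
    have h₂ : ∀ d : H ⊗[k] H, (comul (R := k) (A := H)).lTensor (N ⊗[k] H)
        ((TensorProduct.assoc k N H H).symm (n ⊗ₜ d)) =
        (TensorProduct.assoc k N H (H ⊗[k] H)).symm (n ⊗ₜ (comul (R := k)).lTensor H d) := by
      intro d
      induction d using TensorProduct.induction_on with
      | zero => simp
      | add x y hx hy => simp only [map_add, TensorProduct.tmul_add, hx, hy]
      | tmul g g' => simp
    refine (h₁ (comul h)).trans (Eq.trans ?_ (h₂ (comul h)).symm)
    rw [Coalgebra.coassoc_apply]
  counit_coact := by
    refine TensorProduct.ext' fun n h => ?_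
    trans n ⊗ₜ TensorProduct.rid k H ((counit (R := k)).lTensor H (comul (R := k) h))
    · simp only [LinearMap.comp_apply, LinearMap.lTensor_tmul, LinearEquiv.coe_coe]
      induction comul (R := k) h using TensorProduct.induction_on with
      | zero => simp
      | add x y hx hy => simp only [map_add, TensorProduct.tmul_add, hx, hy]
      | tmul g h => simp
    · simp
  compat := by
    refine TensorProduct.ext' fun z h => ?_
    induction z using TensorProduct.induction_on with
    | zero => simp
    | add x y hx hy => simp only [map_add, TensorProduct.add_tmul, hx, hy]
    | tmul n g =>
      have h₁ := congr($hH.comul_mul (g ⊗ₜ h))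
      simp only [LinearMap.comp_apply, LinearMap.mul'_apply, TensorProduct.map_tmul] at h₁
      simp only [LinearMap.comp_apply, LinearEquiv.coe_coe, TensorProduct.assoc_tmul,
        LinearMap.lTensor_tmul, LinearMap.mul'_apply, TensorProduct.map_tmul, h₁]
      induction comul (R := k) g using TensorProduct.induction_on with
      | zero => simp
      | add x y hx hy => simp only [map_add, TensorProduct.add_tmul, TensorProduct.tmul_add, hx, hy]
      | tmul g g' =>
        induction comul (R := k) h using TensorProduct.induction_on with
        | zero => simp
        | add x y hx hy => simp only [map_add, TensorProduct.tmul_add, hx, hy]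
        | tmul h h' =>
          simp only [midBraid, LinearMap.comp_apply, LinearEquiv.coe_coe, TensorProduct.assoc_tmul,
            LinearMap.lTensor_tmul, TensorProduct.assoc_symm_tmul, LinearMap.rTensor_tmul]
          induction X.braid X (g' ⊗ₜ h) using TensorProduct.induction_on with
          | zero => simp
          | add x y hx hy =>
            simp only [map_add, TensorProduct.add_tmul, TensorProduct.tmul_add, hx, hy]
          | tmul h g => simp

variable [FiniteDimensional k B]
  (hB : antipode k (A := B) ∘ₗ antipode k (A := B) = LinearMap.id)
  {Y : YDData k B M} {j : M →ₗ[k] Module.Dual k H} (hj : Y.IsHom X.dual j)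
  (hinj : Function.Injective j) {l : M →ₗ[k] H ⊗[k] M}
  (hl : ∀ g m, X.dualMul (g ⊗ₜ j m) = j (onFst g (l m)))
  {a : M ⊗[k] H →ₗ[k] M} (ha : j ∘ₗ a = X.dualAct S ∘ₗ j.rTensor H)
include hB hinj hl

theorem onFst_counit_coact (m : M) : onFst (counit (R := k)) (l m) = m :=
  hinj (by rw [← hl, (isYDAlgebra_dual hB hH).one_mul])

variable [Module.Free k M]

/-- Associativity of H^*, dualised: `l` is a left coaction of the coalgebra (H, C⁻¹Δ). -/
theorem comulInvF_coact (m : M) : comulInvF X M (l m) = l.lTensor H (l m) := by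
  refine ext_onFst fun g => ext_onFst fun g' => hinj ?_
  rw [← onFst_dualMul hB hH, ← hl, dualMul_assoc hB hH, hl, hl, onFst_lTensor]

theorem comulInvF_toPair (z : M ⊗[k] T) :
    comulInvF X _ (toPair l z) = (toPair l).lTensor H (toPair l z) := by
  induction z using TensorProduct.induction_on with
  | zero => simp
  | add x y hx hy => simp only [map_add, hx, hy]
  | tmul m t =>
    rw [toPair_tmul, assoc_tmul_eq, toPair_lTensor, comulInvF_coact hH hB hinj hl]
    exact (under₂₂ (fun m => assoc_tmul_eq (l m) t) (l m)).symm

include hj ha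

theorem coact_act (m : M) (h : H) :
    l (a (m ⊗ₜ h)) = diagAct X Y a (TensorProduct.assoc k _ _ _ (l m ⊗ₜ comulInv X h)) := by
  have hX := hH.isYD
  have hX' := isYD_dual hB hX
  have hY := hX'.of_injective hj hinj
  refine ext_onFst fun g => hinj ?_
  have h₁ : j (a (m ⊗ₜ h)) = X.dualAct S (j m ⊗ₜ h) := congr($ha (m ⊗ₜ h))
  have h₂ : ∀ (w : H ⊗[k] M) (d : H ⊗[k] H), TensorProduct.assoc k _ _ _ (j.lTensor H w ⊗ₜ d) =
      (j.rTensor _).lTensor H (TensorProduct.assoc k _ _ _ (w ⊗ₜ d)) := by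
    intro w d
    induction w using TensorProduct.induction_on with
    | zero => simp
    | add x y hx hy => simp only [map_add, TensorProduct.add_tmul, hx, hy]
    | tmul h m => simp
  rw [← hl, h₁, dualMul_dualAct hB hH (t := j.lTensor H (l m))
    (fun g => by rw [hl, onFst_lTensor]), h₂, diagAct_naturality hB hX hY hX' hj ha,
    onFst_lTensor]

theorem toPair_onPair (z : M ⊗[k] (H ⊗[k] T)) :
    toPair l (onPair a z) = mulF k H _ (((onPair a).lTensor H).lTensor H
      ((brInv X Y).lTensor H (((comulInvF X T).lTensor M).lTensor H (toPair l z)))) := by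
  refine ext_two (p := toPair l ∘ₗ onPair a) (q := mulF k H _ ∘ₗ
    ((onPair a).lTensor H).lTensor H ∘ₗ (brInv X Y).lTensor H ∘ₗ
    ((comulInvF X T).lTensor M).lTensor H ∘ₗ toPair l) (fun m h t => ?_) z
  simp only [LinearMap.comp_apply]
  rw [toPair_tmul, lTensor_assoc, LinearMap.lTensor_tmul, toPair_tmul, ← diagAct_tail,
    ← coact_act hH hB hj hinj hl ha, onPair_tmul, toPair_tmul]

variable (hhom : Y.IsHom (X.tensor Y) l)
include hhom

/-- Composing with C turns the left coaction `l` of (H, C⁻¹Δ) into a right coaction of (H, Δ). The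
compatibility is `coact_act` after C cancels the inverse braiding in the diagonal action. -/
theorem isHopfModule_of_dual : X.IsHopfModule Y a (X.braid Y ∘ₗ l) := by
  have hX := hH.isYD
  have hX' := isYD_dual hB hX
  have hY := hX'.of_injective hj hinj
  have haHom : (Y.tensor X).IsHom Y a := by
    refine hj.of_comp_injective ?_ hinj
    rw [ha]
    exact (isHom_dualAct hB hH).comp (hj.rTensor X)
  have ha' : ∀ m h, j (a (m ⊗ₜ h)) = X.dualAct S (j m ⊗ₜ h) := fun m h => congr($ha (m ⊗ₜ h))
  refine ⟨hY, haHom, (isHom_braid hX hY).comp hhom, fun m => hinj ?_, fun m g h => hinj ?_,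
    coassoc_of_tail fun z => ?_, counit_of_tail fun z => ?_, compat_of_tail fun z => ?_⟩
  · rw [ha', dualAct_one hH]
  · rw [ha', ha', ha', dualAct_mul hH]
  · rw [toPair_braid_comp, toPair_braid_comp, ← br_toPair_right hhom hX,
      ← comulInvF_toPair hH hB hinj hl, br_comulInvF hB hH, br_toPair_left hH.comul_hom hY]
  · rw [toPair_braid_comp, ← br_onFst_left hH.counit_hom hY]
    induction z using TensorProduct.induction_on with
    | zero => simp
    | add x y hx hy => simp only [map_add, hx, hy]
    | tmul m t =>
      rw [toPair_tmul, assoc_tmul_eq, onFst_lTensor, onFst_counit_coact hH hB hinj hl]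
      rfl
  · have hD : (comulF k H k : H ⊗[k] k →ₗ[k] _) = br X X ∘ₗ comulInvF X k :=
      LinearMap.ext fun z => (br_comulInvF hB hH z).symm
    rw [toPair_braid_comp, toPair_onPair hH hB hj hinj hl ha, br_onPair_left hH.mul_hom hY,
      under₂₃ (br_onPair_right (T := k) haHom hX),
      under₂₁ (q := LinearMap.id) (br_brInv (T := H ⊗[k] k) hB hX hY), LinearMap.lTensor_id,
      LinearMap.id_apply, br_onPair_right haHom hX, toPair_braid_comp, hD]
    simp only [LinearMap.lTensor_comp, LinearMap.comp_apply]
    rw [br_lTensor, br_lTensor, onPair_lTensor]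

end HopfModule

end YDData

end

open scoped TensorProduct

noncomputable section

namespace YDData

open Coalgebra (comul counit)
open HopfAlgebra (antipode)

/-! ### The rational part is ∫ ⊗ H. -/

section Main

variable {k B H : Type*} [Field k] [Ring B] [HopfAlgebra k B] [FiniteDimensional k B]
  [Ring H] [Algebra k H] [Coalgebra k H]
  (hB : antipode k (A := B) ∘ₗ antipode k (A := B) = LinearMap.id)
  {X : YDData k B H} {S : H →ₗ[k] H} (hH : X.IsBraidedHopfAlgebra S)

omit [FiniteDimensional k B] in
theorem integrals_le_finSub [FiniteDimensional k B] (X : YDData k B H) :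
    X.integrals ≤ X.finSub := fun f hf => ⟨1 ⊗ₜ f, fun g => hf g⟩

include hB hH

/-- The coinvariants of the rational part are the integrals: since C(1 ⊗ f) = f ⊗ 1, the condition
ρ(f) = f ⊗ 1 means l(f) = 1 ⊗ f, that is g f = g(1)f for all g. -/
theorem exists_hopfModule_finSub :
    ∃ (Y : YDData k B X.finSub) (Z : YDData k B X.integrals)
      (a : X.finSub ⊗[k] H →ₗ[k] X.finSub) (ρ : X.finSub →ₗ[k] X.finSub ⊗[k] H),
      Y.IsHom X.dual X.finSub.subtype ∧ Z.IsYD ∧ Z.IsHom X.dual X.integrals.subtype ∧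
      X.finSub.subtype ∘ₗ a = X.dualAct S ∘ₗ X.finSub.subtype.rTensor H ∧
      X.finSub.subtype ∘ₗ X.inducedAct Y ρ =
        X.dualMul ∘ₗ X.finSub.subtype.lTensor (Module.Dual k H) ∧
      X.IsHopfModule Y a ρ ∧
      X.IsHopfModule (Z.tensor X)
        ((LinearMap.mul' k H).lTensor X.integrals ∘ₗ
          (TensorProduct.assoc k X.integrals H H).toLinearMap)
        ((TensorProduct.assoc k X.integrals H H).symm.toLinearMap ∘ₗ
          (comul (R := k) (A := H)).lTensor X.integrals) ∧
      ∃ e : X.finSub ≃ₗ[k] X.integrals ⊗[k] H,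
        Y.IsHom (Z.tensor X) e.toLinearMap ∧
        e.toLinearMap ∘ₗ a =
          (LinearMap.mul' k H).lTensor X.integrals ∘ₗ
            (TensorProduct.assoc k X.integrals H H).toLinearMap ∘ₗ e.toLinearMap.rTensor H ∧
        e.toLinearMap.rTensor H ∘ₗ ρ =
          (TensorProduct.assoc k X.integrals H H).symm.toLinearMap ∘ₗ
            (comul (R := k) (A := H)).lTensor X.integrals ∘ₗ e.toLinearMap := by
  have hX := hH.isYD
  have hX' := isYD_dual hB hX
  obtain ⟨Y, l, hY, hhom, hl⟩ := exists_finSub hB hH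
  obtain ⟨Z, hZ⟩ := exists_integrals hB hH
  have hYD := hX'.of_injective hY Subtype.val_injective
  have hZD := hX'.of_injective hZ Subtype.val_injective
  have hmem : ∀ z : X.finSub ⊗[k] H,
      (X.dualAct S ∘ₗ X.finSub.subtype.rTensor H) z ∈ X.finSub := by
    intro z
    induction z using TensorProduct.induction_on with
    | zero => rw [map_zero]; exact zero_mem _
    | add x y hx hy => rw [map_add]; exact add_mem hx hy
    | tmul f h => exact dualAct_mem_finSub hB hH f.2 h
  let a := (X.dualAct S ∘ₗ X.finSub.subtype.rTensor H).codRestrict X.finSub hmem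
  have ha : X.finSub.subtype ∘ₗ a = X.dualAct S ∘ₗ X.finSub.subtype.rTensor H :=
    LinearMap.subtype_comp_codRestrict _ _ hmem
  have hM : X.IsHopfModule Y a (X.braid Y ∘ₗ l) :=
    isHopfModule_of_dual hH hB hY Subtype.val_injective hl ha hhom
  have hone : ∀ f : X.finSub, X.braid Y (1 ⊗ₜ f) = f ⊗ₜ 1 := braid_one_tmul hYD hH.one_hom
  let i := Submodule.inclusion X.integrals_le_finSub
  have hi : Z.IsHom Y i := hY.of_comp_injective hZ Subtype.val_injective
  refine ⟨Y, Z, a, X.braid Y ∘ₗ l, hY, hZD, hZ, ha, ?_, hM, isHopfModule_tensor hH hZD,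
    exists_equiv_of_coinv hH hM hi (Submodule.inclusion_injective _) (fun n => ?_)
      fun m hm => ?_⟩
  · refine TensorProduct.ext' fun g f => ?_
    rw [LinearMap.comp_apply, LinearMap.comp_apply, LinearMap.lTensor_tmul,
      inducedAct_tmul hB hX hYD, LinearMap.comp_apply, braidInv_braid hB hX hYD]
    exact (hl g f).symm
  · have h : l (i n) = 1 ⊗ₜ i n := by
      refine ext_onFst fun g => Subtype.ext ?_
      rw [← hl]
      exact n.2 g
    rw [LinearMap.comp_apply, h, hone]
  · have h : l m = 1 ⊗ₜ m := by
      rw [← braidInv_braid hB hX hYD (l m), ← braidInv_braid hB hX hYD (1 ⊗ₜ m), hone, ← hm,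
        LinearMap.comp_apply]
    refine ⟨⟨m.1, fun g => ?_⟩, Subtype.ext rfl⟩
    rw [hl, h]
    rfl

end Main

end YDData

end

theorem mainTheorem4 {k B H : Type*} [Field k] [Ring B] [HopfAlgebra k B] [FiniteDimensional k B]
    (hB : HopfAlgebra.antipode k (A := B) ∘ₗ HopfAlgebra.antipode k (A := B) = LinearMap.id)
    [Ring H] [Algebra k H] [Coalgebra k H] (X : YDData k B H) (S : H →ₗ[k] H)
    (hH : X.IsBraidedHopfAlgebra S) :
    -- `H^*` is an algebra in the Yetter–Drinfeld category and the evaluation is a morphism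
    X.dual.IsYDAlgebra X.dualMul Coalgebra.counit ∧
    (X.dual.tensor X).IsHom (YDData.unit k B) (YDData.ev k H) ∧
    -- `⇀` is a morphism, and so is `h ⊗ f ↦ f(- h)`
    (X.tensor X.dual).IsHom X.dual X.harpoon ∧
    (X.tensor X.dual).IsHom X.dual (YDData.translate k H) ∧
    -- `H^{*rat}` is the maximal rational submodule
    IsGreatest {N | X.IsRationalSubmodule N} X.rat ∧
    -- if the braiding is symmetric on `H`, then `dualAct` is `↼`
    (X.braid X ∘ₗ X.braid X = LinearMap.id → X.dualAct S = X.rightHarpoon S) ∧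
    -- `H^{*rat}` and `∫^l_{H^*}` are Yetter–Drinfeld submodules of `H^*`
    ∃ (Y : YDData k B X.rat) (Z : YDData k B X.integrals)
      (a : X.rat ⊗[k] H →ₗ[k] X.rat) (ρ : X.rat →ₗ[k] X.rat ⊗[k] H),
      Y.IsHom X.dual X.rat.subtype ∧ Z.IsYD ∧ Z.IsHom X.dual X.integrals.subtype ∧
      -- `H^{*rat}` is an `H`-Hopf module: `a` is the restriction of `dualAct`, and `ρ` is dual
      -- to the left multiplication by elements of `H^*`
      X.rat.subtype ∘ₗ a = X.dualAct S ∘ₗ X.rat.subtype.rTensor H ∧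
      X.rat.subtype ∘ₗ X.inducedAct Y ρ =
        X.dualMul ∘ₗ X.rat.subtype.lTensor (Module.Dual k H) ∧
      X.IsHopfModule Y a ρ ∧
      -- `∫^l_{H^*} ⊗ H` is an `H`-Hopf module through the second factor
      X.IsHopfModule (Z.tensor X)
        ((LinearMap.mul' k H).lTensor X.integrals ∘ₗ
          (TensorProduct.assoc k X.integrals H H).toLinearMap)
        ((TensorProduct.assoc k X.integrals H H).symm.toLinearMap ∘ₗ
          (Coalgebra.comul (R := k) (A := H)).lTensor X.integrals) ∧
      -- the two are isomorphic as `H`-Hopf modules in the Yetter–Drinfeld category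
      ∃ e : X.rat ≃ₗ[k] X.integrals ⊗[k] H,
        Y.IsHom (Z.tensor X) e.toLinearMap ∧
        e.toLinearMap ∘ₗ a =
          (LinearMap.mul' k H).lTensor X.integrals ∘ₗ
            (TensorProduct.assoc k X.integrals H H).toLinearMap ∘ₗ e.toLinearMap.rTensor H ∧
        e.toLinearMap.rTensor H ∘ₗ ρ =
          (TensorProduct.assoc k X.integrals H H).symm.toLinearMap ∘ₗ
            (Coalgebra.comul (R := k) (A := H)).lTensor X.integrals ∘ₗ e.toLinearMap := by
  refine ⟨YDData.isYDAlgebra_dual hB hH, YDData.isHom_ev hB hH.isYD, YDData.isHom_harpoon hB hH,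
    YDData.isHom_translate hB hH, ?_, YDData.dualAct_eq_rightHarpoon hB hH, ?_⟩
  · rw [YDData.rat_eq_finSub hB hH]
    exact YDData.isGreatest_finSub hB hH
  · rw [YDData.rat_eq_finSub hB hH]
    exact YDData.exists_hopfModule_finSub hB hH
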